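/- **Theorem.** There is a finite connected planar graph $G$ with at most $720$ vertices whose $1$-cop-move number is exactly $4$, that is, $\mathrm{cop}_1(G)=4$. Here graphs are simple and undirected, and a graph is planar if it can be drawn in the plane with its vertices as distinct points and its edges as simple arcs between their ends, such that no arc passes through a vertex other than its ends and two distinct arcs meet only in common ends. In the $1$-cop-move game with $c$ cops on $G$, the cop player first places each of the $c$ cops at a vertex (several cops may share a vertex); then the robber player places the robber at a vertex not occupied by a cop, if there is one (otherwise the cops win). After that the two players take turns, the cop player first. On each of its turns the cop player moves at most one cop along an edge to a neighbouring vertex, or moves no cop; on each of its turns the robber player moves the robber along an edge to a neighbouring vertex or leaves it where it is. Both players always know all positions. The cops win if at some time a cop and the robber are at the same vertex; otherwise the robber wins. The number $\mathrm{cop}_1(G)$ is the least $c$ such that the cop player has a winning strategy in the $1$-cop-move game with $c$ cops on $G$. -/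

import Mathlib

namespace CopsRobber

/-- A drawing of a graph in the plane without crossings: distinct vertices are distinct points,
every edge is a simple arc joining the points of its two ends, an arc passes through no vertex
other than its ends, and two different arcs meet only in common ends. -/
structure PlaneDrawing {V : Type*} (G : SimpleGraph V) where
  /-- The point that represents a vertex. -/
  point : V → ℝ × ℝ
  /-- The arc that represents an edge. -/
  arc : G.edgeSet → C(unitInterval, ℝ × ℝ)
  point_injective : Function.Injective point
  arc_injective : ∀ e, Function.Injective (arc e)
  arc_ends : ∀ e, s(arc e 0, arc e 1) = (e : Sym2 V).map point
  arc_vertex : ∀ e t v, arc e t = point v → v ∈ (e : Sym2 V)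
  arc_arc : ∀ e f, e ≠ f → ∀ t u, arc e t = arc f u →
    ∃ v, v ∈ (e : Sym2 V) ∧ v ∈ (f : Sym2 V) ∧ arc e t = point v

/-- A graph is planar if it can be drawn in the plane without crossings. -/
def IsPlanar {V : Type*} (G : SimpleGraph V) : Prop :=
  Nonempty (PlaneDrawing G)

/-- A step of a single piece: it stays, or it moves along an edge. -/
def Step {V : Type*} (G : SimpleGraph V) (x y : V) : Prop :=
  x = y ∨ G.Adj x y

/-- A turn of the cop player, taking the cops from positions `p` to positions `q`: every cop makes
a step, and at most `k` cops change position. Several cops may share a vertex. -/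
def CopTurn {V : Type*} (G : SimpleGraph V) (k : ℕ) {c : ℕ} (p q : Fin c → V) : Prop :=
  (∀ i, Step G (p i) (q i)) ∧ {i | p i ≠ q i}.ncard ≤ k

/-- A (history-dependent) strategy of the cop player in the `k`-cop-move game with `c` cops.
`pos h` is the placement of the cops after they have reacted to the sequence `h` of positions
which the robber has taken so far, in chronological order; in particular `pos []` is the initial
placement of the cops. Every reaction has to be a legal turn. -/
structure CopStrategy {V : Type*} (G : SimpleGraph V) (k c : ℕ) where
  pos : List V → Fin c → V
  legal : ∀ (h : List V) (x : V), CopTurn G k (pos h) (pos (h ++ [x]))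

/-- The placement of the cops after their first `n` turns, if they follow `σ` and the robber is
placed at `r 0` and is at `r i` after its `i`-th turn. -/
def CopStrategy.cops {V : Type*} {G : SimpleGraph V} {k c : ℕ} (σ : CopStrategy G k c)
    (r : ℕ → V) (n : ℕ) : Fin c → V :=
  σ.pos ((List.range n).map r)

/-- The strategy `σ` is winning: wherever the robber is placed off the initial vertices of the
cops, and however it then moves, at some time it is at the same vertex as a cop, either after its
own turn (first alternative) or after the next turn of the cops (second alternative). The cops have
the first turn after the placement. -/
def CopStrategy.Wins {V : Type*} {G : SimpleGraph V} {k c : ℕ} (σ : CopStrategy G k c) : Prop :=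
  ∀ r : ℕ → V, (∀ i, σ.cops r 0 i ≠ r 0) → (∀ n, Step G (r n) (r (n + 1))) →
    ∃ n i, σ.cops r n i = r n ∨ σ.cops r (n + 1) i = r n

/-- The cops have a winning strategy in the `k`-cop-move game with `c` cops on `G`. -/
def CopsWin {V : Type*} (G : SimpleGraph V) (k c : ℕ) : Prop :=
  ∃ σ : CopStrategy G k c, σ.Wins

/-- The `k`-cop-move number of `G`: the least number of cops with which the cop player wins the
`k`-cop-move game on `G`. (On a finite graph such a number exists.) -/
noncomputable def copMoveNumber {V : Type*} (G : SimpleGraph V) (k : ℕ) : ℕ :=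
  sInf {c : ℕ | CopsWin G k c}

end CopsRobber

/-! The witness is the chiral icosahedral fullerene with 140 vertices. It is cubic, and its
automorphisms carry every vertex to one of 0, 1, 2. The robber may therefore always be assumed to
stand at one of these three representatives: after each of its moves the whole position is turned
back by an automorphism. What remains is finite and is settled by certificates that the kernel
evaluates.

One set of positions serves both bounds. A position of three cops and a robber at a representative,
with the cops to move, is bad if a cop is within distance one of the robber or if the unordered
triple of cops occurs in `traps0`, `traps1`, `traps2`. Each listed position stores a value and a cop
move. The move captures the robber or leaves it only replies that lead to capture, to a cop within
distance one, or to listed positions of smaller value. Hence three cops win from every bad position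
(`caught_of_bad`). The list is also complete: from a position that is not bad, whatever turn the
cops take, the robber has a reply to a position that is not bad (`bad_of_lost_of_step`,
`Safe.exists_step`). Completeness does not require a search through all positions. The robber may
stay, so a position all of whose replies are bad is bad itself, and only the predecessors of bad
positions have to be examined.

Lower bound: being not bad is thus an invariant that the robber can keep, and
`not_copsWin_of_invariant` turns it into the failure of every strategy of three cops. The robber can
also enter it at the start. A bad position has a cop within distance five of the robber, one cop is
that close to at most 43 vertices, and three cops account for at most 129 of the 140
(`exists_safe`).

Upper bound: from the vertices 22, 56, 84, 117 a second list of ranked positions, `chases0`,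
`chases1`, `chases2`, leads four cops to a position in which three of them already win
(`caught_of_chase`). The passage from forced captures to a strategy is `copsWin_of_forall_caught`.

Planarity comes from a drawing with straight edges and integer coordinates. Disjoint edges are
separated by lines, and two edges with a common end are not collinear (`isPlanar_of_segments`). -/

namespace CopsRobber

/-! ### Forced captures and evasion invariants on an arbitrary graph. -/

section Game

variable {V W : Type*} {G : SimpleGraph V} {c d : ℕ}

theorem Step.refl (x : V) : Step G x x := Or.inl rfl

theorem Step.map (φ : G ≃g G) {x y : V} (h : Step G x y) : Step G (φ x) (φ y) :=
  h.elim (fun e => Or.inl (congrArg φ e)) fun e => Or.inr (φ.map_rel_iff.2 e)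

theorem CopTurn.refl (k : ℕ) (p : Fin c → V) : CopTurn G k p p :=
  ⟨fun i => Step.refl _, by simp⟩

theorem CopTurn.update {p : Fin c → V} {j : Fin c} {x : V} (h : Step G (p j) x) :
    CopTurn G 1 p (Function.update p j x) := by
  constructor
  · intro i
    by_cases hi : i = j
    · subst hi; simpa using h
    · simpa [hi] using Step.refl (p i)
  · have : {i | p i ≠ Function.update p j x i} ⊆ {j} := by
      intro i hi
      by_contra hij
      exact hi (by simp [show i ≠ j from hij])
    simpa using Set.ncard_le_ncard this

/-- Having at least one cop provides an index to name even when the turn moves nobody. -/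
theorem CopTurn.exists_forall_ne {p q : Fin (c + 1) → V} (h : CopTurn G 1 p q) :
    ∃ j, Step G (p j) (q j) ∧ ∀ i, i ≠ j → q i = p i := by
  by_cases hpq : ∃ j, p j ≠ q j
  · obtain ⟨j, hj⟩ := hpq
    refine ⟨j, h.1 j, fun i hi => ?_⟩
    by_contra hne
    exact hi ((Set.ncard_le_one (Set.toFinite _)).1 h.2 i (fun e => hne e.symm) j hj)
  · push Not at hpq
    exact ⟨0, h.1 0, fun i _ => (hpq i).symm⟩

theorem CopTurn.map (φ : G ≃g G) {k : ℕ} {p q : Fin c → V} (h : CopTurn G k p q) :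
    CopTurn G k (φ ∘ p) (φ ∘ q) :=
  ⟨fun i => (h.1 i).map φ, by simpa using h.2⟩

/-- With the cops to move at `p` and the robber at `r`, the cops can catch the robber within `n`
of their turns. -/
def WinIn (G : SimpleGraph V) : ℕ → (Fin c → V) → V → Prop
  | 0, _, _ => False
  | n + 1, p, r => ∃ q, CopTurn G 1 p q ∧
      ((∃ i, q i = r) ∨ ∀ r', Step G r r' → (∃ i, q i = r') ∨ WinIn G n q r')

theorem WinIn.succ : ∀ {n : ℕ} {p : Fin c → V} {r : V}, WinIn G n p r → WinIn G (n + 1) p r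
  | 0, _, _, h => h.elim
  | _ + 1, _, _, ⟨q, hq, h⟩ =>
    ⟨q, hq, h.imp_right fun h r' hr => (h r' hr).imp_right WinIn.succ⟩

theorem WinIn.mono {n m : ℕ} (hnm : n ≤ m) {p : Fin c → V} {r : V} (h : WinIn G n p r) :
    WinIn G m p r := by
  induction hnm with
  | refl => exact h
  | step _ ih => exact ih.succ

/-- The winning turn in the image position is pulled back along `φ.symm`. This is what allows the
tables to treat only three positions of the robber. -/
theorem WinIn.of_map (φ : G ≃g G) : ∀ {n : ℕ} {p : Fin c → V} {r : V},
    WinIn G n (φ ∘ p) (φ r) → WinIn G n p r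
  | 0, _, _, h => h
  | n + 1, p, r, ⟨q, hq, h⟩ => by
    have key : φ ∘ (φ.symm ∘ q) = q := by ext i; simp
    refine ⟨φ.symm ∘ q, ?_, ?_⟩
    · have := hq.map φ.symm
      rwa [show φ.symm ∘ φ ∘ p = p by ext i; simp] at this
    · refine h.imp (fun ⟨i, hi⟩ => ⟨i, by simp [hi]⟩) fun h r' hr => ?_
      refine (h (φ r') (hr.map φ)).imp (fun ⟨i, hi⟩ => ⟨i, by simp [hi]⟩) fun h' => ?_
      exact WinIn.of_map φ (by rwa [key])

/-- Cops may be renumbered, and further cops may be added. -/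
theorem WinIn.of_comp {f : Fin c → Fin d} (hf : Function.Injective f) :
    ∀ {n : ℕ} {p : Fin d → V} {r : V}, WinIn G n (p ∘ f) r → WinIn G n p r
  | 0, _, _, h => h
  | n + 1, p, r, ⟨q, hq, h⟩ => by
    -- `Function.extend f q p` makes the cops in the range of `f` follow the known turn and leaves
    -- all others standing.
    have key : Function.extend f q p ∘ f = q := funext fun i => hf.extend_apply q p i
    refine ⟨Function.extend f q p, ⟨fun j => ?_, ?_⟩, ?_⟩
    · by_cases hj : ∃ i, f i = j
      · obtain ⟨i, rfl⟩ := hj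
        rw [hf.extend_apply]
        exact hq.1 i
      · rw [Function.extend_apply' _ _ _ hj]
        exact Step.refl _
    · refine le_trans ?_ hq.2
      rw [← Set.ncard_image_of_injective _ hf]
      refine Set.ncard_le_ncard ?_ (Set.toFinite _)
      intro j hj
      by_cases hj' : ∃ i, f i = j
      · obtain ⟨i, rfl⟩ := hj'
        exact ⟨i, by simpa [hf.extend_apply] using hj, rfl⟩
      · exact absurd (Function.extend_apply' q p j hj').symm hj
    · refine h.imp (fun ⟨i, hi⟩ => ⟨f i, by rw [hf.extend_apply, hi]⟩) fun h r' hr => ?_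
      refine (h r' hr).imp (fun ⟨i, hi⟩ => ⟨f i, by rw [hf.extend_apply, hi]⟩) fun h' => ?_
      exact WinIn.of_comp hf (by rwa [key])

/-- With the cops to move at `p` and the robber at `r`, the cops can force a capture in a bounded
number of turns. -/
def Win (G : SimpleGraph V) (p : Fin c → V) (r : V) : Prop := ∃ n, WinIn G n p r

theorem Win.of_map (φ : G ≃g G) {p : Fin c → V} {r : V} (h : Win G (φ ∘ p) (φ r)) : Win G p r :=
  h.imp fun _ => WinIn.of_map φ

theorem Win.of_comp {f : Fin c → Fin d} (hf : Function.Injective f) {p : Fin d → V} {r : V}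
    (h : Win G (p ∘ f) r) : Win G p r :=
  h.imp fun _ => WinIn.of_comp hf

theorem Win.of_capture {p : Fin c → V} {r : V} {i : Fin c} (h : Step G (p i) r) : Win G p r :=
  ⟨1, Function.update p i r, CopTurn.update h, Or.inl ⟨i, by simp⟩⟩

/-- Each reply of the robber may need its own number of turns. Finiteness of the graph bounds these
numbers, and `WinIn.mono` then makes one number serve all replies. -/
theorem Win.of_turn [Finite V] {p q : Fin c → V} {r : V} (hq : CopTurn G 1 p q)
    (h : (∃ i, q i = r) ∨ ∀ r', Step G r r' → (∃ i, q i = r') ∨ Win G q r') : Win G p r := by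
  classical
  rcases h with h | h
  · exact ⟨1, q, hq, Or.inl h⟩
  · have : ∀ r', ∃ n, Step G r r' → (∃ i, q i = r') ∨ WinIn G n q r' := fun r' => by
      by_cases hr : Step G r r'
      · rcases h r' hr with h | ⟨n, h⟩
        exacts [⟨0, fun _ => Or.inl h⟩, ⟨n, fun _ => Or.inr h⟩]
      · exact ⟨0, fun h => absurd h hr⟩
    choose n hn using this
    obtain ⟨m, hm⟩ := (Set.finite_range n).bddAbove
    exact ⟨m + 1, q, hq, Or.inr fun r' hr =>
      (hn r' hr).imp_right (WinIn.mono (hm ⟨r', rfl⟩))⟩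

open Classical in
/-- A reply of the cops that brings a forced capture nearer whenever there is one. -/
noncomputable def bestReply (G : SimpleGraph V) (p : Fin c → V) (r : V) : Fin c → V :=
  if h : ∃ q, CopTurn G 1 p q ∧ ((∃ i, q i = r) ∨ ∀ r', Step G r r' → (∃ i, q i = r') ∨
    ∃ n, WinIn G n q r' ∧ ∀ m, WinIn G m p r → n < m) then h.choose else p

theorem copTurn_bestReply (p : Fin c → V) (r : V) : CopTurn G 1 p (bestReply G p r) := by
  unfold bestReply
  split_ifs with h
  exacts [h.choose_spec.1, CopTurn.refl 1 p]

/-- The first turn of a shortest forced capture satisfies the condition in `bestReply`, so the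
chosen reply has the required property. That property compares with every length that works for the
old state, hence in particular with the given `n`. -/
theorem WinIn.bestReply {n : ℕ} {p : Fin c → V} {r : V} (h : WinIn G n p r) :
    (∃ i, bestReply G p r i = r) ∨ ∀ r', Step G r r' → (∃ i, bestReply G p r i = r') ∨
      ∃ m < n, WinIn G m (bestReply G p r) r' := by
  classical
  have hex : ∃ n, WinIn G n p r := ⟨n, h⟩
  have hmin := Nat.find_spec hex
  obtain ⟨k, hk⟩ : ∃ k, Nat.find hex = k + 1 :=
    Nat.exists_eq_succ_of_ne_zero fun e => by rw [e] at hmin; exact hmin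
  rw [hk] at hmin
  obtain ⟨q, hq, hq'⟩ := hmin
  have hne : ∃ q, CopTurn G 1 p q ∧ ((∃ i, q i = r) ∨ ∀ r', Step G r r' → (∃ i, q i = r') ∨
      ∃ n, WinIn G n q r' ∧ ∀ m, WinIn G m p r → n < m) :=
    ⟨q, hq, hq'.imp_right fun h' r' hr => (h' r' hr).imp_right fun hw =>
      ⟨k, hw, fun m hm => by have := Nat.find_min' hex hm; omega⟩⟩
  have hb : CopsRobber.bestReply G p r = hne.choose := by
    unfold CopsRobber.bestReply
    exact dif_pos hne
  rw [hb]
  exact hne.choose_spec.2.imp_right fun h' r' hr => (h' r' hr).imp_right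
    fun ⟨m, hm, hlt⟩ => ⟨m, hlt n h, hm⟩

/-- If the cops can force a capture from one placement, wherever the robber is placed, then they
have a winning strategy. -/
theorem copsWin_of_forall_win (p₀ : Fin c → V) (h : ∀ r, (∀ i, p₀ i ≠ r) → Win G p₀ r) :
    CopsWin G 1 c := by
  -- The strategy is positional: folding `bestReply` over the robber's history recomputes the
  -- current placement.
  refine ⟨⟨fun l => l.foldl (bestReply G) p₀, fun l x => ?_⟩, fun r h0 hr => ?_⟩
  · rw [List.foldl_append]
    exact copTurn_bestReply _ x
  · set σ : CopStrategy G 1 c := ⟨fun l => l.foldl (bestReply G) p₀, _⟩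
    have hsucc : ∀ n, σ.cops r (n + 1) = bestReply G (σ.cops r n) (r n) := fun n => by
      simp [CopStrategy.cops, σ, List.range_succ]
    -- Induction on the number `m` of turns still needed, which drops in every round without a
    -- capture.
    have main : ∀ m n, WinIn G m (σ.cops r n) (r n) →
        ∃ n i, σ.cops r n i = r n ∨ σ.cops r (n + 1) i = r n := by
      intro m
      induction m using Nat.strong_induction_on with
      | _ m ih =>
        intro n hw
        have hb := hw.bestReply
        rw [← hsucc] at hb
        rcases hb with ⟨i, hi⟩ | hb
        · exact ⟨n, i, Or.inr hi⟩
        · rcases hb _ (hr n) with ⟨i, hi⟩ | ⟨m', hm', hw'⟩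
          · exact ⟨n + 1, i, Or.inl hi⟩
          · exact ih m' hm' (n + 1) hw'
    obtain ⟨m, hm⟩ := h (r 0) h0
    exact main m 0 hm

/-- If the robber has a set of safe positions which it can enter at the beginning and in which it
can stay, then the cops have no winning strategy. -/
theorem not_copsWin_of_invariant (S : (Fin c → V) → V → Prop) (start : ∀ p, ∃ r, S p r)
    (safe : ∀ p r, S p r → ∀ i, ¬ Step G (p i) r)
    (next : ∀ p q r, S p r → CopTurn G 1 p q → ∃ r', Step G r r' ∧ S q r') :
    ¬ CopsWin G 1 c := by
  rintro ⟨σ, hσ⟩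
  choose f hf using start
  -- The hypotheses are moved behind the existential, so that `choose` gives a reply function `g` of
  -- three positions alone, fit for a recursion.
  have next' : ∀ p q r, ∃ r', S p r → CopTurn G 1 p q → Step G r r' ∧ S q r' := fun p q r => by
    by_cases h : S p r ∧ CopTurn G 1 p q
    · obtain ⟨r', hr'⟩ := next p q r h.1 h.2
      exact ⟨r', fun _ _ => hr'⟩
    · exact ⟨r, fun h₁ h₂ => absurd ⟨h₁, h₂⟩ h⟩
  choose g hg using next'
  -- The play against `σ` is defined by recursion on pairs: the robber's positions before time `n`,
  -- and its position at time `n`.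
  let s : ℕ → List V × V := fun n => Nat.rec ([], f (σ.pos []))
    (fun _ t => (t.1 ++ [t.2], g (σ.pos t.1) (σ.pos (t.1 ++ [t.2])) t.2)) n
  let r : ℕ → V := fun n => (s n).2
  have hs : ∀ n, (s n).1 = (List.range n).map r := fun n => by
    induction n with
    | zero => rfl
    | succ n ih =>
      have : (s (n + 1)).1 = (s n).1 ++ [(s n).2] := rfl
      rw [this, ih, List.range_succ, List.map_append]
      rfl
  have hturn : ∀ n, CopTurn G 1 (σ.cops r n) (σ.cops r (n + 1)) := fun n => by
    have := σ.legal ((List.range n).map r) (r n)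
    simpa [CopStrategy.cops, List.range_succ] using this
  have hr : ∀ n, r (n + 1) = g (σ.cops r n) (σ.cops r (n + 1)) (r n) := fun n => by
    have : r (n + 1) = g (σ.pos (s n).1) (σ.pos ((s n).1 ++ [(s n).2])) (s n).2 := rfl
    rw [this, hs n]
    simp [CopStrategy.cops, List.range_succ, r]
  have hS : ∀ n, S (σ.cops r n) (r n) := fun n => by
    induction n with
    | zero => exact hf _
    | succ n ih =>
      rw [hr]
      exact (hg _ _ _ ih (hturn n)).2
  -- Both kinds of capture contradict `safe`: a cop that shares the robber's vertex, and a cop whose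
  -- next turn reaches it, are each within one step of a safe robber.
  obtain ⟨n, i, h | h⟩ := hσ r (fun i h => safe _ _ (hS 0) i (Or.inl h)) fun n => by
    rw [hr]
    exact (hg _ _ _ (hS n) (hturn n)).1
  · exact safe _ _ (hS n) i (Or.inl h)
  · exact safe _ _ (hS n) i (h ▸ (hturn n).1 i)

/-- The extra cop stands at an arbitrary vertex for ever, so no turn moves more cops than before. -/
theorem CopsWin.succ [Nonempty V] {k : ℕ} (h : CopsWin G k c) : CopsWin G k (c + 1) := by
  obtain ⟨σ, hσ⟩ := h
  let x : V := Classical.arbitrary V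
  refine ⟨⟨fun l => Fin.snoc (σ.pos l) x, fun l y => ⟨fun i => ?_, ?_⟩⟩, fun r h0 hr => ?_⟩
  · refine Fin.lastCases ?_ (fun j => ?_) i
    · simpa using Step.refl x
    · simpa using (σ.legal l y).1 j
  · refine le_trans ?_ (σ.legal l y).2
    rw [← Set.ncard_image_of_injective _ (Fin.castSucc_injective c)]
    refine Set.ncard_le_ncard ?_ (Set.toFinite _)
    intro i
    refine Fin.lastCases (fun hi => by simp at hi) (fun j hj => ⟨j, by simpa using hj, rfl⟩) i
  · obtain ⟨n, i, hi⟩ := hσ r (fun i => by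
      simpa [CopStrategy.cops] using h0 i.castSucc) hr
    exact ⟨n, i.castSucc, by simpa [CopStrategy.cops] using hi⟩

theorem CopsWin.mono [Nonempty V] {k : ℕ} (hcd : c ≤ d) (h : CopsWin G k c) : CopsWin G k d := by
  induction hcd with
  | refl => exact h
  | step _ ih => exact ih.succ

/-- A win with fewer cops would give a win with `n` of them by adding idle cops. The infimum is
attained because `hwin` makes the set nonempty. -/
theorem copMoveNumber_eq_succ [Nonempty V] {k n : ℕ} (hwin : CopsWin G k (n + 1))
    (hlose : ¬ CopsWin G k n) : copMoveNumber G k = n + 1 :=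
  le_antisymm (Nat.sInf_le hwin) <| by
    by_contra hlt
    exact hlose (CopsWin.mono (Nat.lt_succ_iff.1 (not_le.1 hlt)) (Nat.sInf_mem (s := {c | CopsWin G k c}) ⟨_, hwin⟩))

end Game

/-! ### Placements of cops as lists, regarded up to order. -/

section Lists

variable {V : Type*} {G : SimpleGraph V}

/-- This expresses a permutation as an injection of indices, the form in which `Win.of_comp`
renumbers cops. -/
theorem _root_.List.Perm.exists_injective_get {α : Type*} {l l' : List α} (h : l.Perm l') :
    ∃ f : Fin l.length → Fin l'.length, Function.Injective f ∧ ∀ i, l'.get (f i) = l.get i := by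
  induction h with
  | nil => exact ⟨id, Function.injective_id, fun _ => rfl⟩
  | @cons a l l' _ ih =>
    obtain ⟨f, hf, hg⟩ := ih
    refine ⟨Fin.cons 0 (Fin.succ ∘ f), ?_, ?_⟩
    · refine Fin.cons_injective_iff.2 ⟨?_, (Fin.succ_injective _).comp hf⟩
      rintro ⟨i, hi⟩
      exact Fin.succ_ne_zero _ hi
    · intro i
      refine Fin.cases ?_ (fun i => ?_) i
      · rfl
      · exact hg i
  | swap a b l =>
    refine ⟨Equiv.swap (0 : Fin (l.length + 2)) 1, (Equiv.swap _ _).injective, ?_⟩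
    intro i
    refine Fin.cases ?_ (fun i => Fin.cases ?_ (fun i => ?_) i) i
    · simp [Equiv.swap_apply_left]
    · simp
    · have : Equiv.swap (0 : Fin (l.length + 2)) 1 i.succ.succ = i.succ.succ :=
        Equiv.swap_apply_of_ne_of_ne (Fin.succ_ne_zero _) fun h =>
          Fin.succ_ne_zero i (Fin.succ_injective _ h)
      simp [this]
  | trans _ _ ih₁ ih₂ =>
    obtain ⟨f, hf, hf'⟩ := ih₁
    obtain ⟨g, hg, hg'⟩ := ih₂
    exact ⟨g ∘ f, hg.comp hf, fun i => (hg' _).trans (hf' i)⟩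

/-- The cops standing on the vertices listed in `l` can force a capture of the robber at `r`. -/
def Caught (G : SimpleGraph V) (l : List V) (r : V) : Prop := Win G l.get r

theorem Caught.perm {l l' : List V} (h : l.Perm l') {r : V} (hw : Caught G l r) :
    Caught G l' r := by
  obtain ⟨f, hf, hg⟩ := h.exists_injective_get
  exact Win.of_comp hf (by rwa [show l'.get ∘ f = l.get from funext hg])

theorem Caught.sublist {l l' : List V} (h : l.Sublist l') {r : V} (hw : Caught G l r) :
    Caught G l' r := by
  obtain ⟨f, hf⟩ := List.sublist_iff_exists_fin_orderEmbedding_get_eq.1 h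
  exact Win.of_comp f.injective (by rwa [show l'.get ∘ f = l.get from funext fun i => (hf i).symm])

theorem Caught.of_map (φ : G ≃g G) {l : List V} {r : V} (h : Caught G (l.map φ) (φ r)) :
    Caught G l r := by
  refine Win.of_map φ ?_
  have hl : (l.map φ).length = l.length := List.length_map _
  refine Win.of_comp (f := Fin.cast hl) (Fin.cast_injective _) ?_
  have : (φ ∘ l.get) ∘ Fin.cast hl = (l.map φ).get := by
    ext i
    simp
  rwa [this]

theorem Caught.of_step {l : List V} {x r : V} (hx : x ∈ l) (h : Step G x r) : Caught G l r := by
  obtain ⟨i, rfl⟩ := List.get_of_mem hx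
  exact Win.of_capture h

/-- Treating only the cop at the head of the list is enough, since `Caught.perm` can bring any cop
there. -/
theorem Caught.of_turn [Finite V] {l : List V} {x y r : V} (hxy : Step G x y)
    (h : r ∈ y :: l ∨ ∀ r', Step G r r' → r' ∈ y :: l ∨ Caught G (y :: l) r') :
    Caught G (x :: l) r := by
  have hq : (y :: l).get = Function.update (x :: l).get 0 y := by
    ext i
    refine Fin.cases ?_ (fun i => ?_) i
    · rfl
    · rw [Function.update_of_ne (Fin.succ_ne_zero i)]
      rfl
  have hmem : ∀ z, z ∈ y :: l → ∃ i, Function.update (x :: l).get 0 y i = z := fun z hz => by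
    obtain ⟨i, hi⟩ := List.get_of_mem hz
    exact ⟨i, hq ▸ hi⟩
  refine Win.of_turn (q := Function.update (x :: l).get 0 y) (CopTurn.update hxy) ?_
  refine h.imp (hmem r) fun h r' hr => (h r' hr).imp (hmem r') fun h' => ?_
  rw [← hq]
  exact h'

theorem copsWin_of_forall_caught (l : List V) (h : ∀ r, r ∉ l → Caught G l r) :
    CopsWin G 1 l.length :=
  copsWin_of_forall_win l.get fun r hr => h r fun hm => by
    obtain ⟨i, hi⟩ := List.get_of_mem hm
    exact hr i hi

end Lists

/-! ### Tables: the graph, its automorphisms, and the positions won by three cops. -/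

/-- Binary search trees that store values at keys. -/
inductive BT
  | nil
  | leaf (k v : ℕ)
  | node (l : BT) (k v : ℕ) (r : BT)
/-- The identity. In the tables that follow, the value at the vertex `i` is the `i`-th byte. -/
noncomputable def tabId : ℕ := 0x8b8a898887868584838281807f7e7d7c7b7a797877767574737271706f6e6d6c6b6a696867666564636261605f5e5d5c5b5a595857565554535251504f4e4d4c4b4a494847464544434241403f3e3d3c3b3a393837363534333231302f2e2d2c2b2a292827262524232221201f1e1d1c1b1a191817161514131211100f0e0d0c0b0a09080706050403020100

/-- A rotation about the vertex `0`. -/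
noncomputable def tabRho : ℕ := 0x898a84858378798b8287867c7b7a6c6e776d88817f7d71706f5e606b5f807e767472646362614f52515d5075736a6765565554534043424e416968665c5957474645443134323f335b5a584d4a483837363524272530264c494b3e3b392a2928181a19233d3a3c2f2c2b1d1c1b0e100f162e2d221e1f121106070c212017131409080205150d0a03010b0400

/-- The inverse rotation about the vertex `0`. -/
noncomputable def tabRhoInv : ℕ := 0x848a8b79828188898783786e776d76807f7e85867b6c606b5f6a7574737c7a7d705e52515d505c69686766716f72624f43424e414d5b5a595864636165544034323f333e4c4b4a49565553574531272530262f3d3c3b3a4744464836241a1923222e2d2c383537392818100f161721201f2a292b0e1b070c0d15141d1c1e061102050b0a1213080104090300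

/-- A rotation about a pentagonal face that contains the vertex `2`. -/
noncomputable def tabSigma : ℕ := 0x857c7189867d727a647b838a878b746556576f637078847f88675947486162556c7982817e80664a3b38395354465e6e7776737558492c2a2b44454f37606d6b6a68694b3a1f1d1e35364029525f5d5c5a5b3c2d1412132843311c51504e4d4c2e200a091b34241142413f3e3d211504031827083332302f170b000e1a06262523220d011002191605070f0c

/-- The inverse rotation about the pentagonal face. -/
noncomputable def tabSigmaInv : ℕ := 0x7e8088737f878b75816968667467868a82846a765b5a587d59858977795c4d6b4c4b494a72657c83786d6e4e3e5d3d3c3a3b71577a7b6c5f603f302f502e2d2c4864566f705e51523323224121201f39634761624f42432617163215142b385553544034190d0c250b0a1e2a46444531270f051a13041d37353624070110090012292818020e031c1b060811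

/-- A half-turn about the edge from `1` to `5`. -/
noncomputable def tabTau : ℕ := 0x7a7c856f7b838971866463617062788a878b727d5655536c5479847f88655774474644455e4f6e82817e805948673837353660406d777673754a3b39662a29283152435f6b6a6869492c2b581d1c1b245134505d5c5a5b3a1e1f4b1211182742414e4d4c2d13143c09080e1a32333f3e3d200a2e0603102526302f1504210200071923220b17010f160d050c

/-- The bytes `3 * v`, `3 * v + 1`, `3 * v + 2` are the neighbours of `v`. -/
noncomputable def tabNbr : ℕ := 0x8a88878b89848a85838b81808b867f87857d89867c8a8279897b78848177888276887e75877e74807f73867472857a71837a707c7b6f84786e83796c826d6b816b6a806a697f7d677e68667d71657c72647b6c627a6361796d60776e5f78705e77765d76755c75685b73695a7466597367587259577163566f64557061546f62536e5e526d51506c604f6b504e6a4e4d694d4c684c4b67654a664b49655648645747634746624f456146446051435f52425f5d415e54405d5c3f5c5b3e5b5a3d5a583c59493b584a3a573b395655385553375444365345355240345134325033324f43314e33304d302f4c2f2e4b2e2d4a482c492d2c48382b47392a462a29453128442928434227413f264241254036243f3e233e3d223d3c213c3a203b3a1f391f1e38371d37351c36351b34241a332319321a193127183026162f17162e17152d1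5142c2b142b1d132a1e1229121128181127251026250f241b0e22210d23220c21200b201f0a1e0a091d1c091c1b081a0e07190c07181006170b05160f05150d04141304131203110603100f020e08020d0c010b0a00090800070601050200040301

/-- The number of a generator that brings a vertex nearer to a representative of its orbit. -/
noncomputable def tabStep : ℕ := 0x404040504030304040405050505010303030404040505020201010303040403040505020202010103030303040304050502020201010303030304040304050502020201010303030304040304050505010201010303030304040305050502010103030303040403050505020101030303040403050502010103030404030504020101030403050201000000

set_option maxRecDepth 100000 in
/-- States with the robber at `0` in which three cops win: the key holds the sorted positions of the
cops, and the value is `16 * n + m`, where `m` is the code of a good turn and `n` the number of turns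
that are left. -/
noncomputable def traps0 : BT :=
  (.node (.node (.node (.node (.node (.node (.node (.node (.node (.node (.leaf 132618 37) 132619 37 .nil) 133130
  17 (.leaf 133131 17)) 133133 40 (.node (.leaf 133139 40) 133140 39 (.leaf 133141 39))) 133152 145 (.node
  (.node (.leaf 133386 17) 133387 17 (.leaf 133389 40)) 133395 40 (.node (.leaf 133396 39) 133397 39 (.leaf
  133399 97)))) 133408 113 (.node (.node (.node (.leaf 133409 81) 133420 289 (.leaf 133421 129)) 133422 97
  (.node (.leaf 133423 177) 133434 177 (.leaf 133435 305))) 133436 161 (.node (.node (.leaf 133437 161) 133450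
  449 (.leaf 133451 225)) 133452 193 (.node (.leaf 133453 321) 133649 39 (.leaf 133650 39))))) 133651 39 (.node
  (.node (.node (.node (.leaf 133656 136) 133659 113 (.leaf 133660 113)) 133661 84 (.node (.leaf 133662 100)
  133668 313 (.leaf 133672 135))) 133673 132 (.node (.node (.leaf 133674 100) 133681 241 (.leaf 133685 152))
  133686 241 (.node (.leaf 133687 151) 133688 164 (.leaf 133689 180)))) 133696 311 (.node (.node (.node (.leaf
  133700 167) 133701 295 (.leaf 133702 167)) 133703 196 (.node (.leaf 133711 456) 133715 455 (.leaf 133716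
  311))) 133719 324 (.node (.node (.leaf 133730 455) 133905 39 (.leaf 133906 39)) 133907 39 (.node (.leaf 133916
  116) 133917 84 (.leaf 133918 100)))))) 133928 292 (.node (.node (.node (.node (.node (.leaf 133929 132) 133930
  100 (.leaf 133941 180)) 133942 308 (.node (.leaf 133943 164) 133944 164 (.leaf 133945 180))) 133957 452 (.node
  (.node (.leaf 133958 228) 133959 196 (.leaf 133975 324)) 134418 149 (.node (.leaf 134428 133) 134429 165
  (.leaf 134441 181)))) 135443 120 (.node (.node (.node (.leaf 135444 119) 135445 214 (.leaf 135456 193)) 135699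
  152 (.node (.leaf 135700 151) 135701 148 (.leaf 135703 248))) 135712 132 (.node (.node (.leaf 135713 164)
  135725 180 (.leaf 135726 247)) 135957 148 (.node (.leaf 135963 133) 135964 133 (.leaf 135965 165))))) 135968
  132 (.node (.node (.node (.node (.leaf 135969 164) 135976 245 (.leaf 135977 149)) 135981 180 (.node (.leaf
  135985 309) 135989 165 (.leaf 135990 293))) 135991 165 (.node (.node (.leaf 136004 453) 136005 309 (.leaf
  136020 453)) 136219 132 (.node (.leaf 136220 132) 136221 164 (.leaf 136232 244)))) 136233 148 (.node (.node
  (.node (.leaf 136241 308) 136245 164 (.leaf 136246 292)) 136247 164 (.node (.leaf 136260 452) 136261 308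
  (.leaf 136276 452))) 136476 132 (.node (.node (.leaf 136477 164) 136478 248 (.leaf 136488 280)) 136489 180
  (.node (.leaf 136490 247) 136501 248 (.leaf 136503 247))))))) 136516 279 (.node (.node (.node (.node (.node
  (.node (.leaf 136518 263) 136989 261 (.leaf 137001 277)) 138272 177 (.node (.leaf 138273 215) 138285 193
  (.leaf 138528 180))) 138529 244 (.node (.node (.leaf 138541 199) 138542 263 (.leaf 138784 197)) 138785 261
  (.node (.leaf 139304 280) 139305 193 (.leaf 139306 199)))) 139317 248 (.node (.node (.node (.leaf 139319 247)
  139332 279 (.leaf 139334 263)) 139561 244 (.node (.leaf 139562 263) 139573 276 (.leaf 139575 260))) 141613 247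
  (.node (.node (.leaf 141614 279) 142645 276 (.leaf 142647 260)) 329226 37 (.node (.leaf 329227 37) 329236 117
  (.leaf 329247 133))))) 329248 133 (.node (.node (.node (.node (.leaf 329260 245) 329275 549 (.leaf 329738 17))
  329739 17 (.node (.leaf 329741 40) 329747 40 (.leaf 329748 39))) 329749 39 (.node (.node (.leaf 329759 116)
  329760 116 (.leaf 329771 136)) 329772 135 (.node (.leaf 329773 135) 329786 244 (.leaf 329787 244)))) 329800
  244 (.node (.node (.node (.leaf 329802 452) 329815 468 (.leaf 329994 17)) 329995 17 (.node (.leaf 329997 40)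
  330003 40 (.leaf 330004 39))) 330005 39 (.node (.node (.leaf 330007 97) 330015 116 (.leaf 330016 113)) 330017
  81 (.node (.leaf 330027 136) 330028 135 (.leaf 330029 129)))))) 330030 97 (.node (.node (.node (.node (.node
  (.leaf 330031 177) 330041 313 (.leaf 330042 152)) 330043 244 (.node (.leaf 330044 151) 330045 161 (.leaf
  330056 244))) 330057 167 (.node (.node (.leaf 330058 295) 330059 167 (.leaf 330060 193)) 330061 321 (.node
  (.leaf 330071 311) 330072 455 (.leaf 330073 311)))) 330085 456 (.node (.node (.node (.leaf 330087 455) 330257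
  39 (.leaf 330258 39)) 330259 39 (.node (.leaf 330264 136) 330267 113 (.leaf 330268 113))) 330280 135 (.node
  (.node (.leaf 330281 135) 330289 241 (.leaf 330293 241)) 330294 241 (.node (.leaf 330304 465) 330309 449
  (.leaf 330513 39))))) 330514 39 (.node (.node (.node (.node (.leaf 330515 39) 330524 145 (.leaf 332051 120))
  332052 116 (.node (.leaf 332053 216) 332063 132 (.leaf 332064 132))) 332075 184 (.node (.node (.leaf 332076
  183) 332077 215 (.leaf 332091 548)) 332308 116 (.node (.leaf 332309 148) 332319 132 (.leaf 332320 132))))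
  332321 164 (.node (.node (.node (.leaf 332332 244) 332333 148 (.leaf 332346 164)) 332347 292 (.node (.leaf
  332348 164) 332360 308 (.leaf 332361 452))) 332362 308 (.node (.node (.leaf 332377 452) 332564 116 (.leaf
  332565 148)) 332571 133 (.node (.leaf 332572 133) 332575 132 (.leaf 332576 132)))))))) 332577 164 (.node
  (.node (.node (.node (.node (.node (.node (.node (.leaf 332584 245) 332588 244 .nil) 332589 148 (.leaf 332598
  549)) 332602 164 (.node (.leaf 332603 292) 332604 164 (.leaf 332616 308))) 332617 452 (.node (.node (.leaf
  332618 308) 332633 452 (.leaf 332824 216)) 332827 132 (.node (.leaf 332828 132) 332840 215 (.leaf 332841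
  183)))) 332854 548 (.node (.node (.node (.leaf 333084 193) 333097 241 (.leaf 333855 229)) 334623 180 (.node
  (.leaf 334624 212) 334635 232 (.leaf 334636 231))) 334879 180 (.node (.node (.leaf 334880 177) 334881 279
  (.leaf 334891 200)) 334892 199 (.node (.leaf 334893 193) 334906 280 (.leaf 334908 279))))) 335656 231 (.node
  (.node (.node (.node (.leaf 335657 199) 335669 311 (.leaf 335670 311)) 335913 193 (.node (.leaf 337963 312)
  337964 311 (.leaf 338221 273))) 395019 146 (.node (.node (.leaf 395040 274) 395274 33 (.leaf 395275 33))
  395530 33 (.node (.leaf 395531 33) 395541 145 (.leaf 395552 129)))) 395553 161 (.node (.node (.node (.leaf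
  395565 177) 395788 114 (.leaf 395791 130)) 395793 113 (.node (.leaf 395794 145) 395798 130 (.leaf 395803
  129))) 395804 129 (.node (.node (.leaf 395805 161) 395811 242 (.leaf 395816 241)) 395817 145 (.node (.leaf
  395824 546) 395825 305 (.leaf 395829 161)))))) 395830 289 (.node (.node (.node (.node (.node (.leaf 395831
  161) 395844 449 (.leaf 395845 305)) 395860 449 (.node (.leaf 396044 114) 396047 130 (.leaf 396048 162)))
  396050 145 (.node (.node (.leaf 396054 130) 396057 146 (.leaf 396060 129)) 396061 161 (.node (.leaf 396067
  242) 396069 162 (.leaf 396070 162)))) 396073 177 (.node (.node (.node (.leaf 396080 290) 396083 450 (.leaf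
  396094 306)) 396095 306 (.node (.leaf 396110 450) 396308 130 (.leaf 396319 210))) 396320 178 (.node (.node
  (.leaf 397076 210) 397088 194 (.leaf 397845 161)) 397856 177 (.node (.leaf 397857 241) 398358 178 (.leaf
  398620 209))))) 398621 241 (.node (.node (.node (.node (.leaf 398633 241) 398645 273 (.leaf 398647 257))
  398879 226 (.node (.leaf 398880 194) 398892 306 (.leaf 399648 274))) 400416 193 (.node (.node (.leaf 400672
  193) 400673 257 (.leaf 401449 241)) 401461 273 (.node (.leaf 401463 257) 401705 273 (.leaf 460810 33))))
  460811 33 (.node (.node (.node (.leaf 460813 152) 460820 210 (.leaf 460821 151)) 460832 194 (.node (.leaf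
  460845 244) 461066 33 (.leaf 461067 33))) 461069 152 (.node (.node (.leaf 461076 217) 461077 145 (.leaf 461079
  248)) 461088 129 (.node (.leaf 461089 161) 461100 280 (.leaf 461101 177))))))) 461102 247 (.node (.node (.node
  (.node (.node (.node (.leaf 461114 248) 461116 247 (.leaf 461129 279)) 461131 263 (.node (.leaf 461329 113)
  461330 145 (.leaf 461339 129))) 461340 129 (.node (.node (.leaf 461341 161) 461352 241 (.leaf 461353 145))
  461361 305 (.node (.leaf 461365 161) 461366 289 (.leaf 461367 161)))) 461380 449 (.node (.node (.node (.leaf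
  461381 305) 461396 449 (.leaf 461585 151)) 461586 145 (.node (.leaf 461587 151) 461596 129 (.leaf 461597
  161))) 461598 248 (.node (.node (.leaf 461609 177) 461610 247 (.leaf 462098 165)) 462108 181 (.node (.leaf
  462109 245) 463124 258 (.leaf 463125 262))))) 463136 276 (.node (.node (.node (.node (.leaf 463149 391) 463380
  265 (.leaf 463381 161)) 463383 264 (.node (.leaf 463392 177) 463393 183 (.leaf 463405 244))) 463406 263 (.node
  (.node (.leaf 463418 276) 463420 260 (.leaf 463637 164)) 463648 212 (.node (.leaf 463649 244) 463661 244
  (.leaf 463674 276)))) 463676 260 (.node (.node (.node (.leaf 463900 374) 463901 406 (.leaf 463913 390)) 463925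
  502 (.node (.leaf 463927 502) 464156 180 (.leaf 464157 183))) 464158 264 (.node (.node (.leaf 464169 241)
  464170 263 (.leaf 464181 273)) 464183 257 (.node (.leaf 464669 405) 465696 388 (.leaf 465952 193)))))) 465953
  261 (.node (.node (.node (.node (.node (.leaf 465965 277) 465978 424 (.leaf 465980 423)) 466208 193 (.node
  (.leaf 466209 257) 466221 276 (.leaf 466222 407))) 466234 584 (.node (.node (.leaf 466236 583) 466464 405
  (.leaf 466465 405)) 466477 581 (.node (.leaf 466984 504) 466985 241 (.leaf 466986 407)))) 466997 273 (.node
  (.node (.node (.leaf 466999 257) 467012 503 (.leaf 467014 503)) 467241 273 (.node (.leaf 467242 407) 469293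
  391 (.leaf 469306 472))) 469308 471 (.node (.node (.leaf 469549 580) 470325 472 (.leaf 470327 471)) 526860 39
  (.node (.leaf 526861 39) 526863 116 (.leaf 526870 116))))) 526873 135 (.node (.node (.node (.node (.leaf
  526882 135) 526883 135 (.leaf 526886 244)) 526896 244 (.node (.leaf 526910 244) 526911 452 (.leaf 526925
  468))) 527116 39 (.node (.node (.leaf 527117 39) 527118 97 (.leaf 527119 113)) 527120 81 (.node (.leaf 527126
  116) 527129 129 (.leaf 527130 97)))) 527138 135 (.node (.node (.node (.leaf 527139 135) 527140 177 (.leaf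
  527141 151)) 527142 151 (.node (.leaf 527143 161) 527151 313 (.leaf 527152 244))) 527154 167 (.node (.node
  (.leaf 527155 167) 527156 193 (.leaf 527166 244)) 527167 295 (.node (.leaf 527168 321) 527169 456 (.leaf
  527181 311))))))))) 527182 311 (.node (.node (.node (.node (.node (.node (.node (.node (.node (.leaf 527196
  456) 527197 455 .nil) 527373 120 (.leaf 527379 120)) 527380 116 (.node (.leaf 527381 119) 527391 132 (.leaf
  527392 132))) 527403 216 (.node (.node (.leaf 527404 215) 527405 183 (.leaf 527419 548)) 527631 133 (.node
  (.leaf 527632 165) 527636 116 (.leaf 527638 133)))) 527641 149 (.node (.node (.node (.leaf 527647 132) 527648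
  132 (.leaf 527651 245)) 527653 165 (.node (.leaf 527654 165) 527660 244 (.leaf 527664 293))) 527667 453 (.node
  (.node (.leaf 527675 548) 527678 309 (.leaf 527679 309)) 527694 453 (.node (.leaf 528147 136) 528148 133
  (.leaf 528149 135))))) 528159 213 (.node (.node (.node (.node (.leaf 528160 177) 528173 193 (.leaf 528405
  167)) 528416 276 (.node (.leaf 529174 133) 529187 245 (.leaf 529200 549))) 529430 132 (.node (.node (.leaf
  529433 215) 529442 183 (.leaf 529443 183)) 529456 548 (.node (.leaf 529686 132) 529689 148 (.leaf 529699
  244)))) 529701 164 (.node (.node (.node (.leaf 529702 164) 529712 292 (.leaf 529715 452)) 529726 308 (.node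
  (.leaf 529727 308) 529742 452 (.leaf 529951 183))) 529952 180 (.node (.node (.leaf 529963 232) 529964 231
  (.leaf 529965 199)) 529978 311 (.node (.leaf 529979 311) 530720 193 (.leaf 530733 273)))))) 532258 231 (.node
  (.node (.node (.node (.node (.leaf 532259 231) 532514 199 (.leaf 532515 199)) 532517 279 (.node (.leaf 532518
  279) 533036 308 (.leaf 533292 308))) 592396 39 (.node (.node (.leaf 592397 39) 592399 145 (.leaf 592652 39))
  592653 39 (.node (.leaf 592654 97) 592655 113 (.leaf 592656 81)))) 592665 129 (.node (.node (.node (.leaf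
  592666 97) 592675 289 (.leaf 592676 177)) 592677 161 (.node (.leaf 592678 177) 592679 161 (.leaf 592688 305)))
  592690 225 (.node (.node (.leaf 592692 193) 592703 449 (.leaf 592704 321)) 592916 116 (.node (.leaf 592917
  148) 592927 132 (.leaf 592928 132))))) 592929 164 (.node (.node (.node (.node (.leaf 592940 244) 592941 148
  (.leaf 592954 164)) 592955 292 (.node (.leaf 592956 164) 592968 308 (.leaf 592969 452))) 592970 308 (.node
  (.node (.leaf 592985 452) 593167 133 (.leaf 593168 165)) 593172 116 (.node (.leaf 593173 148) 593177 181
  (.leaf 593183 132)))) 593184 132 (.node (.node (.node (.leaf 593185 164) 593196 244 (.leaf 593197 148)) 593210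
  164 (.node (.leaf 593211 292) 593212 164 (.leaf 593224 308))) 593225 452 (.node (.node (.leaf 593226 308)
  593241 452 (.leaf 593429 245)) 593441 261 (.node (.leaf 593453 277) 593684 193 (.leaf 593685 135))))))) 593687
  200 (.node (.node (.node (.node (.node (.node (.leaf 593696 177) 593697 183 (.leaf 593708 280)) 593709 193
  (.node (.leaf 593710 199) 593722 248 (.leaf 593724 247))) 593737 279 (.node (.node (.leaf 593739 263) 593941
  164 (.leaf 593943 264)) 593952 212 (.node (.leaf 593953 244) 593965 244 (.leaf 593966 263)))) 593978 276
  (.node (.node (.node (.leaf 593980 260) 595225 180 (.leaf 595226 247)) 596256 193 (.node (.leaf 596257 196)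
  596269 244 (.leaf 596282 276))) 596284 260 (.node (.node (.leaf 596513 260) 596525 276 (.leaf 658449 116))
  658450 216 (.node (.leaf 658456 184) 658459 132 (.leaf 658460 132))))) 658472 183 (.node (.node (.node (.node
  (.leaf 658473 215) 658486 548 (.leaf 658705 116)) 658715 132 (.node (.leaf 658716 132) 658728 244 (.leaf
  658742 548))) 659217 133 (.node (.node (.leaf 659218 193) 659224 200 (.leaf 659227 181)) 659228 177 (.node
  (.leaf 659229 279) 659240 199 (.leaf 659241 193)))) 659253 280 (.node (.node (.node (.leaf 659255 279) 659734
  132 (.leaf 659737 183)) 659746 215 (.node (.leaf 659747 215) 659760 548 (.leaf 659993 241))) 661016 232 (.node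
  (.node (.leaf 661019 180) 661020 212 (.leaf 661032 231)) 661539 309 (.node (.leaf 661787 196) 661788 193
  (.leaf 661801 273)))))) 662306 231 (.node (.node (.node (.node (.node (.leaf 662307 231) 662310 312 (.leaf
  662320 311)) 664360 311 (.node (.leaf 723985 119) 723986 213 (.leaf 723996 193))) 724498 245 (.node (.node
  (.leaf 724508 197) 724509 261 (.leaf 724753 135)) 724754 135 (.node (.leaf 724755 135) 724764 177 (.leaf
  724765 215)))) 724777 193 (.node (.node (.node (.leaf 725009 167) 725010 164 (.leaf 725011 167)) 725020 180
  (.node (.leaf 725021 244) 725022 264 (.leaf 725033 199))) 725034 263 (.node (.node (.leaf 725270 132) 725273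
  148 (.leaf 725283 244)) 725285 164 (.node (.leaf 725286 164) 725296 292 (.leaf 725299 452))))) 725310 308
  (.node (.node (.node (.node (.leaf 725311 308) 725326 452 (.leaf 725529 180)) 725530 247 (.node (.leaf 725539
  280) 725541 247 (.leaf 725542 247))) 725554 263 (.node (.node (.leaf 725555 279) 725785 180 (.leaf 727324
  193)) 727325 247 (.node (.leaf 727326 280) 727337 247 (.leaf 727338 279)))) 727580 196 (.node (.node (.node
  (.leaf 727581 260) 728099 280 (.leaf 728101 247)) 728102 247 (.node (.leaf 728114 263) 728115 279 (.leaf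
  728357 260))) 728358 276 (.node (.node (.leaf 730409 263) 730665 279 (.leaf 790803 136)) 790804 129 (.node
  (.leaf 790805 264) 790815 177 (.leaf 790816 180)))))))) 790827 264 (.node (.node (.node (.node (.node (.node
  (.node (.node (.leaf 790828 263) 790829 263 .nil) 791060 261 (.leaf 791061 258)) 791072 370 (.node (.leaf
  791073 402) 791085 386 (.leaf 791098 498))) 791100 498 (.node (.node (.leaf 791323 181) 791324 213 (.leaf
  791576 264)) 791579 180 (.node (.leaf 791580 177) 791592 263 (.leaf 791593 263)))) 791836 273 (.node (.node
  (.node (.leaf 791849 391) 793375 225 (.leaf 793376 260)) 793631 193 (.node (.leaf 793632 193) 793633 391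
  (.leaf 793645 273))) 793658 424 (.node (.node (.leaf 793660 423) 794408 305 (.leaf 794665 402)) 796973 418
  (.node (.leaf 796986 562) 855826 210 (.leaf 855836 194))))) 856082 242 (.node (.node (.node (.node (.leaf
  856092 194) 856093 258 (.leaf 856340 129)) 856351 177 (.node (.leaf 856352 209) 856601 242 (.leaf 856613
  258))) 856614 274 (.node (.node (.leaf 857115 209) 857116 177 (.leaf 857372 273)) 858396 242 (.node (.leaf
  858397 274) 858911 225 (.leaf 859167 193)))) 859168 193 (.node (.node (.node (.leaf 859173 258) 859174 274
  (.leaf 859181 273)) 859944 305 (.node (.leaf 922133 258) 922145 402 (.leaf 922908 402))) 922909 402 (.node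
  (.node (.leaf 922921 578) 924961 418 (.leaf 987411 184)) 987412 178 (.node (.leaf 987413 374) 987423 258
  (.leaf 987424 196)))))) 987437 406 (.node (.node (.node (.node (.node (.leaf 987667 280) 987668 279 (.leaf
  987669 177)) 987671 408 (.node (.leaf 987679 391) 987680 196 (.leaf 987681 196))) 987692 504 (.node (.node
  (.leaf 987693 244) 987694 407 (.leaf 987706 276)) 987708 260 (.node (.leaf 987721 503) 987723 503 (.leaf
  987925 180)))) 987931 197 (.node (.node (.node (.leaf 987932 197) 987936 196 (.leaf 987937 196)) 987945 277
  (.node (.leaf 987949 244) 987962 276 (.leaf 987964 260))) 988187 196 (.node (.node (.leaf 988188 196) 988189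
  391 (.leaf 988201 276)) 988213 424 (.node (.leaf 988215 423) 988444 196 (.leaf 988445 257))))) 988457 273
  (.node (.node (.node (.node (.leaf 988469 424) 988471 423 (.leaf 989984 404)) 990239 407 (.node (.leaf 990240
  369) 990241 375 (.leaf 990253 389))) 990266 408 (.node (.node (.leaf 990268 407) 990496 372 (.leaf 990497
  401)) 990509 388 (.node (.leaf 990522 500) 990524 500 (.leaf 991017 420)))) 991273 385 (.node (.node (.node
  (.leaf 991285 408) 991287 407 (.leaf 991529 420)) 993580 568 (.node (.leaf 993581 404) 993594 424 (.leaf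
  993596 423))) 993609 567 (.node (.node (.leaf 994613 424) 994615 423 (.leaf 996666 565)) 997178 564 (.node
  (.leaf 1052949 406) 1052960 385 (.leaf 1053205 177))))))) 1053207 408 (.node (.node (.node (.node (.node
  (.node (.leaf 1053216 257) 1053217 257 (.leaf 1053229 273)) 1053230 407 (.node (.leaf 1053461 244) 1053473 260
  (.leaf 1053485 276))) 1053980 196 (.node (.node (.leaf 1053981 257) 1053982 408 (.leaf 1053993 273)) 1053994
  407 (.node (.leaf 1054005 584) 1054007 583 (.leaf 1054493 421)))) 1055776 369 (.node (.node (.node (.leaf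
  1055777 405) 1055789 417 (.leaf 1056032 401)) 1056033 401 (.node (.leaf 1056045 577) 1056046 423 (.leaf
  1056289 421))) 1056809 385 (.node (.node (.leaf 1056821 497) 1056823 497 (.leaf 1057065 580)) 1057066 423
  (.node (.leaf 1059117 465) 1118998 213 (.leaf 1119254 177))))) 1119257 263 (.node (.node (.node (.node (.leaf
  1119266 263) 1119267 263 (.leaf 1119513 387)) 1119525 499 (.node (.leaf 1119526 499) 1119775 225 (.leaf
  1119776 193))) 1119788 305 (.node (.node (.leaf 1120544 273) 1120557 419 (.leaf 1122341 423)) 1122342 423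
  (.node (.leaf 1123885 563) 1184793 391 (.leaf 1185049 244)))) 1185050 263 (.node (.node (.node (.leaf 1185061
  260) 1185062 276 (.leaf 1185561 581)) 1186080 280 (.node (.leaf 1186081 279) 1186093 388 (.leaf 1186094 583)))
  1186106 472 (.node (.node (.leaf 1186108 471) 1186337 404 (.leaf 1187877 423)) 1187878 423 (.node (.leaf
  1188133 583) 1188134 583 (.leaf 1189165 468)))))) 1189421 468 (.node (.node (.node (.node (.node (.leaf
  1250843 226) 1252131 306 (.leaf 1316379 225)) 1316380 260 (.node (.leaf 1317148 403) 1317161 419 (.leaf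
  1317173 563))) 1317667 305 (.node (.node (.leaf 1381916 388) 1382684 241 (.leaf 1382685 273)) 1382697 391
  (.node (.leaf 1382709 472) 1382711 471 (.leaf 1382940 404)))) 1382941 404 (.node (.node (.node (.leaf 1382953
  580) 1383459 504 (.leaf 1383461 257)) 1383462 273 (.node (.leaf 1383474 503) 1383475 503 (.leaf 1385769 468)))
  1386025 468 (.node (.node (.leaf 1448992 401) 1449005 417 (.leaf 1645344 420)) 1645600 385 (.node (.leaf
  1645601 391) 1645613 401 (.leaf 1645626 424))))) 1645628 423 (.node (.node (.node (.node (.leaf 1645856 420)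
  1645857 580 (.leaf 1645869 468)) 1646632 568 (.node (.leaf 1646633 401) 1646645 424 (.leaf 1646647 423)))
  1646660 567 (.node (.node (.leaf 1646889 468) 1648941 417 (.leaf 1648954 504)) 1648956 503 (.node (.leaf
  1649973 504) 1649975 503 (.leaf 1711393 417)))) 1843237 407 (.node (.node (.node (.leaf 1843238 407) 1843493
  500 (.leaf 1843494 500)) 1844013 565 (.node (.leaf 1844525 420) 1844781 420 (.leaf 1844794 568))) 1844796 567
  (.node (.node (.leaf 1846579 567) 2106665 420 (.leaf 2106677 564)) 2106921 420 (.node (.leaf 2106933 564)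
  2435373 497 (.leaf 2500909 497))))))))))

set_option maxRecDepth 100000 in
/-- The corresponding states with the robber at `1`. -/
noncomputable def traps1 : BT :=
  (.node (.node (.node (.node (.node (.node (.node (.node (.node (.node (.leaf 197388 98) 197639 134 .nil)
  197644 98 (.node (.leaf 197647 118) 197657 135 .nil)) 197667 226 (.node (.node (.leaf 197680 530) 198155 40
  .nil) 198156 17 (.node (.leaf 198157 17) 198159 40 .nil))) 198166 39 (.node (.node (.node (.leaf 198167 39)
  198178 145 .nil) 198192 529 (.node (.leaf 198411 40) 198412 17 .nil)) 198413 17 (.node (.node (.leaf 198415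
  40) 198421 97 .nil) 198422 39 (.node (.leaf 198423 39) 198432 152 .nil)))) 198433 81 (.node (.node (.node
  (.node (.leaf 198434 113) 198445 177 .nil) 198446 97 (.node (.leaf 198447 129) 198448 225 .nil)) 198458 232
  (.node (.node (.leaf 198460 161) 198461 161 .nil) 198462 177 (.node (.leaf 198475 193) 198476 225 .nil)))
  198477 257 (.node (.node (.node (.leaf 198668 37) 198669 37 .nil) 198671 104 (.node (.leaf 198678 103) 199180
  114 .nil)) 199183 132 (.node (.node (.leaf 199436 114) 199438 85 .nil) 199439 101 (.node (.leaf 199440 69)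
  199449 119 .nil))))) 199450 85 (.node (.node (.node (.node (.node (.leaf 199459 274) 199460 165 .nil) 199461
  149 (.node (.leaf 199462 167) 199463 149 .nil)) 199472 290 (.node (.node (.leaf 199474 213) 199476 181 .nil)
  199487 434 (.node (.leaf 199488 309) 199692 101 .nil))) 199693 101 (.node (.node (.node (.leaf 199694 39)
  199695 39 .nil) 199696 39 (.node (.leaf 199697 103) 199699 162 .nil)) 199700 162 (.node (.node (.leaf 199701
  133) 199703 117 .nil) 199704 65 (.node (.leaf 199705 103) 199706 68 .nil)))) 199707 88 (.node (.node (.node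
  (.node (.leaf 199711 210) 199712 178 .nil) 199713 133 (.node (.leaf 199714 149) 199716 87 .nil)) 199717 88
  (.node (.node (.leaf 199719 87) 199720 103 .nil) 199723 290 (.node (.leaf 199724 290) 199725 226 .nil)))
  199726 213 (.node (.node (.node (.leaf 199727 197) 199729 103 .nil) 199730 103 (.node (.leaf 199732 103)
  199733 537 .nil)) 199734 152 (.node (.node (.leaf 199738 261) 199740 229 .nil) 199741 229 (.node (.leaf 199744
  151) 199746 152 .nil)))))) 199747 151 (.node (.node (.node (.node (.node (.node (.leaf 199748 488) 199749 167
  .nil) 199755 309 (.node (.leaf 199756 357) 199759 167 .nil)) 199761 167 (.node (.node (.leaf 199762 167)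
  199763 535 .nil) 199764 264 (.node (.leaf 199774 263) 199775 484 .nil))) 199776 344 (.node (.node (.node
  (.leaf 199777 488) 199778 343 .nil) 199788 343 (.node (.leaf 199789 500) 199791 567 .nil)) 199792 487 (.node
  (.node (.leaf 199803 567) 199950 39 .nil) 199951 39 (.node (.leaf 199952 39) 199960 87 .nil)))) 199961 103
  (.node (.node (.node (.node (.leaf 199962 68) 199971 290 .nil) 199972 148 (.node (.leaf 199973 88) 199974 178
  .nil)) 199975 87 (.node (.node (.leaf 199984 338) 199985 164 .nil) 199986 116 (.node (.leaf 199987 498) 199988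
  148 .nil))) 199999 354 (.node (.node (.node (.leaf 200000 260) 200001 215 .nil) 200002 180 (.node (.leaf
  200003 180) 200005 532 .nil)) 200014 498 (.node (.node (.leaf 200015 308) 200017 340 .nil) 200020 484 (.node
  (.leaf 200030 356) 200031 484 .nil))))) 200034 564 (.node (.node (.node (.node (.node (.leaf 200045 500)
  200207 72 .nil) 200214 71 (.node (.leaf 200215 87) 200226 177 .nil)) 200239 353 (.node (.node (.leaf 200240
  385) 200254 401 .nil) 200269 449 (.node (.leaf 200463 101) 200464 69 .nil))) 200468 185 (.node (.node (.node
  (.leaf 200469 119) 200470 103 .nil) 200471 103 (.node (.leaf 200472 85) 200474 85 .nil)) 200475 101 (.node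
  (.node (.leaf 200480 136) 200481 120 .nil) 200482 120 (.node (.leaf 200484 101) 200485 101 .nil)))) 200487 101
  (.node (.node (.node (.node (.leaf 200492 264) 200493 183 .nil) 200494 135 (.node (.leaf 200495 151) 200497
  149 .nil)) 200500 149 (.node (.node (.leaf 200502 165) 200506 232 .nil) 200508 216 (.node (.leaf 200509 200)
  200510 199 .nil))) 200512 165 (.node (.node (.node (.leaf 200514 165) 200515 165 .nil) 200516 533 (.node
  (.leaf 200517 485) 200521 263 .nil)) 200523 231 (.node (.node (.leaf 200524 231) 200527 261 .nil) 200532 341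
  (.leaf 200536 312))))))) 200538 311 (.node (.node (.node (.node (.node (.node (.node (.leaf 200539 359) 200542
  341 .nil) 200545 565 (.node (.leaf 200546 485) 200560 565 .nil)) 200725 148 (.node (.node (.leaf 200726 71)
  200727 71 .nil) 200737 148 (.node (.leaf 200738 129) 200749 228 .nil))) 200750 164 (.node (.node (.node (.leaf
  200751 177) 200752 369 .nil) 200764 244 (.node (.leaf 200765 289) 200766 257 .nil)) 200781 401 (.node (.node
  (.leaf 202009 135) 202010 230 .nil) 202019 290 (.node (.leaf 202021 278) 202032 434 .nil)))) 202047 450 (.node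
  (.node (.node (.node (.leaf 202264 84) 202266 84 .nil) 202267 100 (.node (.leaf 202276 100) 202277 100 .nil))
  202279 100 (.node (.node (.leaf 202289 148) 202292 148 .nil) 202294 164 (.node (.leaf 202304 164) 202306 164
  .nil))) 202307 164 (.node (.node (.node (.leaf 202308 532) 202309 484 .nil) 202319 260 (.node (.leaf 202324
  340) 202334 340 .nil)) 202337 564 (.node (.node (.leaf 202338 484) 202352 564 .nil) 202521 119 (.node (.leaf
  202522 84) 202532 164 .nil))))) 202533 148 (.node (.node (.node (.node (.node (.leaf 202534 199) 202535 148
  .nil) 202546 212 (.node (.leaf 202548 180) 202560 308 .nil)) 202800 529 (.node (.node (.leaf 203040 180)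
  203041 132 .nil) 203042 148 (.node (.leaf 203053 228) 203054 212 .nil))) 203055 196 (.node (.node (.node
  (.leaf 203066 260) 203068 228 .nil) 203069 228 (.node (.leaf 203083 308) 203084 356 .nil)) 203297 209 (.node
  (.node (.leaf 203298 177) 203310 231 .nil) 203311 193 (.node (.leaf 203312 385) 203325 273 .nil)))) 203326 273
  (.node (.node (.node (.node (.leaf 203340 295) 203341 417 .nil) 203355 497 (.node (.leaf 205093 213) 205095
  229 .nil)) 205106 279 (.node (.node (.leaf 205348 241) 205349 200 .nil) 205351 199 (.node (.leaf 205362 215)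
  205364 241 .nil))) 205871 353 (.node (.node (.node (.leaf 205872 513) 205886 497 .nil) 205901 513 (.node
  (.leaf 206126 279) 206127 215 .nil)) 206140 360 (.node (.node (.leaf 206141 264) 206142 263 .nil) 206156 311
  (.leaf 206639 241)))))) 206640 465 (.node (.node (.node (.node (.node (.node (.leaf 206653 292) 206654 353
  .nil) 206669 497 (.node (.leaf 208434 359) 208690 263 .nil)) 208692 353 (.node (.node (.leaf 208948 641)
  209469 308 .nil) 209982 497 (.node (.leaf 209997 641) 263687 163 .nil))) 263691 40 (.node (.node (.node (.leaf
  263692 17) 263693 17 .nil) 263695 40 (.node (.leaf 263702 39) 263703 39 .nil)) 263705 163 (.node (.node (.leaf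
  263714 116) 263715 116 .nil) 263718 136 (.node (.leaf 263727 135) 263728 135 .nil)))) 263731 440 (.node (.node
  (.node (.node (.leaf 263742 212) 263743 276 .nil) 263757 228 (.node (.leaf 263758 439) 263771 454 .nil))
  263772 454 (.node (.node (.leaf 263944 147) 263945 147 .nil) 263947 40 (.node (.leaf 263948 17) 263949 17
  .nil))) 263950 181 (.node (.node (.node (.leaf 263951 40) 263953 163 .nil) 263954 227 (.node (.leaf 263957 97)
  263958 39 .nil)) 263959 39 (.node (.node (.leaf 263963 181) 263964 179 .nil) 263965 243 (.node (.leaf 263969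
  81) 263970 113 .nil))))) 263971 116 (.node (.node (.node (.node (.node (.leaf 263974 136) 263977 227 .nil)
  263981 177 (.node (.leaf 263982 97) 263983 129 .nil)) 263984 135 (.node (.node (.leaf 263987 232) 263989 277
  .nil) 263996 161 (.node (.leaf 263997 152) 263998 151 .nil))) 263999 215 (.node (.node (.node (.leaf 264011
  193) 264012 167 .nil) 264013 167 (.node (.leaf 264014 231) 264027 216 .nil)) 264028 215 (.node (.node (.leaf
  264041 263) 264042 263 .nil) 264204 37 (.node (.leaf 264205 37) 264207 104 .nil)))) 264214 103 (.node (.node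
  (.node (.node (.leaf 264217 147) 264226 133 .nil) 264227 133 (.node (.leaf 264230 232) 264240 231 .nil))
  264254 229 (.node (.node (.leaf 264255 435) 264269 453 .nil) 264463 132 (.node (.leaf 264974 101) 264976 101
  .nil))) 265230 39 (.node (.node (.node (.leaf 265231 39) 265232 39 .nil) 265233 103 (.node (.leaf 265234 261)
  265240 65 .nil)) 265242 87 (.node (.node (.leaf 265243 88) 265244 181 .nil) 265252 87 (.leaf 265255
  145)))))))) 265256 113 (.node (.node (.node (.node (.node (.node (.node (.node (.leaf 265257 261) 265265 145
  .nil) 265268 161 (.node (.leaf 265269 215) 265270 177 .nil)) 265280 177 (.node (.node (.leaf 265285 465)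
  265295 337 .nil) 265300 481 (.node (.leaf 265314 497) 265486 39 .nil))) 265487 39 (.node (.node (.node (.leaf
  265488 39) 265496 100 .nil) 265498 97 (.node (.leaf 265508 177) 265511 177 .nil)) 265743 72 (.node (.node
  (.leaf 265750 71) 265751 103 .nil) 265753 183 (.node (.leaf 265762 132) 265763 132 .nil)))) 265766 152 (.node
  (.node (.node (.node (.leaf 265775 151) 265776 151 .nil) 265779 311 (.node (.leaf 265789 405) 265790 228
  .nil)) 265791 343 (.node (.node (.leaf 265793 504) 265804 457 .nil) 265805 263 (.node (.leaf 265806 359)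
  265819 408 .nil))) 265820 407 (.node (.node (.node (.leaf 265821 503) 265833 455 .nil) 265834 455 (.node
  (.leaf 266000 85) 266001 147 .nil)) 266002 184 (.node (.node (.leaf 266006 116) 266007 148 .nil) 266008 85
  (.node (.leaf 266011 149) 266012 167 .nil))))) 266013 263 (.node (.node (.node (.node (.node (.leaf 266017
  164) 266018 132 .nil) 266019 132 (.node (.leaf 266020 149) 266023 165 .nil)) 266024 183 (.node (.node (.leaf
  266025 183) 266031 148 .nil) 266032 212 (.node (.leaf 266033 181) 266037 264 .nil))) 266039 263 (.node (.node
  (.node (.leaf 266045 164) 266046 164 .nil) 266047 228 (.node (.leaf 266052 279) 266061 212 .nil)) 266075 260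
  (.node (.node (.leaf 266076 260) 266262 87 .nil) 266263 103 (.node (.leaf 266273 164) 266274 129 .nil))))
  266275 132 (.node (.node (.node (.node (.leaf 266278 152) 266286 409 .nil) 266287 148 (.node (.leaf 266288
  151) 266291 376 .nil)) 266301 164 (.node (.node (.leaf 266302 164) 266303 228 .nil) 266316 407 (.node (.leaf
  266317 212) 266318 375 .nil))) 266331 260 (.node (.node (.node (.leaf 266332 260) 266345 471 .nil) 266346 471
  (.node (.leaf 266518 183) 266521 163 .nil)) 266531 228 (.node (.node (.leaf 266544 532) 266777 227 .nil)
  267800 84 (.leaf 267802 135)))))) 267803 148 (.node (.node (.node (.node (.node (.node (.leaf 267812 148)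
  267815 164 .nil) 267816 212 (.node (.leaf 267825 180) 267828 215 .nil)) 268058 161 (.node (.node (.leaf 268071
  225) 268322 148 .nil) 268323 148 (.node (.leaf 268326 232) 268335 404 .nil))) 268336 231 (.node (.node (.node
  (.leaf 268339 500) 268350 260 .nil) 268351 356 (.node (.leaf 268365 404) 268366 500 .nil)) 268379 452 (.node
  (.node (.leaf 268380 452) 268571 180 .nil) 268572 180 (.node (.leaf 268585 259) 268597 276 .nil)))) 268833 209
  (.node (.node (.node (.node (.leaf 268834 148) 268835 148 .nil) 268846 289 (.node (.leaf 268847 193) 268848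
  228 .nil)) 268861 273 (.node (.node (.leaf 268862 244) 268863 372 .nil) 268876 353 (.node (.leaf 268877 324)
  268891 468 .nil))) 268892 468 (.node (.node (.node (.leaf 269091 229) 269094 248 .nil) 269104 247 (.node
  (.leaf 269118 405) 269119 533 .nil)) 269133 453 (.node (.node (.leaf 270884 228) 270887 209 .nil) 270900 231
  (.node (.leaf 271140 228) 271143 212 .nil))))) 271144 247 (.node (.node (.node (.node (.node (.leaf 271153
  247) 271156 247 .nil) 271398 248 (.node (.leaf 271407 325) 271408 247 .nil)) 271411 584 (.node (.node (.leaf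
  271422 404) 271423 532 .nil) 271436 649 (.node (.leaf 271437 423) 271438 583 .nil))) 271451 568 (.node (.node
  (.node (.leaf 271452 567) 271465 647 .nil) 271466 647 (.node (.leaf 271911 245) 272175 231 .nil)) 272176 247
  (.node (.node (.leaf 272179 600) 272189 321 .nil) 272190 327 (.node (.leaf 272191 551) 272204 633 .nil))))
  272205 407 (.node (.node (.node (.node (.leaf 272206 599) 272219 552 .nil) 272220 551 (.node (.leaf 272233
  631) 272234 631 .nil)) 274228 327 (.node (.node (.leaf 274481 535) 274484 551 .nil) 274750 420 (.node (.leaf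
  274751 580) 274765 564 .nil))) 274779 644 (.node (.node (.node (.leaf 274780 644) 275518 404 .nil) 275519 596
  (.node (.leaf 275533 548) 275547 628 .nil)) 275548 628 (.node (.node (.leaf 395019 146) 395021 162 .nil)
  395029 162 (.leaf 395040 213))))))) 395053 258 (.node (.node (.node (.node (.node (.node (.node (.leaf 395276
  36) 395277 36 .nil) 395532 36 (.node (.leaf 395533 36) 395543 273 .nil)) 395567 305 (.node (.node (.leaf
  395788 36) 395789 36 .nil) 395791 136 (.node (.leaf 395798 116) 395810 132 .nil))) 395811 132 (.node (.node
  (.node (.leaf 395814 264) 395824 263 .nil) 395838 228 (.node (.leaf 395839 436) 395853 452 .nil)) 396044 36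
  (.node (.node (.leaf 396045 36) 396047 130 .nil) 396048 167 (.node (.leaf 396054 116) 396057 146 .nil))))
  396066 132 (.node (.node (.node (.node (.leaf 396067 132) 396069 167 .nil) 396070 167 (.node (.leaf 396079
  329) 396080 263 .nil)) 396083 279 (.node (.node (.leaf 396094 228) 396095 311 .nil) 396097 472 (.node (.leaf
  396109 327) 396110 327 .nil))) 396124 472 (.node (.node (.node (.leaf 396125 471) 396301 130 .nil) 396307 136
  (.node (.leaf 396308 132) 396309 135 .nil)) 396319 148 (.node (.node (.leaf 396320 148) 396331 232 .nil)
  396332 231 (.node (.leaf 396333 199) 396347 564 .nil))))) 396559 146 (.node (.node (.node (.node (.node (.leaf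
  396560 178) 396562 161 .nil) 396564 132 (.node (.leaf 396566 149) 396569 162 .nil)) 396572 145 (.node (.node
  (.leaf 396573 177) 396575 148 .nil) 396576 148 (.node (.leaf 396579 261) 396581 178 .nil))) 396582 178 (.node
  (.node (.node (.leaf 396585 193) 396588 260 .nil) 396592 309 (.node (.leaf 396595 469) 396603 564 .nil))
  396606 325 (.node (.node (.leaf 396607 325) 396622 469 .nil) 397076 149 (.node (.leaf 397077 146) 397087 229
  .nil)))) 397088 194 (.node (.node (.node (.node (.leaf 397101 215) 397847 321 .nil) 398102 149 (.node (.leaf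
  398115 261) 398128 565 .nil)) 398358 148 (.node (.node (.leaf 398370 199) 398371 199 .nil) 398384 564 (.node
  (.leaf 398614 148) 398617 162 .nil))) 398627 260 (.node (.node (.node (.leaf 398630 276) 398640 308 .nil)
  398643 468 (.node (.leaf 398654 324) 398655 324 .nil)) 398670 468 (.node (.node (.leaf 398879 199) 398880 196
  .nil) 398891 248 (.leaf 398892 247)))))) 398893 215 (.node (.node (.node (.node (.node (.node (.leaf 399133
  337) 399648 212 .nil) 399661 290 (.node (.leaf 401186 247) 401187 247 .nil)) 401442 215 (.node (.node (.leaf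
  401443 215) 460811 130 .nil) 460812 36 (.node (.leaf 460813 36) 460821 146 .nil))) 460823 132 (.node (.node
  (.node (.leaf 460832 168) 460833 148 .nil) 460834 132 (.node (.leaf 460845 226) 460846 164 .nil)) 460847 180
  (.node (.node (.leaf 460858 264) 460860 244 .nil) 461067 132 (.node (.leaf 461068 36) 461069 36 .nil))))
  461077 148 (.node (.node (.node (.node (.leaf 461079 132) 461088 168 .nil) 461089 148 (.node (.leaf 461090
  132) 461101 228 .nil)) 461102 164 (.node (.node (.leaf 461103 180) 461114 264 .nil) 461116 244 (.node (.leaf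
  461117 263) 461131 263 .nil))) 461324 36 (.node (.node (.node (.leaf 461325 36) 461334 116 .nil) 461335 148
  (.node (.leaf 461345 164) 461346 132 .nil)) 461347 132 (.node (.node (.leaf 461359 148) 461360 212 .nil)
  461373 164 (.node (.leaf 461374 164) 461375 228 .nil))))) 461389 212 (.node (.node (.node (.node (.node (.leaf
  461403 260) 461404 260 .nil) 461580 36 (.node (.leaf 461581 36) 461582 167 .nil)) 461585 146 (.node (.node
  (.leaf 461586 151) 461587 151 .nil) 461590 116 (.node (.leaf 461591 148) 461595 167 .nil))) 461596 167 (.node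
  (.node (.node (.leaf 461597 231) 461598 248 .nil) 461601 164 (.node (.leaf 461602 132) 461603 132 .nil))
  461609 183 (.node (.node (.leaf 461610 247) 461615 148 .nil) 461616 212 (.node (.leaf 461621 232) 461623 231
  .nil)))) 461629 164 (.node (.node (.node (.node (.leaf 461630 164) 461631 228 .nil) 461645 212 (.node (.leaf
  461659 260) 461660 260 .nil)) 462097 165 (.node (.node (.leaf 462098 161) 462099 167 .nil) 462108 145 (.node
  (.leaf 462109 177) 462110 264 .nil))) 462121 193 (.node (.node (.node (.leaf 462122 263) 463125 164 .nil)
  463136 210 (.node (.leaf 463137 278) 463149 260 .nil)) 463162 408 (.node (.node (.leaf 463164 407) 463381 164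
  .nil) 463383 183 (.leaf 463392 248))))))))) 463393 180 (.node (.node (.node (.node (.node (.node (.node (.node
  (.node (.leaf 463394 280) 463405 260 .nil) 463406 260 (.node (.leaf 463418 568) 463420 260 .nil)) 463421 407
  (.node (.node (.leaf 463435 551) 463637 164 .nil) 463639 260 (.node (.leaf 463649 180) 463661 260 .nil)))
  463662 260 (.node (.node (.node (.leaf 463676 260) 464155 279 .nil) 464156 180 (.node (.leaf 464157 244)
  464158 392 .nil)) 464168 488 (.node (.node (.leaf 464169 228) 464170 391 .nil) 464181 344 (.node (.leaf 464183
  343) 464196 487 .nil)))) 464198 487 (.node (.node (.node (.node (.leaf 464668 196) 464669 260 .nil) 464670 424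
  (.node (.leaf 464681 421) 464682 423 .nil)) 465696 418 (.node (.node (.leaf 465709 404) 465952 264 .nil)
  465953 263 (.node (.leaf 465965 402) 465966 279 .nil))) 465978 424 (.node (.node (.node (.leaf 465980 423)
  465995 439 .nil) 466208 392 (.node (.leaf 466209 324) 466210 424 .nil)) 466221 564 (.node (.node (.leaf 466222
  343) 466234 616 .nil) 466236 548 (.node (.leaf 466237 551) 466251 599 .nil))))) 466465 292 (.node (.node
  (.node (.node (.node (.leaf 466477 613) 466478 487 .nil) 466492 597 (.node (.leaf 466985 341) 466997 482
  .nil)) 466999 485 (.node (.node (.leaf 467241 279) 467242 343 .nil) 467243 487 (.node (.leaf 467253 424)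
  467255 423 .nil))) 467256 487 (.node (.node (.node (.leaf 469037 645) 469293 420 .nil) 469294 423 (.node
  (.leaf 469306 568) 469308 436 .nil)) 469323 583 (.node (.node (.leaf 469549 612) 469550 487 .nil) 469564 596
  (.node (.leaf 470325 568) 470327 567 .nil)))) 470340 647 (.node (.node (.node (.node (.leaf 470342 647) 472378
  648 .nil) 472380 581 (.node (.leaf 472890 648) 472892 580 .nil)) 526348 97 (.node (.node (.leaf 526604 100)
  526860 100 .nil) 526863 120 (.node (.leaf 526870 119) 526883 228 .nil))) 526896 532 (.node (.node (.node
  (.leaf 527116 100) 527119 113 .nil) 527120 151 (.node (.leaf 527126 119) 527129 135 .nil)) 527139 228 (.node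
  (.node (.leaf 527141 151) 527142 151 .nil) 527152 279 (.leaf 527155 440)))))) 527166 296 (.node (.node (.node
  (.node (.node (.node (.leaf 527167 295) 527182 439 .nil) 527373 120 (.node (.leaf 527374 65) 527375 97 .nil))
  527376 65 (.node (.node (.leaf 527379 120) 527380 119 .nil) 527381 119 (.node (.leaf 527383 135) 527384 81
  .nil))) 527386 81 (.node (.node (.node (.leaf 527387 97) 527390 167 .nil) 527391 167 (.node (.leaf 527392 167)
  527393 167 .nil)) 527396 97 (.node (.node (.leaf 527397 97) 527399 97 .nil) 527403 216 (.node (.leaf 527404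
  215) 527405 183 .nil)))) 527409 145 (.node (.node (.node (.node (.leaf 527412 145) 527414 161 .nil) 527417 295
  (.node (.leaf 527418 232) 527419 295 .nil)) 527420 231 (.node (.node (.leaf 527424 161) 527426 161 .nil)
  527427 161 (.node (.leaf 527428 529) 527429 481 .nil))) 527439 257 (.node (.node (.node (.leaf 527444 337)
  527454 337 .nil) 527457 561 (.node (.leaf 527458 481) 527472 561 .nil)) 527630 81 (.node (.node (.leaf 527631
  97) 527632 65 .nil) 527638 135 (.node (.leaf 527641 149) 527642 81 .nil))))) 527651 184 (.node (.node (.node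
  (.node (.node (.leaf 527652 161) 527653 145 .nil) 527654 167 (.node (.leaf 527655 145) 527664 293 .nil))
  527666 183 (.node (.node (.leaf 527667 183) 527668 177 .nil) 527678 344 (.node (.leaf 527679 343) 527680 305
  .nil))) 527681 504 (.node (.node (.node (.leaf 527694 359) 527708 504 .nil) 527709 503 (.node (.leaf 528147
  165) 528148 165 .nil)) 528149 129 (.node (.node (.leaf 528151 113) 528159 213 .nil) 528160 152 (.node (.leaf
  528161 129) 528162 145 .nil)))) 528171 293 (.node (.node (.node (.node (.leaf 528172 293) 528173 199 .nil)
  528174 209 (.node (.leaf 528175 193) 528186 232 .nil)) 528188 225 (.node (.node (.leaf 528189 225) 528203 305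
  .nil) 528204 353 (.node (.leaf 528405 164) 528407 161 .nil))) 528418 177 (.node (.node (.node (.leaf 528429
  260) 528431 353 .nil) 529174 167 (.node (.leaf 529430 167) 529686 167 .nil)) 529689 148 (.node (.node (.leaf
  529699 276) 529701 167 .nil) 529702 167 (.leaf 529712 292))))))) 529715 456 (.node (.node (.node (.node (.node
  (.node (.node (.leaf 529726 440) 529727 436 .nil) 529742 455 (.node (.leaf 529951 212) 529952 180 .nil))
  529963 292 (.node (.node (.leaf 529964 292) 529965 228 .nil) 530201 164 (.node (.leaf 530202 209) 530211 292
  .nil))) 530213 180 (.node (.node (.node (.leaf 530214 180) 530215 225 .nil) 530224 340 (.node (.leaf 530227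
  500) 530239 356 .nil)) 530254 500 (.node (.node (.leaf 530720 168) 530721 167 .nil) 530733 228 (.node (.leaf
  530746 296) 530748 295 .nil)))) 530977 225 (.node (.node (.node (.node (.leaf 530978 193) 530991 273 .nil)
  531005 289 (.node (.leaf 532515 293) 532528 437 .nil)) 532543 453 (.node (.node (.leaf 532771 292) 532773 273
  .nil) 532784 436 (.node (.leaf 532799 452) 533029 209 .nil))) 533031 241 (.node (.node (.node (.leaf 533805
  292) 533806 353 .nil) 533807 257 (.node (.leaf 533821 305) 534061 292 .nil)) 534319 353 (.node (.node (.leaf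
  592655 113) 592656 151 .nil) 592665 161 (.node (.leaf 592910 65) 592911 97 .nil))))) 592912 65 (.node (.node
  (.node (.node (.node (.leaf 592920 81) 592922 81 .nil) 592923 97 (.node (.leaf 592932 97) 592933 97 .nil))
  592935 97 (.node (.node (.leaf 592945 145) 592948 145 .nil) 592950 161 (.node (.leaf 592960 161) 592962 161
  .nil))) 592963 161 (.node (.node (.node (.leaf 592964 529) 592965 481 .nil) 592975 257 (.node (.leaf 592980
  337) 592990 337 .nil)) 592993 561 (.node (.node (.leaf 592994 481) 593008 561 .nil) 593166 81 (.node (.leaf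
  593167 97) 593168 65 .nil)))) 593177 177 (.node (.node (.node (.node (.leaf 593178 81) 593188 161 .nil) 593189
  145 (.node (.leaf 593191 145) 593202 209 .nil)) 593204 177 (.node (.node (.leaf 593216 305) 593431 277 .nil)
  593685 129 (.node (.leaf 593687 113) 593696 177 .nil))) 593697 129 (.node (.node (.node (.leaf 593698 145)
  593709 225 .nil) 593710 209 (.node (.leaf 593711 193) 593722 257 .nil)) 593724 225 (.node (.node (.leaf 593725
  225) 593739 305 .nil) 593740 353 (.leaf 593941 164)))))) 593943 161 (.node (.node (.node (.node (.node (.node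
  (.leaf 593953 180) 593954 177 .nil) 593965 260 (.node (.leaf 593966 260) 593967 353 .nil)) 593980 260 (.node
  (.node (.leaf 595737 193) 595738 209 .nil) 595749 209 (.node (.leaf 595751 225) 596513 225 .nil))) 596514 193
  (.node (.node (.node (.leaf 596527 273) 596541 289 .nil) 598309 273 (.node (.leaf 598565 209) 598567 241
  .nil)) 599342 353 (.node (.node (.leaf 599343 257) 599357 305 .nil) 599855 353 (.node (.leaf 658446 65) 658448
  81 .nil)))) 658449 119 (.node (.node (.node (.node (.leaf 658456 81) 658459 145 .nil) 658460 199 (.node (.leaf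
  658468 145) 658471 161 .nil)) 658472 209 (.node (.node (.leaf 658481 177) 658702 97 .nil) 658704 97 (.node
  (.leaf 658712 148) 658737 324 .nil))) 658959 177 (.node (.node (.node (.leaf 658966 129) 658978 145 .nil)
  658979 145 (.node (.leaf 658982 305) 658991 401 .nil)) 658992 337 (.node (.node (.leaf 658995 497) 659006 257
  .nil) 659007 353 (.node (.leaf 659021 401) 659022 497 .nil))))) 659035 449 (.node (.node (.node (.node (.node
  (.leaf 659036 449) 659217 161 .nil) 659218 257 (.node (.leaf 659224 197) 659227 177 .nil)) 659228 177 (.node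
  (.node (.leaf 659241 257) 659253 273 .nil) 659478 129 (.node (.leaf 659479 161) 659490 145 .nil))) 659491 145
  (.node (.node (.node (.leaf 659503 193) 659504 225 .nil) 659517 401 (.node (.leaf 659518 241) 659519 369
  .nil)) 659533 321 (.node (.node (.leaf 659547 465) 659548 465 .nil) 659734 199 (.node (.leaf 661016 145)
  661019 212 .nil)))) 661028 225 (.node (.node (.node (.node (.leaf 661031 209) 661538 247 .nil) 661539 225
  (.node (.leaf 661552 385) 661566 401 .nil)) 661567 529 (.node (.node (.leaf 661581 449) 662307 241 .nil)
  664103 225 (.node (.leaf 664356 241) 664359 241 .nil))) 664624 529 (.node (.node (.node (.leaf 664638 417)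
  664639 577 .nil) 664653 561 (.node (.leaf 664667 641) 664668 641 .nil)) 665391 321 (.node (.node (.leaf 665392
  545) 665406 401 .nil) 665407 593 (.leaf 665421 545)))))))) 665435 625 (.node (.node (.node (.node (.node
  (.node (.node (.node (.leaf 665436 625) 723982 65 .nil) 723984 81 (.node (.leaf 723985 119) 723986 213 .nil))
  723992 81 (.node (.node (.leaf 723995 145) 723996 167 .nil) 724004 145 (.node (.leaf 724007 161) 724008 209
  .nil))) 724009 245 (.node (.node (.node (.leaf 724017 177) 724238 97 .nil) 724240 97 (.node (.leaf 724495 148)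
  724502 129 .nil)) 724505 164 (.node (.node (.leaf 724514 145) 724515 145 .nil) 724518 276 (.node (.leaf 724527
  401) 724528 308 .nil)))) 724531 468 (.node (.node (.node (.node (.leaf 724542 257) 724543 324 .nil) 724557 401
  (.node (.leaf 724558 468) 724571 449 .nil)) 724572 449 (.node (.node (.leaf 724753 135) 724754 200 .nil)
  724763 151 (.node (.leaf 724764 151) 724765 215 .nil))) 724777 199 (.node (.node (.node (.leaf 724789 248)
  724791 247 .nil) 725009 164 (.node (.leaf 725010 228) 725014 129 .nil)) 725015 161 (.node (.node (.leaf 725020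
  180) 725021 244 .nil) 725026 145 (.node (.leaf 725027 145) 725033 228 .nil))))) 725039 193 (.node (.node
  (.node (.node (.node (.leaf 725040 225) 725053 401 .nil) 725054 241 (.node (.leaf 725055 369) 725069 321
  .nil)) 725083 465 (.node (.node (.leaf 725084 465) 725270 167 .nil) 725273 148 (.node (.leaf 725283 276)
  725285 167 .nil))) 725286 167 (.node (.node (.node (.leaf 725296 292) 725311 436 .nil) 725529 213 (.node
  (.leaf 725541 231) 725542 231 .nil)) 726552 145 (.node (.node (.leaf 726564 225) 726567 209 .nil) 727075 225
  (.node (.leaf 727088 385) 727102 401 .nil)))) 727103 529 (.node (.node (.node (.node (.leaf 727117 449) 727323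
  167 .nil) 727324 167 (.node (.leaf 727325 231) 727337 215 .nil)) 727349 264 (.node (.node (.leaf 727351 263)
  727843 241 .nil) 728099 292 (.node (.leaf 728101 215) 728102 215 .nil))) 729639 225 (.node (.node (.node
  (.leaf 729892 241) 729895 241 .nil) 730160 529 (.node (.leaf 730174 417) 730175 577 .nil)) 730189 561 (.node
  (.node (.leaf 730203 641) 730204 641 .nil) 730409 260 (.leaf 730665 260)))))) 730927 321 (.node (.node (.node
  (.node (.node (.node (.leaf 730928 545) 730942 401 .nil) 730943 593 (.node (.leaf 730957 545) 730971 625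
  .nil)) 730972 625 (.node (.node (.leaf 789777 135) 789778 322 .nil) 789788 210 (.node (.leaf 790036 148)
  790047 228 .nil))) 790048 196 (.node (.node (.node (.leaf 790803 164) 790804 164 .nil) 790805 164 (.node
  (.leaf 790815 212) 790816 180 .nil)) 790817 343 (.node (.node (.leaf 790827 292) 790828 292 .nil) 790829 228
  (.node (.leaf 790842 344) 790844 343 .nil)))) 791061 354 (.node (.node (.node (.node (.leaf 791063 514) 791072
  370 .nil) 791073 370 (.node (.leaf 791085 450) 791086 514 .nil)) 791098 626 (.node (.node (.leaf 791100 498)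
  791320 197 .nil) 791323 213 (.node (.leaf 791336 231) 791576 196 .nil))) 791579 212 (.node (.node (.node
  (.leaf 791580 247) 791588 279 .nil) 791592 263 (.node (.leaf 791835 277) 791836 242 .nil)) 791849 386 (.node
  (.node (.leaf 792607 241) 792608 277 .nil) 793374 231 (.node (.leaf 793375 263) 793376 260 .nil))))) 793387
  312 (.node (.node (.node (.node (.node (.leaf 793388 311) 793389 279 .nil) 793632 260 (.node (.leaf 793633
  386) 793645 340 .nil)) 793658 482 (.node (.node (.leaf 793660 482) 794408 311 .nil) 794664 279 (.node (.leaf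
  794665 402) 794677 482 .nil))) 794921 434 (.node (.node (.node (.leaf 796973 482) 796986 626 .nil) 796988 498
  (.node (.leaf 855570 261) 855580 213 .nil)) 855581 277 (.node (.node (.leaf 855825 146) 855826 180 .nil)
  855836 194 (.node (.leaf 855837 260) 855849 215 .nil)))) 856081 183 (.node (.node (.node (.node (.leaf 856082
  180) 856083 183 .nil) 856092 196 (.node (.leaf 856093 260) 856094 280 .nil)) 856105 215 (.node (.node (.leaf
  856106 279) 856345 162 .nil) 856355 290 (.node (.leaf 856357 180) 856358 180 .nil))) 856368 340 (.node (.node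
  (.node (.leaf 856371 500) 856383 356 .nil) 856398 500 (.node (.leaf 856601 226) 856602 263 .nil)) 856613 277
  (.node (.node (.leaf 856626 295) 857112 225 .nil) 858143 241 (.leaf 858396 210))))))) 858409 258 (.node (.node
  (.node (.node (.node (.node (.node (.leaf 858652 212) 858653 276 .nil) 859173 263 (.node (.leaf 859174 263)
  859186 279 .nil)) 859429 292 (.node (.node (.leaf 861481 279) 921376 209 .nil) 922135 418 (.node (.leaf 922646
  193) 923167 241 .nil))) 923168 209 (.node (.node (.node (.leaf 923421 434) 987412 217 .nil) 987413 148 (.node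
  (.leaf 987424 196) 987425 390 .nil)) 987437 215 (.node (.node (.leaf 987450 424) 987452 423 .nil) 987668 377
  (.node (.leaf 987669 215) 987671 273 .nil)))) 987680 360 (.node (.node (.node (.node (.leaf 987681 321) 987682
  520 .nil) 987692 632 (.node (.leaf 987693 375) 987694 375 .nil)) 987706 456 (.node (.node (.leaf 987708 455)
  987709 519 .nil) 987721 631 (.node (.leaf 987723 503) 987931 226 .nil))) 987937 289 (.node (.node (.node
  (.leaf 988184 274) 988187 258 .nil) 988188 390 (.node (.leaf 988201 406) 988213 486 .nil)) 988443 391 (.node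
  (.node (.leaf 988444 196) 988445 359 .nil) 988457 244 (.node (.leaf 988469 392) 988471 391 .nil))))) 988956
  212 (.node (.node (.node (.node (.node (.leaf 988957 417) 988969 437 .nil) 989216 421 (.node (.leaf 989983
  306) 989984 212 .nil)) 989997 420 (.node (.node (.leaf 990240 212) 990241 247 .nil) 990252 488 (.node (.leaf
  990253 391) 990254 391 .nil))) 990266 408 (.node (.node (.node (.leaf 990268 407) 990281 487 .nil) 990283 487
  (.node (.leaf 990496 372) 990497 337 .nil)) 990509 452 (.node (.node (.leaf 990510 516) 990522 628 .nil)
  990524 500 (.node (.leaf 990753 481) 991272 423 .nil)))) 991273 389 (.node (.node (.node (.node (.leaf 991285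
  408) 991287 407 .nil) 991300 487 (.node (.leaf 991529 388) 991530 481 .nil)) 991541 440 (.node (.node (.leaf
  991543 439) 993580 632 .nil) 993581 404 (.node (.leaf 993582 439) 993594 484 .nil))) 993596 484 (.node (.node
  (.node (.leaf 993609 631) 993611 503 .nil) 994613 484 (.node (.leaf 994615 487) 996666 629 .nil)) 996668 501
  (.node (.node (.leaf 997178 628) 997180 500 .nil) 1052949 273 (.leaf 1052973 401)))))) 1053205 241 (.node
  (.node (.node (.node (.node (.node (.leaf 1053207 263) 1053217 321 .nil) 1053218 424 (.node (.leaf 1053229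
  561) 1053230 401 .nil)) 1053244 545 (.node (.node (.leaf 1053463 276) 1053473 289 .nil) 1053980 257 (.node
  (.leaf 1053981 385) 1053993 337 .nil))) 1054005 481 (.node (.node (.node (.leaf 1054007 481) 1054492 212 .nil)
  1054493 276 (.node (.leaf 1054494 440) 1054506 439 .nil)) 1055777 273 (.node (.node (.leaf 1055789 417)
  1055804 433 .nil) 1056033 337 (.node (.leaf 1056034 440) 1056045 609 .nil)))) 1056046 545 (.node (.node (.node
  (.node (.leaf 1056060 593) 1056289 481 .nil) 1057065 417 (.node (.leaf 1057066 481) 1059117 561 .nil)) 1059132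
  577 (.node (.node (.leaf 1060149 641) 1060151 641 .nil) 1119254 247 (.node (.leaf 1119510 343) 1119513 161
  .nil))) 1119523 289 (.node (.node (.node (.leaf 1119525 407) 1119526 407 .nil) 1119536 433 (.node (.leaf
  1119551 449) 1119776 260 .nil)) 1119789 340 (.node (.node (.leaf 1120544 212) 1120545 407 .nil) 1120557 289
  (.node (.leaf 1120570 440) 1120572 439 .nil))))) 1123629 436 (.node (.node (.node (.node (.node (.leaf 1123885
  436) 1185049 228 .nil) 1185561 519 (.node (.leaf 1185562 423) 1185573 292 .nil)) 1186080 372 (.node (.node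
  (.leaf 1186081 372) 1186093 452 .nil) 1186094 516 (.node (.leaf 1186106 628) 1186108 500 .nil))) 1250840 242
  (.node (.node (.node (.leaf 1250843 228) 1316376 241 .nil) 1316379 260 (.node (.leaf 1382683 407) 1382684 209
  .nil)) 1382697 257 (.node (.node (.leaf 1383461 263) 1383462 263 .nil) 1448735 305 (.node (.leaf 1448736 273)
  1513756 257 .nil)))) 1514013 436 (.node (.node (.node (.node (.leaf 1514533 273) 1645344 417 .nil) 1645357 436
  (.node (.leaf 1645600 264) 1645601 263 .nil)) 1645613 401 (.node (.node (.leaf 1645614 567) 1645626 481 .nil)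
  1645628 481 (.node (.leaf 1645643 631) 1646633 401 .nil))) 1646645 481 (.node (.node (.node (.leaf 1646889
  433) 1648941 481 .nil) 1648954 625 (.node (.leaf 1648956 497) 1843493 567 .nil)) 1843494 567 (.node (.node
  (.leaf 1844525 548) 1844540 628 .nil) 1844781 548 (.leaf 1844796 628))))))))))

set_option maxRecDepth 100000 in
/-- The corresponding states with the robber at `2`. -/
noncomputable def traps2 : BT :=
  (.node (.node (.node (.node (.node (.node (.node (.node (.node (.node (.node (.leaf 14 72) 16 49 .nil) 26 71
  (.node (.leaf 782 56) 783 37 .nil)) 784 33 (.node (.node (.leaf 793 133) 794 55 .nil) 805 117 (.leaf 1038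
  88))) 1040 68 (.node (.node (.node (.leaf 1050 87) 1294 49 .nil) 1296 50 (.leaf 1304 71)) 1306 71 (.node
  (.node (.leaf 1316 133) 1319 130 .nil) 1329 165 (.leaf 1332 162)))) 1344 290 (.node (.node (.node (.node
  (.leaf 2060 40) 2062 40 .nil) 2063 17 (.leaf 2064 17)) 2073 39 (.node (.node (.leaf 2074 39) 2083 197 .nil)
  2085 97 (.leaf 2086 133))) 2096 309 (.node (.node (.node (.leaf 2098 113) 2125 437 .nil) 2318 72 (.leaf 2320
  49)) 2330 71 (.node (.node (.leaf 2576 84) 2830 104 .nil) 2832 82 (.leaf 2842 103))))) 3086 33 (.node (.node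
  (.node (.node (.node (.leaf 3088 56) 3089 101 .nil) 3096 55 (.leaf 3098 82)) 3099 85 (.node (.node (.leaf 3108
  103) 3111 130 .nil) 3112 101 (.leaf 3121 135))) 3124 146 (.node (.node (.node (.leaf 3126 168) 3136 167 .nil)
  3141 453 (.leaf 3151 322)) 3156 466 (.node (.node (.leaf 3170 485) 3342 68 .nil) 3344 66 (.leaf 3354 87))))
  3364 164 (.node (.node (.node (.node (.leaf 3367 164) 3598 37 .nil) 3599 17 (.leaf 3600 17)) 3601 53 (.node
  (.node (.leaf 3602 85) 3605 117 .nil) 3606 49 (.leaf 3607 101))) 3608 85 (.node (.node (.node (.leaf 3609 33)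
  3610 39 .nil) 3611 69 (.leaf 3612 69)) 3613 101 (.node (.node (.leaf 3616 197) 3617 117 .nil) 3618 71 (.leaf
  3619 71)))))) 3620 101 (.node (.node (.node (.node (.node (.node (.leaf 3621 49) 3622 49 .nil) 3624 85 (.node
  (.leaf 3625 85) 3626 181 .nil)) 3629 293 (.node (.node (.leaf 3630 197) 3631 181 .nil) 3632 177 (.leaf 3634
  71))) 3635 71 (.node (.node (.node (.leaf 3637 101) 3638 101 .nil) 3639 101 (.leaf 3640 229)) 3642 309 (.node
  (.node (.leaf 3644 213) 3645 213 .nil) 3646 193 (.leaf 3647 177)))) 3649 161 (.node (.node (.node (.node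
  (.leaf 3654 181) 3659 293 .nil) 3660 341 (.leaf 3661 247)) 3662 193 (.node (.node (.leaf 3664 209) 3665 401
  .nil) 3667 261 (.leaf 3669 261))) 3675 289 (.node (.node (.node (.leaf 3676 273) 3677 321 .nil) 3679 289
  (.leaf 3689 439)) 3690 439 (.node (.node (.leaf 3693 433) 3856 40 .nil) 3857 39 (.leaf 3858 100))))) 3864 39
  (.node (.node (.node (.node (.node (.leaf 3866 98) 3867 68 .nil) 3868 84 (.leaf 3876 68)) 3879 84 (.node
  (.node (.leaf 3880 84) 3881 100 .nil) 3882 228 (.leaf 3889 84))) 3892 135 (.node (.node (.node (.leaf 3893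
  100) 3894 100 .nil) 3895 180 (.leaf 3904 151)) 3907 242 (.node (.node (.leaf 3908 456) 3909 212 .nil) 3910 260
  (.leaf 3919 247)))) 3924 260 (.node (.node (.node (.node (.leaf 3934 327) 3937 488 .nil) 3938 471 (.leaf 3952
  487)) 4112 37 (.node (.node (.leaf 4113 33) 4114 71 .nil) 4115 71 (.leaf 4116 201))) 4117 103 (.node (.node
  (.node (.leaf 4118 69) 4119 82 .nil) 4120 39 (.leaf 4121 53)) 4123 49 (.node (.node (.leaf 4124 49) 4125 87
  .nil) 4126 104 (.leaf 4128 120))))))) 4129 104 (.node (.node (.node (.node (.node (.node (.node (.leaf 4130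
  103) 4131 103 .nil) 4132 68 (.node (.leaf 4133 69) 4134 69 .nil)) 4135 84 (.node (.node (.leaf 4136 71) 4137
  71 .nil) 4138 103 (.leaf 4140 312))) 4141 199 (.node (.node (.node (.leaf 4142 119) 4143 119 .nil) 4144 119
  (.leaf 4145 84)) 4147 197 (.node (.node (.leaf 4149 87) 4150 87 .nil) 4151 87 (.leaf 4152 183)))) 4153 232
  (.node (.node (.node (.node (.leaf 4154 296) 4156 200 .nil) 4157 184 (.leaf 4158 183)) 4159 309 (.node (.node
  (.leaf 4160 228) 4161 213 .nil) 4164 103 (.leaf 4165 103))) 4166 103 (.node (.node (.node (.leaf 4167 231)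
  4169 311 .nil) 4171 215 (.leaf 4172 215)) 4173 231 (.node (.node (.leaf 4174 423) 4176 389 .nil) 4179 184
  (.leaf 4180 260))))) 4181 183 (.node (.node (.node (.node (.node (.leaf 4184 296) 4186 295 .nil) 4187 312
  (.leaf 4188 311)) 4193 263 (.node (.node (.leaf 4195 263) 4201 455 .nil) 4202 455 (.leaf 4377 97))) 4378 55
  (.node (.node (.node (.leaf 4387 168) 4389 113 .nil) 4390 145 (.leaf 4402 129)) 4403 167 (.node (.node (.leaf
  4417 273) 4432 385 .nil) 4433 545 (.leaf 4447 529)))) 4461 545 (.node (.node (.node (.node (.leaf 4633 165)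
  4634 87 .nil) 4645 181 (.leaf 5402 119)) 5656 71 (.node (.node (.leaf 5658 98) 5668 132 .nil) 5671 146 (.leaf
  5681 164))) 5684 194 (.node (.node (.node (.leaf 5696 290) 5914 103 .nil) 5927 214 (.leaf 6169 52)) 6170 87
  (.node (.node (.leaf 6179 136) 6181 68 .nil) 6182 68 (.leaf 6192 196)))))) 6194 119 (.node (.node (.node
  (.node (.node (.node (.leaf 6195 135) 6206 244 .nil) 6207 248 (.leaf 6209 209)) 6221 292 (.node (.node (.leaf
  6222 329) 6224 231 .nil) 6225 513 (.leaf 6235 436))) 6236 436 (.node (.node (.node (.leaf 6237 312) 6239 311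
  .nil) 6251 327 (.leaf 6253 513)) 6263 593 (.node (.node (.leaf 6426 119) 6427 84 .nil) 6428 145 (.leaf 6436
  116)))) 6439 132 (.node (.node (.node (.node (.leaf 6440 100) 6441 167 .nil) 6442 312 (.leaf 6449 135)) 6452
  151 (.node (.node (.leaf 6453 151) 6454 151 .nil) 6455 263 (.leaf 6464 199))) 6467 232 (.node (.node (.node
  (.leaf 6468 215) 6469 167 .nil) 6470 311 (.leaf 6479 231)) 6482 279 (.node (.node (.leaf 6483 583) 6484 312
  .nil) 6494 311 (.leaf 6496 392))))) 6497 536 (.node (.node (.node (.node (.node (.leaf 6498 391) 6508 391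
  .nil) 6511 615 (.leaf 6512 535)) 6523 615 (.node (.node (.leaf 6683 68) 6684 68 .nil) 6685 100 (.leaf 6688
  196))) 6689 116 (.node (.node (.node (.leaf 6690 116) 6691 116 .nil) 6692 100 (.leaf 6696 84)) 6697 84 (.node
  (.node (.leaf 6698 180) 6701 292 .nil) 6702 196 (.leaf 6703 180)))) 6704 308 (.node (.node (.node (.node
  (.leaf 6709 100) 6710 100 .nil) 6711 100 (.leaf 6712 228)) 6714 308 (.node (.node (.leaf 6716 212) 6717 212
  .nil) 6718 228 (.leaf 6719 420))) 6726 180 (.node (.node (.node (.leaf 6731 292) 6732 338 .nil) 6733 308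
  (.leaf 6739 260)) 6741 260 (.node (.node (.leaf 6747 452) 6748 452 .nil) 6947 152 (.leaf 6949 113)))))))) 6950
  129 (.node (.node (.node (.node (.node (.node (.node (.node (.leaf 6960 309) 6962 129 .nil) 6963 151 (.node
  (.leaf 6977 225) 6989 501 .nil)) 6992 273 (.node (.node (.leaf 6993 497) 7005 321 .nil) 7007 385 (.leaf 7021
  529))) 7205 129 (.node (.node (.node (.leaf 7206 164) 7218 177 .nil) 7461 374 (.leaf 8740 164)) 8743 196
  (.node (.node (.leaf 8756 215) 8996 164 .nil) 8999 184 (.leaf 9000 213)))) 9009 183 (.node (.node (.node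
  (.node (.leaf 9012 199) 9253 116 .nil) 9254 132 (.leaf 9263 309)) 9264 183 (.node (.node (.leaf 9266 135) 9267
  183 .nil) 9278 389 (.leaf 9279 216))) 9281 216 (.node (.node (.node (.leaf 9292 633) 9293 407 .nil) 9294 377
  (.leaf 9296 247)) 9307 552 (.node (.node (.leaf 9308 551) 9309 296 .nil) 9311 295 (.leaf 9321 631))))) 9322
  631 (.node (.node (.node (.node (.node (.leaf 9323 375) 9511 136 .nil) 9512 129 (.leaf 9513 183)) 9514 296
  (.node (.node (.leaf 9521 135) 9525 183 .nil) 9526 164 (.leaf 9527 247))) 9528 375 (.node (.node (.node (.leaf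
  9536 228) 9539 276 .nil) 9540 199 (.leaf 9541 183)) 9542 295 (.node (.node (.leaf 9551 308) 9555 376 .nil)
  9556 388 (.leaf 9557 375)))) 9566 388 (.node (.node (.node (.node (.leaf 9569 612) 9570 532 .nil) 9584 612
  (.leaf 9767 148)) 9768 148 (.node (.node (.leaf 9769 260) 9777 183 .nil) 9781 212 (.leaf 9782 164))) 9783 308
  (.node (.node (.node (.leaf 9792 228) 9795 276 .nil) 9796 580 (.leaf 9797 532)) 9807 308 (.node (.node (.leaf
  9812 388) 9822 388 .nil) 9825 612 (.leaf 9826 532)))))) 9840 612 (.node (.node (.node (.node (.node (.node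
  (.leaf 10031 215) 10032 199 .nil) 10035 213 (.node (.leaf 10045 312) 10046 311 .nil)) 10047 535 (.node (.node
  (.leaf 10049 245) 10060 617 .nil) 10061 391 (.leaf 10062 583))) 10064 293 (.node (.node (.node (.leaf 10075
  536) 10076 535 .nil) 10077 373 (.leaf 10089 615)) 10090 615 (.node (.node (.leaf 10290 177) 10291 215 .nil)
  10305 273 (.leaf 10320 385)))) 10321 673 (.node (.node (.node (.node (.leaf 10335 529) 10349 673 .nil) 10546
  247 (.leaf 10802 375)) 12084 311 (.node (.node (.leaf 12337 519) 12340 535 .nil) 12595 212 (.leaf 12606 404)))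
  12607 564 (.node (.node (.node (.leaf 12609 244) 12621 548 .nil) 12624 292 (.leaf 12635 628)) 12636 628 (.node
  (.node (.leaf 12637 372) 12853 196 .nil) 12854 180 (.leaf 12855 292))))) 12870 372 (.node (.node (.node (.node
  (.node (.leaf 13374 388) 13375 580 .nil) 13389 532 (.leaf 13403 612)) 13404 612 (.node (.node (.leaf 197391
  114) 197392 49 .nil) 197647 114 (.leaf 197648 52))) 197902 56 (.node (.node (.node (.leaf 197903 34) 197904 34
  .nil) 197912 85 (.leaf 197913 98)) 197914 55 (.node (.node (.leaf 197924 130) 197925 82 .nil) 197927 103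
  (.leaf 197937 149)))) 197938 98 (.node (.node (.node (.node (.leaf 197940 135) 197952 242 .nil) 197954 168
  (.leaf 197955 167)) 197957 517 (.node (.node (.leaf 197967 295) 197969 322 .nil) 197972 469 (.leaf 197982
  338))) 197983 466 (.node (.node (.node (.leaf 197986 549) 197997 482 .nil) 198668 85 (.leaf 198671 33)) 198672
  33 (.node (.node (.leaf 198681 119) 198693 113 .nil) 198928 65 (.leaf 199183 130))))))) 199438 88 (.node
  (.node (.node (.node (.node (.node (.node (.leaf 199439 103) 199440 69 .nil) 199449 146 (.node (.leaf 199450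
  87) 199461 162 .nil)) 199694 49 (.node (.node (.leaf 199695 87) 199696 52 .nil) 199704 71 (.leaf 199706 71)))
  199707 88 (.node (.node (.node (.leaf 199716 87) 199717 88 .nil) 199719 87 (.leaf 199729 135)) 199732 135
  (.node (.node (.leaf 199734 152) 199744 151 .nil) 199746 152 (.leaf 199747 151)))) 199748 520 (.node (.node
  (.node (.node (.leaf 199749 473) 199759 247 .nil) 199764 328 (.leaf 199774 327)) 199777 552 (.node (.node
  (.leaf 199778 471) 199792 551 .nil) 199950 72 (.leaf 199951 87))) 199952 52 (.node (.node (.node (.leaf 199961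
  162) 199962 71 .nil) 199972 148 (.leaf 199973 136)) 199975 132 (.node (.node (.leaf 199986 194) 199988 164
  .nil) 200000 292 (.leaf 200207 33))))) 200208 33 (.node (.node (.node (.node (.node (.leaf 200213 165) 200214
  65 .nil) 200215 85 (.leaf 200217 49)) 200225 165 (.node (.node (.leaf 200226 87) 200227 87 .nil) 200229 65
  (.leaf 200230 65))) 200237 277 (.node (.node (.node (.leaf 200238 181) 200239 197 .nil) 200240 193 (.leaf
  200243 193)) 200252 261 (.node (.node (.leaf 200253 309) 200254 241 .nil) 200255 305 (.leaf 200257 209))))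
  200269 289 (.node (.node (.node (.node (.leaf 200272 385) 200283 433 .nil) 200284 433 (.leaf 200463 100))
  200464 69 (.node (.node (.leaf 200465 97) 200467 178 .nil) 200468 178 (.leaf 200469 116))) 200470 100 (.node
  (.node (.node (.leaf 200471 100) 200472 85 .nil) 200474 85 (.leaf 200475 81)) 200479 226 (.node (.node (.leaf
  200480 162) 200481 116 .nil) 200482 132 (.leaf 200484 103)))))) 200485 104 (.node (.node (.node (.node (.node
  (.node (.leaf 200487 103) 200488 97 .nil) 200491 306 (.leaf 200492 306)) 200493 210 (.node (.node (.leaf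
  200494 196) 200495 180 .nil) 200496 308 (.leaf 200497 119))) 200500 119 (.node (.node (.node (.leaf 200501
  553) 200502 168 .nil) 200506 242 (.leaf 200508 212)) 200509 212 (.node (.node (.leaf 200510 228) 200512 167
  .nil) 200514 168 (.leaf 200515 167)))) 200516 504 (.node (.node (.node (.node (.leaf 200517 183) 200523 292
  .nil) 200524 340 (.leaf 200525 308)) 200527 183 (.node (.node (.leaf 200530 247) 200531 551 .nil) 200532 280
  (.leaf 200542 279))) 200544 360 (.node (.node (.node (.leaf 200545 504) 200546 359 .nil) 200556 359 (.leaf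
  200559 583)) 200560 503 (.node (.node (.leaf 200571 583) 200721 49 .nil) 200722 81 (.leaf 200725 87)))))
  200726 71 (.node (.node (.node (.node (.node (.leaf 200727 71) 200728 81 .nil) 200729 87 (.leaf 200731 65))
  200732 65 (.node (.node (.leaf 200733 97) 200736 168 .nil) 200737 88 (.leaf 200738 87))) 200739 87 (.node
  (.node (.node (.leaf 200740 97) 200744 81 .nil) 200745 81 (.leaf 200746 177)) 200749 265 (.node (.node (.leaf
  200750 167) 200751 151 .nil) 200752 280 (.leaf 200757 97)))) 200758 97 (.node (.node (.node (.node (.leaf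
  200759 97) 200760 225 .nil) 200762 280 (.leaf 200764 184)) 200765 183 (.node (.node (.leaf 200766 199) 200767
  391 .nil) 200774 177 (.leaf 200779 263))) 200780 311 (.node (.node (.node (.leaf 200781 279) 200787 257 .nil)
  200789 257 (.leaf 200795 424)) 200796 423 (.node (.node (.leaf 200985 145) 200997 129 .nil) 200998 161 (.leaf
  202010 167))))))))) 202264 84 (.node (.node (.node (.node (.node (.node (.node (.node (.node (.leaf 202266 84)
  202276 132 .nil) 202277 104 (.node (.leaf 202279 103) 202289 148 .nil)) 202292 148 (.node (.node (.leaf 202304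
  244) 202306 200 .nil) 202307 199 (.leaf 202309 516))) 202319 295 (.node (.node (.node (.leaf 202324 468)
  202338 548 .nil) 202521 178 (.leaf 202522 87)) 202532 264 (.node (.node (.leaf 202533 194) 202535 214 .nil)
  202548 263 (.leaf 202777 103)))) 202787 193 (.node (.node (.node (.node (.leaf 202789 113) 202790 129 .nil)
  202800 305 (.leaf 202803 241)) 202814 452 (.node (.node (.leaf 202817 225) 202829 468 .nil) 202832 305 (.leaf
  202845 321))) 203034 100 (.node (.node (.node (.leaf 203035 116) 203036 161 .nil) 203044 116 (.leaf 203047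
  116)) 203048 145 (.node (.node (.leaf 203049 257) 203057 164 .nil) 203060 164 (.leaf 203061 209))))) 203062
  161 (.node (.node (.node (.node (.node (.leaf 203063 305) 203072 180 .nil) 203075 244 (.leaf 203076 548))
  203077 500 (.node (.node (.leaf 203087 276) 203092 356 .nil) 203102 356 (.leaf 203105 580))) 203106 500 (.node
  (.node (.node (.leaf 203120 580) 203297 164 .nil) 203298 103 (.leaf 203299 103)) 203309 276 (.node (.node
  (.leaf 203310 180) 203311 196 .nil) 203312 296 (.leaf 203324 260)))) 203325 216 (.node (.node (.node (.node
  (.leaf 203326 215) 203327 407 .nil) 203340 295 (.leaf 203341 295)) 203354 344 (.node (.node (.leaf 203355 343)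
  203356 439 .nil) 203369 519 (.leaf 203557 129))) 203558 145 (.node (.node (.node (.leaf 203585 273) 203600 385
  .nil) 203813 177 (.leaf 205093 264)) 205095 261 (.node (.node (.leaf 205348 148) 205349 200 .nil) 205351 148
  (.leaf 205364 196)))))) 205376 292 (.node (.node (.node (.node (.node (.node (.leaf 205378 280) 205379 279
  .nil) 205604 148 (.node (.leaf 205607 148) 205620 196 .nil)) 205632 292 (.node (.node (.leaf 205861 129)
  205862 177 .nil) 205871 293 (.leaf 205872 485))) 205875 209 (.node (.node (.node (.leaf 205885 341) 205886 373
  .nil) 205887 535 (.leaf 205889 241)) 205901 517 (.node (.node (.leaf 205904 289) 205915 536 .nil) 205916 535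
  (.leaf 205917 369)))) 206120 177 (.node (.node (.node (.node (.leaf 206121 241) 206122 369 .nil) 206126 341
  (.leaf 206127 213)) 206128 405 (.node (.node (.leaf 206133 193) 206134 177 .nil) 206135 289 (.leaf 206141
  293))) 206142 293 (.node (.node (.node (.leaf 206150 369) 206156 341 .nil) 206157 437 (.leaf 206171 517))
  206376 209 (.node (.node (.leaf 206638 340) 206639 212 .nil) 206640 376 (.leaf 206653 292))))) 206654 292
  (.node (.node (.node (.node (.node (.leaf 206655 487) 206668 340 .nil) 206669 375 (.leaf 206683 516)) 206684
  519 (.node (.node (.leaf 208692 276) 208945 535 .nil) 208948 487 (.leaf 208962 664))) 208963 663 (.node (.node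
  (.node (.leaf 209214 516) 209229 532 .nil) 209981 340 (.leaf 209982 372)) 209983 663 (.node (.node (.leaf
  209997 516) 210011 664 .nil) 210012 663 (.leaf 212546 520)))) 212547 519 (.node (.node (.node (.node (.leaf
  213581 661) 213837 660 .nil) 263184 81 (.leaf 263438 65)) 263440 65 (.node (.node (.leaf 263448 87) 263460 161
  .nil) 263463 161 (.leaf 264204 85))) 264207 33 (.node (.node (.node (.leaf 264208 33) 264217 119 .nil) 264227
  213 (.leaf 264229 113)) 264230 229 (.node (.node (.leaf 264240 293) 264243 453 .nil) 264255 309 (.leaf 264269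
  453))))))) 264284 469 (.node (.node (.node (.node (.node (.node (.node (.leaf 264464 65) 264976 97 .nil)
  265230 49 (.node (.leaf 265232 72) 265233 165 .nil)) 265240 71 (.node (.node (.leaf 265243 136) 265252 129
  .nil) 265255 145 (.leaf 265256 197))) 265265 161 (.node (.node (.node (.leaf 265486 84) 265488 81 .nil) 265743
  33 (.leaf 265744 33)) 265750 65 (.node (.node (.leaf 265753 49) 265762 87 .nil) 265763 87 (.leaf 265765 65))))
  265766 65 (.node (.node (.node (.node (.leaf 265775 297) 265776 193 .nil) 265778 520 (.leaf 265779 167))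
  265790 216 (.node (.node (.leaf 265791 215) 265793 209 .nil) 265804 457 (.leaf 265805 289))) 265806 359 (.node
  (.node (.node (.leaf 265808 385) 265819 433 .nil) 265820 376 (.leaf 265821 375)) 265833 455 (.node (.node
  (.leaf 265834 455) 265845 472 .nil) 265846 471 (.leaf 266000 88))))) 266001 97 (.node (.node (.node (.node
  (.node (.leaf 266002 244) 266008 87 .nil) 266011 81 (.leaf 266012 167)) 266020 113 (.node (.node (.leaf 266023
  129) 266024 97 .nil) 266025 244 (.leaf 266033 145))) 266037 199 (.node (.node (.node (.leaf 266038 199) 266048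
  241 .nil) 266053 449 (.leaf 266063 321)) 266068 465 (.node (.node (.leaf 266082 481) 266257 49 .nil) 266258 81
  (.leaf 266261 113)))) 266262 85 (.node (.node (.node (.node (.leaf 266263 97) 266264 81 .nil) 266265 113
  (.leaf 266267 65)) 266268 65 (.node (.node (.leaf 266269 97) 266272 193 .nil) 266273 113 (.leaf 266274 113)))
  266275 113 (.node (.node (.node (.leaf 266276 97) 266278 165 .nil) 266280 81 (.leaf 266281 81)) 266282 177
  (.node (.node (.leaf 266285 289) 266286 193 .nil) 266287 177 (.leaf 266288 213)))))) 266291 325 (.node (.node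
  (.node (.node (.node (.node (.leaf 266293 97) 266294 97 .nil) 266295 97 (.leaf 266296 225)) 266298 305 (.node
  (.node (.leaf 266300 209) 266301 209 .nil) 266302 225 (.leaf 266303 357))) 266305 517 (.node (.node (.node
  (.leaf 266310 177) 266315 289 .nil) 266316 337 (.leaf 266317 305)) 266318 373 (.node (.node (.leaf 266323 257)
  266325 257 .nil) 266331 449 (.leaf 266332 449)))) 266346 469 (.node (.node (.node (.node (.leaf 266521 145)
  266533 129 .nil) 266534 161 (.leaf 267800 87)) 267812 161 (.node (.node (.leaf 267815 193) 268313 113 .nil)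
  268323 193 (.leaf 268325 113))) 268326 129 (.node (.node (.node (.leaf 268336 212) 268339 241 .nil) 268350 292
  (.leaf 268351 356)) 268353 225 (.node (.node (.leaf 268365 436) 268366 372 .nil) 268368 305 (.leaf 268379
  452))))) 268380 452 (.node (.node (.node (.node (.node (.leaf 268381 321) 268394 468 .nil) 268571 129 (.leaf
  268572 161)) 268580 129 (.node (.node (.leaf 268583 145) 268584 145 .nil) 268585 257 (.leaf 268593 193)))
  268597 209 (.node (.node (.node (.leaf 268598 161) 268599 305 .nil) 268608 225 (.leaf 268611 273)) 268612 577
  (.node (.node (.leaf 268613 529) 268623 305 .nil) 268628 385 (.leaf 268638 385)))) 268641 609 (.node (.node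
  (.node (.node (.leaf 268642 529) 268656 609 .nil) 269091 213 (.leaf 269093 129)) 269094 145 (.node (.node
  (.leaf 269107 263) 269121 273 .nil) 269136 385 (.leaf 269349 177))) 270887 209 (.node (.node (.node (.leaf
  271140 177) 271143 193 .nil) 271397 129 (.leaf 271398 177)) 271408 513 (.node (.node (.leaf 271411 209) 271422
  401 .nil) 271423 561 (.leaf 271425 241)))))))) 271437 545 (.node (.node (.node (.node (.node (.node (.node
  (.node (.leaf 271440 289) 271451 625 .nil) 271452 625 (.node (.leaf 271453 369) 271656 177 .nil)) 271657 241
  (.node (.node (.leaf 271658 369) 271669 193 .nil) 271670 177 (.leaf 271671 289))) 271686 369 (.node (.node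
  (.node (.leaf 271912 209) 272175 305 .nil) 272176 529 (.leaf 272190 385)) 272191 577 (.node (.node (.leaf
  272205 529) 272219 609 .nil) 272220 609 (.leaf 328974 49)))) 328976 72 (.node (.node (.node (.node (.leaf
  328984 71) 329740 40 .nil) 329742 40 (.leaf 329743 17)) 329744 17 (.node (.node (.leaf 329752 98) 329753 39
  .nil) 329754 39 (.leaf 329763 101))) 329764 85 (.node (.node (.node (.leaf 329765 69) 329766 85 .nil) 329767
  69 (.leaf 329776 181)) 329777 135 (.node (.node (.leaf 329778 85) 329779 101 .nil) 329780 85 (.leaf 329791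
  181))))) 329792 226 (.node (.node (.node (.node (.node (.leaf 329793 101) 329794 101 .nil) 329795 151 (.leaf
  329797 530)) 329805 293 (.node (.node (.leaf 329806 197) 329807 247 .nil) 329808 213 (.leaf 329809 213)))
  329810 263 (.node (.node (.node (.leaf 329812 328) 329820 277 .nil) 329821 325 (.leaf 329822 327)) 329823 261
  (.node (.node (.leaf 329824 344) 329826 530 .nil) 329836 343 (.leaf 329837 309)))) 329838 453 (.node (.node
  (.node (.node (.leaf 329840 610) 329847 453 .nil) 329998 72 (.leaf 330000 49)) 330008 98 (.node (.node (.leaf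
  330010 71) 330020 146 .nil) 330023 132 (.leaf 330033 194))) 330036 164 (.node (.node (.node (.leaf 330048 290)
  330254 82 .nil) 330256 104 (.leaf 330264 103)) 330276 213 (.node (.node (.leaf 330289 306) 330510 82 .nil)
  330512 104 (.leaf 330520 103)))))) 330766 33 (.node (.node (.node (.node (.node (.node (.leaf 330768 56)
  330769 133 .nil) 330776 55 (.leaf 330779 117)) 331022 68 (.node (.node (.leaf 331024 88) 331032 87 .nil)
  331278 37 (.leaf 331279 17))) 331280 17 (.node (.node (.node (.leaf 331281 53) 331282 103 .nil) 331283 103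
  (.leaf 331284 103)) 331285 103 (.node (.node (.leaf 331286 49) 331287 87 .nil) 331289 33 (.leaf 331290 39))))
  331291 69 (.node (.node (.node (.node (.leaf 331292 69) 331293 119 .nil) 331294 119 (.leaf 331295 119)) 331296
  119 (.node (.node (.leaf 331297 119) 331298 71 .nil) 331299 71 (.leaf 331300 84))) 331301 49 (.node (.node
  (.node (.leaf 331302 49) 331303 68 .nil) 331305 213 (.leaf 331306 245)) 331307 200 (.node (.node (.leaf 331308
  199) 331309 199 .nil) 331311 185 (.leaf 331312 87))))) 331314 71 (.node (.node (.node (.node (.node (.leaf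
  331315 71) 331316 84 .nil) 331321 279 (.leaf 331322 248)) 331323 279 (.node (.node (.leaf 331324 247) 331326
  104 .nil) 331327 88 (.leaf 331328 228))) 331329 87 (.node (.node (.node (.leaf 331330 87) 331331 212 .nil)
  331340 297 (.leaf 331341 183)) 331342 103 (.node (.node (.leaf 331343 404) 331344 103 .nil) 331345 103 (.leaf
  331346 296)))) 331355 280 (.node (.node (.node (.node (.leaf 331356 184) 331357 168 .nil) 331359 167 (.leaf
  331360 407)) 331369 295 (.node (.node (.leaf 331370 199) 331371 199 .nil) 331373 215 (.leaf 331374 296)))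
  331381 280 (.node (.node (.node (.leaf 331382 279) 331383 296 .nil) 331385 439 (.leaf 331394 439)) 331536 40
  (.node (.node (.leaf 331537 39) 331538 196 .nil) 331544 39 (.leaf 331547 97))))))) 331548 132 (.node (.node
  (.node (.node (.node (.node (.node (.leaf 331560 113) 331792 37 .nil) 331793 33 (.node (.leaf 331794 71)
  331795 71 .nil)) 331796 117 (.node (.node (.leaf 331797 117) 331798 69 .nil) 331800 39 (.leaf 331801 53)))
  331802 85 (.node (.node (.node (.leaf 331803 49) 331804 49 .nil) 331805 177 (.leaf 331806 200)) 331807 197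
  (.node (.node (.leaf 331808 197) 331811 85 .nil) 331813 69 (.leaf 331814 69)))) 331815 101 (.node (.node
  (.node (.node (.leaf 331816 71) 331817 71 .nil) 331818 199 (.leaf 331819 277)) 331820 277 (.node (.node (.leaf
  331821 245) 331824 101 .nil) 331826 85 (.leaf 331827 85))) 331829 209 (.node (.node (.node (.leaf 331831 177)
  331832 241 .nil) 331838 181 (.leaf 331839 101)) 331841 101 (.node (.node (.leaf 331842 101) 331846 257 .nil)
  331853 277 (.leaf 331854 181))))) 331856 165 (.node (.node (.node (.node (.node (.leaf 331857 293) 331858 405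
  .nil) 331867 293 (.leaf 331868 197)) 331869 197 (.node (.node (.leaf 331871 213) 331882 277 .nil) 331883 325
  (.leaf 331885 293))) 331886 437 (.node (.node (.node (.leaf 331895 437) 332056 119 .nil) 332057 97 (.leaf
  332058 55)) 332067 168 (.node (.node (.leaf 332068 132) 332069 84 .nil) 332070 145 (.leaf 332071 116))))
  332081 151 (.node (.node (.node (.node (.leaf 332082 100) 332083 167 .nil) 332084 135 (.leaf 332095 280))
  332096 232 (.node (.node (.leaf 332097 151) 332098 151 .nil) 332099 199 (.leaf 332110 361))) 332111 263 (.node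
  (.node (.node (.leaf 332112 215) 332113 167 .nil) 332114 231 (.leaf 332116 312)) 332125 312 (.node (.node
  (.leaf 332126 311) 332127 311 .nil) 332128 392 (.leaf 332139 359)))))) 332140 391 (.node (.node (.node (.node
  (.node (.node (.leaf 332141 391) 332142 536 .nil) 332151 536 (.leaf 332153 551)) 332162 551 (.node (.node
  (.leaf 332312 119) 332313 165 .nil) 332314 133 (.leaf 332324 184))) 332325 149 (.node (.node (.node (.leaf
  332327 164) 332337 199 .nil) 332338 213 (.leaf 332340 183)) 332369 549 (.node (.node (.leaf 332383 533) 332397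
  549 .nil) 332568 119 (.leaf 332580 196)))) 332583 164 (.node (.node (.node (.node (.leaf 332593 215) 332824
  119 .nil) 332836 290 (.leaf 333080 119)) 333336 71 (.node (.node (.leaf 333849 52) 333850 84 .nil) 333855 196
  (.leaf 333856 196))) 333859 84 (.node (.node (.node (.leaf 333861 68) 333862 68 .nil) 333863 100 (.leaf 333867
  276)) 333868 276 (.node (.node (.leaf 333869 244) 333872 100 .nil) 333874 84 (.leaf 333875 84))))) 333886 180
  (.node (.node (.node (.node (.node (.leaf 333887 100) 333889 100 .nil) 333890 100 (.leaf 333901 276)) 333902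
  180 (.node (.node (.leaf 333904 164) 333905 292 .nil) 333906 404 (.leaf 333915 292))) 333916 196 (.node (.node
  (.node (.leaf 333917 196) 333919 212 .nil) 333930 276 (.leaf 333931 324)) 333933 292 (.node (.node (.leaf
  333934 436) 333943 436 .nil) 334107 113 (.leaf 334108 145)))) 334120 129 (.node (.node (.node (.node (.leaf
  334121 167) 334363 68 .nil) 334364 68 (.leaf 334365 196)) 334366 440 (.node (.node (.leaf 334376 119) 334377
  135 .nil) 334378 244 (.leaf 334389 225))) 334391 231 (.node (.node (.node (.leaf 334392 455) 334393 472 .nil)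
  334406 311 (.leaf 334407 471)) 334627 184 (.node (.node (.leaf 334628 136) 334629 113 .nil) 334630 129 (.leaf
  334631 119)))))))))) 334642 129 (.node (.node (.node (.node (.node (.node (.node (.node (.node (.node (.leaf
  334643 183) 334644 135 .nil) 334655 264 (.node (.leaf 334656 260) 334657 183 .nil)) 334658 164 (.node (.node
  (.leaf 334659 228) 334670 377 .nil) 334671 308 (.leaf 334672 199))) 334673 183 (.node (.node (.node (.leaf
  334674 520) 334685 296 .nil) 334686 388 (.leaf 334687 295)) 334688 567 (.node (.node (.leaf 334699 375) 334701
  375 .nil) 334702 520 (.leaf 334711 520)))) 334713 599 (.node (.node (.node (.node (.leaf 334722 599) 334884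
  148 .nil) 334885 129 (.leaf 334886 164)) 334887 132 (.node (.node (.leaf 334898 148) 334899 276 .nil) 334900
  183 (.leaf 334912 260))) 334913 212 (.node (.node (.node (.leaf 334914 164) 334915 228 .nil) 334927 308 (.leaf
  334928 308)) 334929 500 (.node (.node (.leaf 334930 548) 334941 356 .nil) 334942 388 (.leaf 334943 388)))))
  334957 532 (.node (.node (.node (.node (.node (.leaf 334958 548) 334967 548 .nil) 335140 196 (.leaf 335141
  440)) 335143 180 (.node (.node (.leaf 335156 519) 335396 212 .nil) 335399 517 (.leaf 335412 567))) 336937 213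
  (.node (.node (.node (.leaf 336938 373) 336949 261 .nil) 336951 293 (.leaf 336952 517)) 336953 597 (.node
  (.node (.leaf 336966 373) 336967 597 .nil) 337192 129 (.leaf 337193 151)))) 337194 449 (.node (.node (.node
  (.node (.leaf 337207 305) 337208 469 .nil) 337448 177 (.leaf 337704 135)) 337705 183 (.node (.node (.leaf
  337706 296) 337707 567 .nil) 337717 216 (.leaf 337719 215))) 337720 375 (.node (.node (.node (.leaf 337721
  520) 337732 263 .nil) 337734 295 (.leaf 337735 519)) 337736 599 (.node (.node (.leaf 337747 376) 337749 375
  .nil) 337750 599 (.leaf 337970 177)))))) 337971 260 (.node (.node (.node (.node (.node (.node (.leaf 337985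
  196) 337986 180 .nil) 338000 292 (.node (.leaf 338001 516) 338002 564 .nil)) 338013 372 (.node (.node (.leaf
  338015 372) 338029 516 .nil) 338030 596 (.leaf 338039 596))) 338226 212 (.node (.node (.node (.leaf 338228
  215) 338257 548 .nil) 338271 532 (.leaf 338285 548)) 338484 375 (.node (.node (.leaf 341045 260) 341047 292
  .nil) 341048 516 (.leaf 341049 596)))) 341062 372 (.node (.node (.node (.node (.leaf 341063 596) 526348 98
  .nil) 526351 113 (.leaf 526604 98)) 526607 116 (.node (.node (.leaf 526860 98) 526863 116 .nil) 526873 135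
  (.leaf 526883 258))) 526886 274 (.node (.node (.node (.leaf 526896 370) 526911 450 .nil) 526925 594 (.leaf
  527116 98)) 527118 168 (.node (.node (.leaf 527119 116) 527120 81 .nil) 527129 135 (.leaf 527130 117)))))
  527139 258 (.node (.node (.node (.node (.node (.leaf 527141 151) 527142 151 .nil) 527152 274 (.leaf 527154
  167)) 527155 322 (.node (.node (.leaf 527167 354) 527169 514 .nil) 527181 594 (.leaf 527182 434))) 527196 578
  (.node (.node (.node (.leaf 527372 117) 527373 117 .nil) 527374 65 (.leaf 527375 36)) 527376 36 (.node (.node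
  (.leaf 527379 146) 527380 146 .nil) 527381 146 (.leaf 527383 133)))) 527384 81 (.node (.node (.node (.node
  (.leaf 527385 100) 527386 81 .nil) 527387 104 (.leaf 527391 194)) 527392 165 (.node (.node (.leaf 527393 149)
  527394 165 .nil) 527396 103 (.leaf 527397 84))) 527399 103 (.node (.node (.node (.leaf 527403 274) 527404 274
  .nil) 527405 213 (.leaf 527406 229)) 527407 213 (.node (.node (.leaf 527409 119) 527410 100 .nil) 527412 119
  (.leaf 527414 168))))))) 527418 245 (.node (.node (.node (.node (.node (.node (.node (.leaf 527420 245) 527421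
  245 .nil) 527424 167 (.node (.leaf 527426 168) 527427 167 .nil)) 527428 536 (.node (.node (.leaf 527429 361)
  527435 325 .nil) 527436 373 (.leaf 527439 231))) 527441 183 (.node (.node (.node (.leaf 527442 183) 527444 280
  .nil) 527454 279 (.leaf 527455 468)) 527456 360 (.node (.node (.leaf 527457 536) 527458 359 .nil) 527468 359
  (.leaf 527469 484)))) 527472 535 (.node (.node (.node (.node (.leaf 527483 615) 527630 88 .nil) 527631 36
  (.leaf 527632 36)) 527641 100 (.node (.node (.leaf 527642 87) 527651 274 .nil) 527652 132 (.leaf 527653 84)))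
  527654 167 (.node (.node (.node (.leaf 527655 116) 527664 322 .nil) 527666 100 (.leaf 527667 482)) 527668 148
  (.node (.node (.leaf 527679 338) 527680 244 .nil) 527681 199 (.leaf 527682 199))))) 527683 260 (.node (.node
  (.node (.node (.node (.leaf 527694 482) 527695 324 .nil) 527697 324 (.leaf 527710 340)) 527711 468 (.node
  (.node (.leaf 527725 484) 527887 81 .nil) 527893 181 (.leaf 527894 81))) 527895 181 (.node (.node (.node
  (.leaf 527906 197) 527917 277 .nil) 527919 373 (.leaf 527920 401)) 527934 449 (.node (.node (.leaf 527949 465)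
  528143 117 .nil) 528144 81 (.leaf 528147 136)))) 528148 135 (.node (.node (.node (.node (.leaf 528149 135)
  528150 119 .nil) 528151 119 (.leaf 528152 97)) 528154 97 (.node (.node (.leaf 528155 113) 528158 183 .nil)
  528159 183 (.leaf 528160 152))) 528161 136 (.node (.node (.node (.leaf 528162 136) 528164 113 .nil) 528165 117
  (.leaf 528167 113)) 528171 232 (.node (.node (.leaf 528172 231) 528173 167 .nil) 528174 151 (.leaf 528175
  167)))))) 528177 161 (.node (.node (.node (.node (.node (.node (.leaf 528180 161) 528182 177 .nil) 528185 311
  (.leaf 528186 216)) 528187 311 (.node (.node (.leaf 528188 215) 528189 216 .nil) 528190 215 (.leaf 528192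
  177))) 528194 181 (.node (.node (.node (.leaf 528195 181) 528196 545 .nil) 528197 497 (.leaf 528201 247))
  528203 247 (.node (.node (.leaf 528204 247) 528207 273 .nil) 528212 353 (.leaf 528216 328)))) 528218 327
  (.node (.node (.node (.node (.leaf 528219 375) 528222 353 .nil) 528225 577 (.leaf 528226 497)) 528240 577
  (.node (.node (.leaf 528405 161) 528406 81 .nil) 528407 81 (.leaf 528416 180))) 528417 161 (.node (.node
  (.node (.leaf 528418 145) 528429 244 .nil) 528430 177 (.leaf 528431 193)) 528432 385 (.node (.node (.leaf
  528442 276) 528444 257 .nil) 528445 305 (.leaf 528446 273))))) 528461 417 (.node (.node (.node (.node (.node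
  (.leaf 529177 183) 529200 578 .nil) 529433 183 (.leaf 529456 578)) 529689 148 (.node (.node (.leaf 529690 183)
  529699 274 .nil) 529701 164 (.leaf 529702 322))) 529712 418 (.node (.node (.node (.leaf 529715 514) 529727 370
  .nil) 529742 578 (.leaf 529944 100)) 529946 97 (.node (.node (.leaf 529956 116) 529957 116 .nil) 529959 116
  (.leaf 529969 164)))) 529972 164 (.node (.node (.node (.node (.leaf 529984 228) 529986 180 .nil) 529987 180
  (.leaf 529989 532)) 529999 276 (.node (.node (.leaf 530004 356) 530014 356 .nil) 530018 532 (.leaf 530032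
  612))) 530201 135 (.node (.node (.node (.leaf 530202 116) 530213 164 .nil) 530214 183 (.leaf 530215 231))
  530226 196 (.node (.node (.leaf 530719 228) 530720 164 .nil) 530721 148 (.leaf 530722 164)))))))) 530731 308
  (.node (.node (.node (.node (.node (.node (.node (.node (.leaf 530732 308) 530733 212 .nil) 530734 228 (.node
  (.leaf 530735 212) 530746 244 .nil)) 530748 244 (.node (.node (.leaf 530749 244) 530763 324 .nil) 530764 372
  (.leaf 530977 232))) 530978 193 (.node (.node (.node (.leaf 530989 276) 530990 313 .nil) 530991 209 (.leaf
  530992 401)) 531005 289 (.node (.node (.leaf 531006 289) 531020 311 .nil) 531021 433 (.leaf 531035 513))))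
  532773 197 (.node (.node (.node (.node (.leaf 532786 295) 533028 264 .nil) 533029 197 (.leaf 533031 209))
  533042 231 (.node (.node (.leaf 533044 263) 533551 373 .nil) 533552 529 (.leaf 533566 513))) 533581 529 (.node
  (.node (.node (.leaf 533806 295) 533807 231 .nil) 533820 376 (.leaf 533821 280)) 533822 279 (.node (.node
  (.leaf 533836 327) 534319 263 .nil) 534320 481 (.leaf 534333 308))))) 534334 369 (.node (.node (.node (.node
  (.node (.leaf 534349 513) 536114 375 .nil) 536370 279 (.leaf 536372 375)) 536628 657 (.node (.node (.leaf
  537149 324) 537662 513 .nil) 537677 657 (.leaf 592654 168))) 592656 81 (.node (.node (.node (.leaf 592666 167)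
  592910 65 .nil) 592912 65 (.leaf 592920 81)) 592922 81 (.node (.node (.leaf 592923 104) 592932 103 .nil)
  592935 129 (.leaf 592945 145)))) 592948 145 (.node (.node (.node (.node (.leaf 592950 200) 592960 199 .nil)
  592963 296 (.leaf 592965 513)) 592975 295 (.node (.node (.leaf 592980 465) 592994 545 .nil) 593166 88 (.leaf
  593168 65))) 593178 87 (.node (.node (.node (.leaf 593188 196) 593191 164 .nil) 593423 81 (.leaf 593429 181))
  593430 81 (.node (.node (.leaf 593431 181) 593441 197 .nil) 593442 197 (.leaf 593453 293)))))) 593454 277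
  (.node (.node (.node (.node (.node (.node (.leaf 593455 373) 593456 401 .nil) 593468 277 (.leaf 593470 449))
  593485 465 (.node (.node (.leaf 593680 81) 593688 97 .nil) 593690 97 (.leaf 593691 113))) 593700 113 (.node
  (.node (.node (.leaf 593703 113) 593713 161 .nil) 593716 161 (.leaf 593718 177)) 593728 177 (.node (.node
  (.leaf 593731 241) 593732 545 .nil) 593733 497 (.leaf 593743 273)))) 593748 353 (.node (.node (.node (.node
  (.leaf 593758 353) 593761 577 .nil) 593762 497 (.leaf 593776 577)) 593941 161 (.node (.node (.leaf 593942 81)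
  593943 81 .nil) 593952 184 (.leaf 593953 161))) 593954 145 (.node (.node (.node (.leaf 593965 273) 593966 177
  .nil) 593967 193 (.leaf 593968 385)) 593978 296 (.node (.node (.leaf 593980 257) 593981 279 .nil) 593982 273
  (.leaf 593995 279))))) 593997 417 (.node (.node (.node (.node (.node (.leaf 595226 183) 595480 100 .nil)
  595482 97 (.leaf 595492 145)) 595495 145 (.node (.node (.leaf 595505 196) 595508 193 .nil) 595520 289 (.leaf
  595738 183))) 595751 257 (.node (.node (.node (.leaf 596513 196) 596514 193 .nil) 596525 292 (.leaf 596526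
  276)) 596527 209 (.node (.node (.leaf 596528 401) 596540 276 .nil) 596541 289 (.leaf 596542 289)))) 596556 337
  (.node (.node (.node (.node (.leaf 596557 433) 596571 513 .nil) 598567 209 (.leaf 598580 273)) 599088 529
  (.node (.node (.leaf 599102 513) 599117 529 .nil) 599855 289 (.leaf 599856 481))) 599869 337 (.node (.node
  (.node (.leaf 599870 369) 599885 513 .nil) 602164 657 (.leaf 603198 513)) 603213 657 (.node (.node (.leaf
  658446 65) 658448 88 .nil) 658449 181 (.leaf 658456 87))))))) 658459 197 (.node (.node (.node (.node (.node
  (.node (.node (.leaf 658468 215) 658471 248 .nil) 658481 247 (.node (.leaf 658486 312) 658496 311 .nil))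
  658702 100 (.node (.node (.leaf 658959 81) 658966 81 .nil) 658969 193 (.leaf 658978 151))) 658979 151 (.node
  (.node (.node (.leaf 658982 161) 658991 377 .nil) 658992 209 (.leaf 658995 321)) 659006 289 (.node (.node
  (.leaf 659007 353) 659009 513 .nil) 659020 601 (.leaf 659021 375)))) 659022 369 (.node (.node (.node (.node
  (.leaf 659035 449) 659036 449 .nil) 659037 519 (.leaf 659049 599)) 659050 465 (.node (.node (.leaf 659216 200)
  659217 135 .nil) 659224 113 (.leaf 659227 161))) 659228 183 (.node (.node (.node (.leaf 659236 215) 659240 193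
  .nil) 659249 309 (.leaf 659478 149)) 659491 213 (.node (.node (.leaf 659494 325) 659504 357 .nil) 659507 517
  (.leaf 659518 373))))) 659519 373 (.node (.node (.node (.node (.node (.leaf 659533 453) 659534 517 .nil)
  659547 597 (.leaf 659548 469)) 659737 177 (.node (.node (.leaf 661016 151) 661028 244 .nil) 661041 308 (.leaf
  661529 215))) 661539 209 (.node (.node (.node (.leaf 661542 241) 661552 356 .nil) 661555 513 (.leaf 661566
  372)) 661567 372 (.node (.node (.leaf 661581 452) 661582 516 .nil) 661595 596 (.leaf 661596 468)))) 661787 193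
  (.node (.node (.node (.node (.leaf 662310 257) 723982 65 .nil) 723984 88 (.leaf 723985 149)) 723992 87 (.node
  (.node (.leaf 723995 165) 724238 100 .nil) 724495 81 (.leaf 724496 180))) 724497 181 (.node (.node (.node
  (.leaf 724498 245) 724502 81 .nil) 724505 164 (.leaf 724508 197)) 724509 261 (.node (.node (.leaf 724514 151)
  724515 151 .nil) 724517 180 (.leaf 724518 161)))))) 724521 245 (.node (.node (.node (.node (.node (.node
  (.leaf 724527 313) 724528 183 .nil) 724531 295 (.leaf 724542 289)) 724543 327 (.node (.node (.leaf 724545 488)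
  724556 601 .nil) 724557 311 (.leaf 724558 343))) 724571 424 (.node (.node (.node (.leaf 724572 423) 724573 487
  .nil) 724585 599 (.leaf 724586 465)) 724752 168 (.node (.node (.leaf 724753 135) 724754 196 .nil) 724760 113
  (.leaf 724763 151)))) 724764 151 (.node (.node (.node (.node (.leaf 724776 167) 724777 228 .nil) 725009 164
  (.leaf 725010 167)) 725011 167 (.node (.node (.leaf 725014 149) 725017 181 .nil) 725019 180 (.leaf 725020
  180))) 725021 247 (.node (.node (.node (.leaf 725022 264) 725027 181 .nil) 725030 293 (.leaf 725033 199))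
  725034 263 (.node (.node (.leaf 725040 325) 725043 485 .nil) 725045 248 (.leaf 725047 247))))) 725054 309
  (.node (.node (.node (.node (.node (.leaf 725055 341) 725069 421 .nil) 725070 485 (.leaf 725083 597)) 725084
  469 (.node (.node (.leaf 725273 148) 725274 183 .nil) 725283 216 (.leaf 725285 164))) 725286 199 (.node (.node
  (.node (.leaf 725298 183) 725299 215 .nil) 725529 213 (.leaf 725530 247)) 725541 229 (.node (.node (.leaf
  726552 151) 727065 180 .nil) 727075 180 (.leaf 727078 241)))) 727088 324 (.node (.node (.node (.node (.leaf
  727091 484) 727102 308 .nil) 727103 340 (.leaf 727117 420)) 727118 484 (.node (.node (.leaf 727131 596) 727132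
  468 .nil) 727323 164 (.leaf 727324 199))) 727336 183 (.node (.node (.node (.leaf 727337 215) 727580 196 .nil)
  727581 260 (.leaf 727593 244)) 727845 180 (.node (.node (.leaf 727846 183) 728101 180 .nil) 728102 212 (.leaf
  728114 231))))))))) 730409 231 (.node (.node (.node (.node (.node (.node (.node (.node (.node (.leaf 789518
  49) 789774 52 .nil) 790031 33 (.node (.leaf 790032 33) 790033 87 .nil)) 790034 87 (.node (.node (.leaf 790035
  87) 790036 87 .nil) 790037 87 (.leaf 790038 65))) 790041 49 (.node (.node (.node (.leaf 790042 81) 790047 167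
  .nil) 790048 167 (.leaf 790051 81)) 790053 65 (.node (.node (.leaf 790054 65) 790055 97 .nil) 790059 248
  (.leaf 790060 247)))) 790061 215 (.node (.node (.node (.node (.leaf 790064 97) 790066 81 .nil) 790067 81
  (.leaf 790078 177)) 790079 97 (.node (.node (.leaf 790081 97) 790082 97 .nil) 790093 273 (.leaf 790094 177)))
  790096 161 (.node (.node (.node (.leaf 790097 289) 790098 401 .nil) 790107 289 (.leaf 790108 193)) 790109 193
  (.node (.node (.leaf 790111 209) 790122 273 .nil) 790123 321 (.leaf 790125 289))))) 790126 433 (.node (.node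
  (.node (.node (.node (.leaf 790135 433) 790289 119 .nil) 790299 113 (.leaf 790545 49)) 790546 87 (.node (.node
  (.leaf 790547 87) 790548 165 .nil) 790555 65 (.leaf 790556 65))) 790557 193 (.node (.node (.node (.leaf 790559
  245) 790560 213 .nil) 790569 209 (.leaf 790570 241)) 790804 226 (.node (.node (.leaf 790805 322) 790808 100
  .nil) 790809 145 (.leaf 790810 100)))) 790816 242 (.node (.node (.node (.node (.leaf 790817 434) 790820 116
  .nil) 790821 116 (.leaf 790822 161)) 790823 116 (.node (.node (.leaf 790829 322) 790833 164 .nil) 790834 145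
  (.leaf 790835 273))) 790836 164 (.node (.node (.node (.leaf 790842 466) 790844 466 .nil) 790848 228 (.leaf
  790849 209)) 790850 161 (.node (.node (.leaf 790851 180) 790853 532 .nil) 790863 276 (.leaf 790864 305))))))
  790865 497 (.node (.node (.node (.node (.node (.node (.leaf 790866 545) 790868 356 .nil) 790877 353 (.node
  (.leaf 790878 356) 790879 385 .nil)) 790882 532 (.node (.node (.leaf 790893 529) 790894 545 .nil) 790896 612
  (.leaf 790903 545))) 791064 100 (.node (.node (.node (.leaf 791066 193) 791076 148 .nil) 791079 148 (.leaf
  791089 196)) 791104 292 (.node (.node (.leaf 791320 100) 791323 216 .nil) 791332 148 (.leaf 791335 148))))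
  791345 196 (.node (.node (.node (.node (.leaf 791360 292) 791576 167 .nil) 791579 248 (.leaf 791588 244))
  791591 296 (.node (.node (.leaf 791601 295) 791832 293 .nil) 791835 402 (.leaf 792606 215))) 792607 244 (.node
  (.node (.node (.leaf 792608 212) 792619 296 .nil) 792620 295 (.leaf 792621 295)) 792859 129 (.node (.node
  (.leaf 792860 161) 793115 113 .nil) 793116 129 (.leaf 793117 433))))) 793129 225 (.node (.node (.node (.node
  (.node (.leaf 793130 449) 793143 305 .nil) 793144 465 (.leaf 793375 293)) 793376 258 (.node (.node (.leaf
  793381 129) 793382 177 .nil) 793383 129 (.leaf 793389 434))) 793394 177 (.node (.node (.node (.leaf 793395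
  257) 793409 193 .nil) 793410 177 (.leaf 793424 289)) 793425 513 (.node (.node (.leaf 793426 561) 793437 369
  .nil) 793439 369 (.leaf 793453 513)))) 793454 593 (.node (.node (.node (.node (.leaf 793463 593) 793637 145
  .nil) 793639 177 (.leaf 793650 209)) 793681 545 (.node (.node (.leaf 793695 529) 793709 545 .nil) 793895 513
  (.leaf 794151 561))) 794404 292 (.node (.node (.node (.leaf 794660 292) 794664 434 .nil) 796457 209 (.leaf
  796458 369)) 796469 257 (.node (.node (.leaf 796471 289) 796472 513 .nil) 796473 593 (.leaf 796486 369)))))))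
  796487 593 (.node (.node (.node (.node (.node (.node (.node (.leaf 855310 81) 855567 33 .nil) 855568 33 (.node
  (.leaf 855569 113) 855570 113 .nil)) 855571 113 (.node (.node (.leaf 855572 113) 855573 113 .nil) 855574 65
  (.leaf 855577 49))) 855578 81 (.node (.node (.node (.leaf 855580 213) 855581 309 .nil) 855583 193 (.leaf
  855584 193)) 855587 81 (.node (.node (.leaf 855589 65) 855590 65 .nil) 855591 97 (.leaf 855593 229)))) 855595
  273 (.node (.node (.node (.node (.leaf 855596 273) 855597 241 .nil) 855600 97 (.leaf 855602 81)) 855603 81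
  (.node (.node (.leaf 855614 177) 855615 97 .nil) 855617 97 (.leaf 855618 97))) 855629 273 (.node (.node (.node
  (.leaf 855630 177) 855632 161 .nil) 855633 289 (.leaf 855634 401)) 855643 289 (.node (.node (.leaf 855644 193)
  855645 193 .nil) 855647 209 (.leaf 855658 273))))) 855659 321 (.node (.node (.node (.node (.node (.leaf 855661
  289) 855662 433 .nil) 855671 433 (.leaf 855825 119)) 855826 308 (.node (.node (.leaf 855835 113) 855836 180
  .nil) 855849 340 (.leaf 856081 49))) 856082 87 (.node (.node (.node (.leaf 856083 87) 856091 65 .nil) 856092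
  65 (.leaf 856093 193)) 856094 312 (.node (.node (.leaf 856105 209) 856106 241 .nil) 856117 232 (.leaf 856119
  231)))) 856345 145 (.node (.node (.node (.node (.leaf 856346 113) 856356 145 .nil) 856357 129 (.leaf 856358
  161)) 856359 129 (.node (.node (.leaf 856370 145) 856371 273 .nil) 856372 193 (.leaf 856384 257))) 856385 209
  (.node (.node (.node (.leaf 856386 161) 856387 225 .nil) 856399 305 (.leaf 856400 305)) 856401 497 (.node
  (.node (.leaf 856402 545) 856413 353 .nil) 856414 385 (.leaf 856415 385)))))) 856429 529 (.node (.node (.node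
  (.node (.node (.node (.leaf 856430 545) 856439 545 .nil) 856602 193 (.leaf 856612 193)) 856613 277 (.node
  (.node (.leaf 856615 177) 856868 209 .nil) 858395 129 (.leaf 858396 161))) 858651 113 (.node (.node (.node
  (.leaf 858652 129) 858653 279 .nil) 858665 225 (.leaf 858666 449)) 858679 305 (.node (.node (.leaf 858680 465)
  858917 129 .nil) 858918 177 (.leaf 858919 129)))) 858930 177 (.node (.node (.node (.node (.leaf 858931 257)
  858945 193 .nil) 858946 177 (.leaf 858960 289)) 858961 513 (.node (.node (.leaf 858962 561) 858973 369 .nil)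
  858975 369 (.leaf 858989 513))) 858990 593 (.node (.node (.node (.leaf 858999 593) 859173 145 .nil) 859175 177
  (.leaf 859186 209)) 859217 545 (.node (.node (.leaf 859231 529) 859245 545 .nil) 859431 513 (.leaf 859687
  561))))) 861481 279 (.node (.node (.node (.node (.node (.leaf 861993 209) 861994 369 .nil) 862005 257 (.leaf
  862007 289)) 862008 513 (.node (.node (.leaf 862009 593) 862022 369 .nil) 862023 593 (.leaf 921363 200)))
  921364 161 (.node (.node (.node (.leaf 921365 161) 921375 241 .nil) 921376 209 (.leaf 921389 225)) 921877 290
  (.node (.node (.leaf 921901 418) 922133 258 .nil) 922135 306 (.leaf 922145 338)))) 922146 498 (.node (.node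
  (.node (.node (.leaf 922157 578) 922158 418 .nil) 922172 562 (.leaf 922390 149)) 922403 213 (.node (.node
  (.leaf 922406 325) 922416 357 .nil) 922419 517 (.leaf 922430 373))) 922431 373 (.node (.node (.node (.leaf
  922445 453) 922446 517 .nil) 922459 597 (.leaf 922460 469)) 922646 148 (.node (.node (.leaf 922658 215) 922659
  212 .nil) 922662 324 (.leaf 922672 356)))))))) 922675 516 (.node (.node (.node (.node (.node (.node (.node
  (.node (.leaf 922686 372) 922687 372 .nil) 922701 452 (.node (.leaf 922702 516) 922715 596 .nil)) 922716 468
  (.node (.node (.leaf 922902 148) 922905 177 .nil) 922908 274 (.leaf 922909 402))) 922915 180 (.node (.node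
  (.node (.leaf 922918 292) 922921 354 .nil) 922928 324 (.leaf 922931 484)) 922933 498 (.node (.node (.leaf
  922935 498) 922942 308 .nil) 922943 340 (.leaf 922957 420)))) 922958 484 (.node (.node (.node (.node (.leaf
  922971 596) 922972 468 .nil) 923167 215 (.leaf 923168 212)) 923179 264 (.node (.node (.leaf 923180 263) 923181
  231 .nil) 923420 226 (.leaf 923421 498))) 923936 228 (.node (.node (.node (.leaf 924705 290) 924717 434 .nil)
  924732 450 (.leaf 924961 354)) 924973 626 (.node (.node (.leaf 924974 562) 924988 610 .nil) 925474 263 (.leaf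
  925475 263))))) 925730 231 (.node (.node (.node (.node (.node (.leaf 925731 231) 925993 434 .nil) 928045 578
  (.leaf 928060 594)) 929077 658 (.node (.node (.leaf 929079 658) 987168 229 .nil) 987411 180 (.leaf 987412
  180))) 987413 148 (.node (.node (.node (.leaf 987415 132) 987423 228 .nil) 987424 164 (.leaf 987425 148))
  987426 164 (.node (.node (.leaf 987435 308) 987436 308 .nil) 987437 212 (.leaf 987438 228)))) 987439 212
  (.node (.node (.node (.node (.leaf 987450 244) 987452 244 .nil) 987453 244 (.leaf 987465 471)) 987467 324
  (.node (.node (.leaf 987468 372) 987669 337 .nil) 987671 497 (.leaf 987680 321))) 987681 353 (.node (.node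
  (.node (.leaf 987693 433) 987694 497 .nil) 987706 609 (.leaf 987708 481)) 987928 210 (.node (.node (.leaf
  987931 197) 987944 247 .nil) 988184 212 (.leaf 988187 196)))))) 988188 231 (.node (.node (.node (.node (.node
  (.node (.leaf 988196 290) 988200 279 .nil) 988440 408 (.leaf 988443 164)) 988444 225 (.node (.node (.leaf
  988456 407) 988457 369 .nil) 988956 337 (.leaf 988969 529))) 989215 290 (.node (.node (.node (.leaf 989216
  228) 989229 437 .nil) 989982 247 (.leaf 989983 279)) 989984 244 (.node (.node (.leaf 989985 407) 989995 328
  .nil) 989996 327 (.leaf 989997 263)))) 990010 440 (.node (.node (.node (.node (.leaf 990012 439) 990240 244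
  .nil) 990241 369 (.leaf 990253 324)) 990254 385 (.node (.node (.leaf 990266 465) 990268 465 .nil) 990283 481
  (.leaf 991016 327))) 991268 439 (.node (.node (.node (.leaf 991272 263) 991273 385 .nil) 991285 439 (.leaf
  991286 439)) 991529 385 (.node (.node (.leaf 993325 436) 993581 465 .nil) 993582 529 (.leaf 993594 609)))))
  993596 481 (.node (.node (.node (.node (.node (.leaf 1052949 177) 1052951 180 .nil) 1052960 225 (.leaf 1052961
  294)) 1052962 196 (.node (.node (.leaf 1052973 273) 1052975 372 .nil) 1052986 417 (.leaf 1052988 417)))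
  1053205 180 (.node (.node (.node (.leaf 1053206 504) 1053207 180 .nil) 1053216 264 (.leaf 1053217 196))
  1053218 196 (.node (.node (.leaf 1053229 292) 1053230 276 .nil) 1053231 372 (.leaf 1053242 584)))) 1053244 276
  (.node (.node (.node (.node (.leaf 1053245 423) 1053259 567 .nil) 1053461 180 (.leaf 1053463 180)) 1053473 196
  (.node (.node (.leaf 1053474 196) 1053485 292 .nil) 1053486 276 (.leaf 1053487 372))) 1053500 276 (.node
  (.node (.node (.leaf 1053718 210) 1053979 289 .nil) 1053980 196 (.leaf 1053981 260)) 1053982 408 (.node (.node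
  (.leaf 1053992 497) 1053993 244 .nil) 1053994 407 (.leaf 1054005 360))))))) 1054007 359 (.node (.node (.node
  (.node (.node (.node (.node (.leaf 1054020 503) 1054022 503 .nil) 1054239 258 (.node (.leaf 1054240 226)
  1054492 212 .nil)) 1054493 308 (.node (.node (.leaf 1054494 504) 1054505 228 .nil) 1054506 503 (.leaf 1055520
  433))) 1055533 417 (.node (.node (.node (.leaf 1055776 273) 1055777 232 .nil) 1055778 232 (.leaf 1055789 417))
  1055790 295 (.node (.node (.leaf 1055802 440) 1055804 439 .nil) 1055819 455 (.leaf 1056032 408)))) 1056033 340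
  (.node (.node (.node (.node (.leaf 1056034 500) 1056045 580 .nil) 1056046 359 (.leaf 1056058 632)) 1056060 564
  (.node (.node (.leaf 1056061 567) 1056075 615 .nil) 1056289 357 (.leaf 1056301 629))) 1056302 565 (.node
  (.node (.node (.leaf 1056316 613) 1056809 357 .nil) 1056821 501 (.leaf 1056823 501)) 1057065 295 (.node (.node
  (.leaf 1057066 359) 1057077 440 .nil) 1057079 439 (.leaf 1058861 657))))) 1059117 436 (.node (.node (.node
  (.node (.node (.leaf 1059118 439) 1059130 584 .nil) 1059132 452 (.leaf 1059147 599)) 1059373 628 (.node (.node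
  (.leaf 1059374 564) 1059388 612 .nil) 1060149 584 (.leaf 1060151 583))) 1060164 663 (.node (.node (.node
  (.leaf 1060166 663) 1062202 664 .nil) 1062204 597 (.leaf 1062714 664)) 1062716 596 (.node (.node (.leaf
  1119257 231) 1119513 196 .nil) 1119514 295 (.leaf 1119525 180)))) 1119526 212 (.node (.node (.node (.node
  (.leaf 1120025 177) 1120026 225 .nil) 1120037 193 (.leaf 1120544 216)) 1120545 215 (.node (.node (.leaf
  1120556 616) 1120557 324 .nil) 1120558 551 (.leaf 1120570 468))) 1120572 468 (.node (.node (.node (.leaf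
  1120585 615) 1120587 615 .nil) 1120802 209 (.leaf 1120813 420)) 1120815 289 (.node (.node (.leaf 1120829 305)
  1122341 391 .nil) 1122342 391 (.leaf 1122597 289)))))) 1122598 551 (.node (.node (.node (.node (.node (.node
  (.leaf 1122853 225) 1122855 257 .nil) 1123629 532 (.leaf 1123630 369)) 1123631 273 (.node (.node (.leaf
  1123642 612) 1123644 612 .nil) 1123645 321 (.leaf 1123885 532))) 1123898 612 (.node (.node (.node (.leaf
  1123900 612) 1124143 369 .nil) 1185050 263 (.leaf 1185562 276)) 1185573 290 (.node (.node (.leaf 1186337 340)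
  1186338 500 .nil) 1186349 580 (.leaf 1186350 420)))) 1186364 564 (.node (.node (.node (.node (.leaf 1250840
  212) 1251611 244 .nil) 1316376 215 (.leaf 1316388 292)) 1316889 295 (.node (.node (.leaf 1317147 276) 1382425
  421 .nil) 1382683 177 (.leaf 1382684 209))) 1382696 423 (.node (.node (.node (.leaf 1382940 276) 1382941 404
  .nil) 1382953 356 (.leaf 1382965 500)) 1382967 500 (.node (.node (.leaf 1383205 423) 1383206 423 .nil) 1383461
  225 (.leaf 1447967 260))))) 1447968 228 (.node (.node (.node (.node (.node (.leaf 1513756 293) 1514012 225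
  .nil) 1514013 500 (.leaf 1514533 273)) 1514546 295 (.node (.node (.leaf 1516841 295) 1579296 434 .nil) 1579309
  450 (.leaf 1645343 321))) 1645344 257 (.node (.node (.node (.leaf 1645345 423) 1645357 433 .nil) 1645370 456
  (.leaf 1645372 455)) 1645600 388 (.node (.node (.leaf 1645601 548) 1645613 532 .nil) 1645626 612 (.leaf
  1645628 612)))) 1646632 433 (.node (.node (.node (.node (.leaf 1648685 452) 1711137 289 .nil) 1711149 433
  (.leaf 1711164 449)) 1711393 353 (.node (.node (.leaf 1711405 625) 1711406 561 .nil) 1711420 609 (.leaf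
  1712425 433))) 1714477 577 (.node (.node (.node (.leaf 1714492 593) 1715509 657 .nil) 1715511 657 (.leaf
  1777701 439)) 1777702 439 (.node (.node (.leaf 1778989 452) 1779245 452 .nil) 1843493 293 (.leaf 1843749
  293)))))))))))

/-! ### The fullerene graph, its automorphisms, and the robber's moves from a representative. -/

section Concrete

/-- `K x`, arranged so that the kernel evaluates `x` first. -/
noncomputable def force (x : ℕ) (K : ℕ → Bool) : Bool := Nat.rec (K 0) (fun n _ => K (Nat.succ n)) x

theorem force_eq (x : ℕ) (K : ℕ → Bool) : force x K = K x := by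
  cases x <;> rfl

/-- Whether `p` holds for all numbers below `n`. -/
noncomputable def allBelow (n : ℕ) (p : ℕ → Bool) : Bool :=
  Nat.rec true (fun k ih => cond (p k) ih false) n

/-- The bridge from kernel evaluation to bounded quantifiers. All checks are composed of recursors,
`cond` and primitive operations on `Nat`, which the kernel carries out directly on literals. -/
theorem allBelow_iff {n : ℕ} {p : ℕ → Bool} : allBelow n p = true ↔ ∀ i < n, p i = true := by
  induction n with
  | zero => simp [allBelow]
  | succ n ih =>
    have : allBelow (n + 1) p = cond (p n) (allBelow n p) false := rfl
    rw [this, Bool.cond_eq_ite]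
    constructor
    · intro h i hi
      split_ifs at h with hp
      rcases Nat.lt_succ_iff_lt_or_eq.1 hi with hi | rfl
      exacts [ih.1 h i hi, hp]
    · intro h
      rw [if_pos (h n n.lt_succ_self)]
      exact ih.2 fun i hi => h i (hi.trans n.lt_succ_self)

theorem beq_iff {x y : ℕ} : Nat.beq x y = true ↔ x = y := by
  rw [Nat.beq_eq]

theorem blt_iff {x y : ℕ} : Nat.blt x y = true ↔ x < y := by
  simp [Nat.blt]

/-- The `i`-th byte of `t`. -/
noncomputable def tab (t i : ℕ) : ℕ := Nat.mod (Nat.shiftRight t (Nat.mul 8 i)) 256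

/-- The `j`-th neighbour of `v`. -/
noncomputable def nb (v j : ℕ) : ℕ := tab tabNbr (Nat.add (Nat.mul 3 v) j)

noncomputable def adjB (x y : ℕ) : Bool :=
  or (Nat.beq (nb x 0) y) (or (Nat.beq (nb x 1) y) (Nat.beq (nb x 2) y))

theorem adjB_iff {x y : ℕ} : adjB x y = true ↔ ∃ j < 3, nb x j = y := by
  simp only [adjB, Bool.or_eq_true, beq_iff]
  constructor
  · rintro (h | h | h)
    exacts [⟨0, by omega, h⟩, ⟨1, by omega, h⟩, ⟨2, by omega, h⟩]
  · rintro ⟨j, hj, h⟩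
    interval_cases j
    exacts [Or.inl h, Or.inr (Or.inl h), Or.inr (Or.inr h)]

/-- This is what makes `tabNbr` a simple graph: entries in range, no loops, symmetry. That the three
neighbours of a vertex are distinct is never needed. -/
theorem nb_check : (allBelow 140 fun x => allBelow 3 fun j =>
    and (Nat.blt (nb x j) 140) (and (not (Nat.beq (nb x j) x)) (adjB (nb x j) x))) = true := by
  decide +kernel

theorem nb_spec {x j : ℕ} (hx : x < 140) (hj : j < 3) :
    nb x j < 140 ∧ nb x j ≠ x ∧ adjB (nb x j) x = true := by
  have := allBelow_iff.1 (allBelow_iff.1 nb_check x hx) j hj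
  simpa only [Bool.and_eq_true, Bool.not_eq_true', ← Bool.not_eq_true, beq_iff, blt_iff] using this

/-- The chiral icosahedral fullerene graph with 140 vertices. -/
def fullerene : SimpleGraph (Fin 140) where
  Adj x y := adjB x y = true
  symm := ⟨fun x y h => by
    obtain ⟨j, hj, h⟩ := adjB_iff.1 h
    rw [← h]
    exact (nb_spec x.2 hj).2.2⟩
  loopless := ⟨fun x h => by
    obtain ⟨j, hj, h⟩ := adjB_iff.1 h
    exact (nb_spec x.2 hj).2.1 h⟩

theorem fullerene_adj {x y : Fin 140} : fullerene.Adj x y ↔ ∃ j < 3, nb x j = y := adjB_iff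

theorem exists_nb (x : Fin 140) {j : ℕ} (hj : j < 3) :
    ∃ y : Fin 140, (y : ℕ) = nb x j ∧ fullerene.Adj x y :=
  ⟨⟨nb x j, (nb_spec x.2 hj).1⟩, rfl, fullerene_adj.2 ⟨j, hj, rfl⟩⟩

/-- The numbering is chosen so that neighbour 0 of every nonzero vertex has a smaller number.
Following these neighbours leads down to the vertex 0, which gives connectedness. -/
theorem connected_check : (allBelow 139 fun x => Nat.blt (nb (Nat.succ x) 0) (Nat.succ x)) = true := by
  decide +kernel

theorem fullerene_connected : fullerene.Connected := by
  have h0 : ∀ n (x : Fin 140), (x : ℕ) = n → fullerene.Reachable x 0 := by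
    intro n
    induction n using Nat.strong_induction_on with
    | _ n ih =>
      intro x hx
      rcases Nat.eq_zero_or_pos n with rfl | hn
      · rw [show x = 0 from Fin.ext hx]
      · obtain ⟨y, hy, hxy⟩ := exists_nb x (j := 0) (by omega)
        have hlt := allBelow_iff.1 connected_check (n - 1) (by have := x.2; omega)
        rw [show (n - 1).succ = n by omega, ← hx, ← hy] at hlt
        rw [blt_iff] at hlt
        exact hxy.reachable.trans (ih y (by omega) y rfl)
  exact ⟨fun x y => (h0 x x rfl).trans (h0 y y rfl).symm⟩

/-- The table `t` lists the values of the automorphism `φ`. -/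
def Lists (t : ℕ) (φ : fullerene ≃g fullerene) : Prop := ∀ x : Fin 140, (φ x : ℕ) = tab t x

/-- The second table is a certificate of injectivity, which spares any search for preimages. -/
noncomputable def isAut (t t' : ℕ) : Bool :=
  allBelow 140 fun x => and (Nat.blt (tab t x) 140) (and (Nat.beq (tab t' (tab t x)) x)
    (allBelow 3 fun j => adjB (tab t x) (tab t (nb x j))))

theorem isAut_spec {t t' : ℕ} (h : isAut t t' = true) {x : ℕ} (hx : x < 140) :
    tab t x < 140 ∧ tab t' (tab t x) = x ∧ ∀ j < 3, adjB (tab t x) (tab t (nb x j)) = true := by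
  have := allBelow_iff.1 h x hx
  simpa only [Bool.and_eq_true, beq_iff, blt_iff, allBelow_iff] using this

/-- The two checks exhibit the tables as inverse to each other. Preservation of edges by the inverse
is the reflection of edges that an isomorphism needs. -/
theorem exists_lists {t t' : ℕ} (h : isAut t t' = true) (h' : isAut t' t = true) :
    ∃ φ, Lists t φ := by
  have key : ∀ {t t' : ℕ} (h : isAut t t' = true) {x y : Fin 140}, fullerene.Adj x y →
      adjB (tab t x) (tab t y) = true := fun h x y hxy => by
    obtain ⟨j, hj, e⟩ := fullerene_adj.1 hxy
    rw [← e]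
    exact (isAut_spec h x.2).2.2 j hj
  refine ⟨⟨⟨fun x => ⟨tab t x, (isAut_spec h x.2).1⟩, fun x => ⟨tab t' x, (isAut_spec h' x.2).1⟩,
    fun x => Fin.ext (isAut_spec h x.2).2.1, fun x => Fin.ext (isAut_spec h' x.2).2.1⟩, ?_⟩,
    fun x => rfl⟩
  intro x y
  refine ⟨fun hxy => ?_, key h⟩
  have := key h' hxy
  simp only [Equiv.coe_fn_mk, (isAut_spec h x.2).2.1, (isAut_spec h y.2).2.1] at this
  exact this

theorem tabId_check : (allBelow 140 fun x => Nat.beq (tab tabId x) x) = true := by decide +kernel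

theorem tabId_apply (x : Fin 140) : tab tabId x = x :=
  beq_iff.1 (allBelow_iff.1 tabId_check x x.2)

theorem exists_lists_id : ∃ φ, Lists tabId φ := exists_lists (t' := tabId) (by decide +kernel) (by decide +kernel)

theorem exists_lists_rho : ∃ φ, Lists tabRho φ :=
  exists_lists (t' := tabRhoInv) (by decide +kernel) (by decide +kernel)

theorem exists_lists_rhoInv : ∃ φ, Lists tabRhoInv φ :=
  exists_lists (t' := tabRho) (by decide +kernel) (by decide +kernel)

theorem exists_lists_sigma : ∃ φ, Lists tabSigma φ :=
  exists_lists (t' := tabSigmaInv) (by decide +kernel) (by decide +kernel)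

theorem exists_lists_sigmaInv : ∃ φ, Lists tabSigmaInv φ :=
  exists_lists (t' := tabSigma) (by decide +kernel) (by decide +kernel)

theorem exists_lists_tau : ∃ φ, Lists tabTau φ :=
  exists_lists (t' := tabTau) (by decide +kernel) (by decide +kernel)

/-- Whether `P u t s` holds for all options `u` of the robber at `r`, where the automorphism listed
in `t` takes `u` to the representative `s` of its orbit. -/
noncomputable def moves (r : ℕ) (P : ℕ → ℕ → ℕ → Bool) : Bool :=
  cond (Nat.beq r 0) (and (P 0 tabId 0) (and (P 1 tabId 1) (and (P 3 tabRho 1) (P 4 tabRhoInv 1))))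
    (cond (Nat.beq r 1)
      (and (P 1 tabId 1) (and (P 0 tabId 0) (and (P 2 tabId 2) (P 5 tabTau 1))))
      (and (P 2 tabId 2) (and (P 1 tabId 1) (and (P 6 tabSigma 2) (P 7 tabSigmaInv 2)))))

/-- Together with `tab_reps` this shows why three representatives suffice: after one step from a
representative, a single generator (or the identity) brings the robber back to one. -/
theorem nb_reps : nb 0 0 = 1 ∧ nb 0 1 = 3 ∧ nb 0 2 = 4 ∧ nb 1 0 = 0 ∧ nb 1 1 = 2 ∧ nb 1 2 = 5 ∧
    nb 2 0 = 1 ∧ nb 2 1 = 6 ∧ nb 2 2 = 7 := by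
  decide +kernel

theorem tab_reps : tab tabId 0 = 0 ∧ tab tabId 1 = 1 ∧ tab tabId 2 = 2 ∧ tab tabRho 3 = 1 ∧
    tab tabRhoInv 4 = 1 ∧ tab tabTau 5 = 1 ∧ tab tabSigma 6 = 2 ∧ tab tabSigmaInv 7 = 2 := by
  decide +kernel

/-- `u` is an option of the robber at `r`, and the automorphism listed in `t` takes it to `s`. -/
structure IsOption (r u : Fin 140) (t : ℕ) (s : Fin 140) : Prop where
  step : Step fullerene r u
  lt : (s : ℕ) < 3
  exists_lists : ∃ φ : fullerene ≃g fullerene, Lists t φ ∧ φ u = s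

theorem isOption_all :
    (IsOption 0 0 tabId 0 ∧ IsOption 0 1 tabId 1 ∧ IsOption 0 3 tabRho 1 ∧ IsOption 0 4 tabRhoInv 1) ∧
    (IsOption 1 1 tabId 1 ∧ IsOption 1 0 tabId 0 ∧ IsOption 1 2 tabId 2 ∧ IsOption 1 5 tabTau 1) ∧
    (IsOption 2 2 tabId 2 ∧ IsOption 2 1 tabId 1 ∧ IsOption 2 6 tabSigma 2 ∧
      IsOption 2 7 tabSigmaInv 2) := by
  have key : ∀ {r u : Fin 140} {t : ℕ} {s : Fin 140}, (r = u ∨ ∃ j < 3, nb r j = u) →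
      (s : ℕ) < 3 → (∃ φ, Lists t φ) → tab t u = s → IsOption r u t s :=
    fun h hs ⟨φ, hφ⟩ hu => ⟨h.imp_right fullerene_adj.2, hs, φ, hφ, Fin.ext ((hφ _).trans hu)⟩
  obtain ⟨n00, n01, n02, n10, n11, n12, n20, n21, n22⟩ := nb_reps
  obtain ⟨t0, t1, t2, t3, t4, t5, t6, t7⟩ := tab_reps
  have i := exists_lists_id
  exact ⟨⟨key (Or.inl rfl) (by decide) i t0, key (Or.inr ⟨0, by omega, n00⟩) (by decide) i t1,
      key (Or.inr ⟨1, by omega, n01⟩) (by decide) exists_lists_rho t3,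
      key (Or.inr ⟨2, by omega, n02⟩) (by decide) exists_lists_rhoInv t4⟩,
    ⟨key (Or.inl rfl) (by decide) i t1, key (Or.inr ⟨0, by omega, n10⟩) (by decide) i t0,
      key (Or.inr ⟨1, by omega, n11⟩) (by decide) i t2,
      key (Or.inr ⟨2, by omega, n12⟩) (by decide) exists_lists_tau t5⟩,
    ⟨key (Or.inl rfl) (by decide) i t2, key (Or.inr ⟨0, by omega, n20⟩) (by decide) i t1,
      key (Or.inr ⟨1, by omega, n21⟩) (by decide) exists_lists_sigma t6,
      key (Or.inr ⟨2, by omega, n22⟩) (by decide) exists_lists_sigmaInv t7⟩⟩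

theorem eq_of_lt_three {r : Fin 140} (hr : (r : ℕ) < 3) : r = 0 ∨ r = 1 ∨ r = 2 := by
  obtain ⟨r, h⟩ := r
  simp only [Fin.ext_iff] at hr ⊢
  simp
  omega

/-- A statement about all steps of the robber is reduced to four evaluations, each paired with an
automorphism that brings the robber back to a representative. -/
theorem moves_spec {r : Fin 140} (hr : (r : ℕ) < 3) {P : ℕ → ℕ → ℕ → Bool}
    (h : moves r P = true) {u : Fin 140} (hu : Step fullerene r u) :
    ∃ t s, IsOption r u t s ∧ P u t s = true := by
  obtain ⟨⟨a0, a1, a2, a3⟩, ⟨b0, b1, b2, b3⟩, ⟨c0, c1, c2, c3⟩⟩ := isOption_all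
  have hu' : u = r ∨ ∃ j < 3, nb r j = u := hu.imp Eq.symm fullerene_adj.1
  obtain ⟨n00, n01, n02, n10, n11, n12, n20, n21, n22⟩ := nb_reps
  rcases eq_of_lt_three hr with rfl | rfl | rfl
  · have h' : (and (P 0 tabId 0) (and (P 1 tabId 1) (and (P 3 tabRho 1) (P 4 tabRhoInv 1)))) = true := h
    simp only [Bool.and_eq_true] at h'
    obtain ⟨p0, p1, p2, p3⟩ := h'
    rcases hu' with rfl | ⟨j, hj, e⟩
    · exact ⟨_, _, a0, p0⟩
    · interval_cases j
      · obtain rfl : 1 = u := Fin.ext (n00.symm.trans e)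
        exact ⟨_, _, a1, p1⟩
      · obtain rfl : 3 = u := Fin.ext (n01.symm.trans e)
        exact ⟨_, _, a2, p2⟩
      · obtain rfl : 4 = u := Fin.ext (n02.symm.trans e)
        exact ⟨_, _, a3, p3⟩
  · have h' : (and (P 1 tabId 1) (and (P 0 tabId 0) (and (P 2 tabId 2) (P 5 tabTau 1)))) = true := h
    simp only [Bool.and_eq_true] at h'
    obtain ⟨p0, p1, p2, p3⟩ := h'
    rcases hu' with rfl | ⟨j, hj, e⟩
    · exact ⟨_, _, b0, p0⟩
    · interval_cases j
      · obtain rfl : 0 = u := Fin.ext (n10.symm.trans e)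
        exact ⟨_, _, b1, p1⟩
      · obtain rfl : 2 = u := Fin.ext (n11.symm.trans e)
        exact ⟨_, _, b2, p2⟩
      · obtain rfl : 5 = u := Fin.ext (n12.symm.trans e)
        exact ⟨_, _, b3, p3⟩
  · have h' : (and (P 2 tabId 2) (and (P 1 tabId 1) (and (P 6 tabSigma 2) (P 7 tabSigmaInv 2)))) = true := h
    simp only [Bool.and_eq_true] at h'
    obtain ⟨p0, p1, p2, p3⟩ := h'
    rcases hu' with rfl | ⟨j, hj, e⟩
    · exact ⟨_, _, c0, p0⟩
    · interval_cases j
      · obtain rfl : 1 = u := Fin.ext (n20.symm.trans e)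
        exact ⟨_, _, c1, p1⟩
      · obtain rfl : 6 = u := Fin.ext (n21.symm.trans e)
        exact ⟨_, _, c2, p2⟩
      · obtain rfl : 7 = u := Fin.ext (n22.symm.trans e)
        exact ⟨_, _, c3, p3⟩

/-- The four instances conjoined in `moves` all belong to real moves, so a failing conjunction
produces a move that the robber can make. The upper bound uses `moves_spec`, the lower bound uses
this converse. -/
theorem exists_option_of_moves_eq_false {r : Fin 140} (hr : (r : ℕ) < 3) {P : ℕ → ℕ → ℕ → Bool}
    (h : moves r P = false) : ∃ u t s, IsOption r u t s ∧ P u t s = false := by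
  by_contra hc
  push Not at hc
  simp only [ne_eq, Bool.not_eq_false] at hc
  obtain ⟨⟨a0, a1, a2, a3⟩, ⟨b0, b1, b2, b3⟩, ⟨c0, c1, c2, c3⟩⟩ := isOption_all
  refine Bool.false_ne_true (h.symm.trans ?_)
  rcases eq_of_lt_three hr with rfl | rfl | rfl
  · have : (and (P 0 tabId 0) (and (P 1 tabId 1) (and (P 3 tabRho 1) (P 4 tabRhoInv 1)))) = true := by
      simp only [Bool.and_eq_true]
      exact ⟨hc _ _ _ a0, hc _ _ _ a1, hc _ _ _ a2, hc _ _ _ a3⟩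
    exact this
  · have : (and (P 1 tabId 1) (and (P 0 tabId 0) (and (P 2 tabId 2) (P 5 tabTau 1)))) = true := by
      simp only [Bool.and_eq_true]
      exact ⟨hc _ _ _ b0, hc _ _ _ b1, hc _ _ _ b2, hc _ _ _ b3⟩
    exact this
  · have : (and (P 2 tabId 2) (and (P 1 tabId 1) (and (P 6 tabSigma 2) (P 7 tabSigmaInv 2)))) = true := by
      simp only [Bool.and_eq_true]
      exact ⟨hc _ _ _ c0, hc _ _ _ c1, hc _ _ _ c2, hc _ _ _ c3⟩
    exact this

end Concrete

/-! ### Soundness of the list of positions won by three cops. -/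

section Traps

/-- The value stored at the key `x`, or `0` if there is none. -/
noncomputable def BT.find (t : BT) (x : ℕ) : ℕ :=
  BT.rec 0 (fun k v => cond (Nat.beq x k) v 0)
    (fun _ k v _ fl fr => cond (Nat.ble k x) (cond (Nat.beq x k) v fr) fl) t

/-- Whether `P k v` holds whenever the value `v` is stored at the key `k`. -/
noncomputable def BT.all (t : BT) (P : ℕ → ℕ → Bool) : Bool :=
  BT.rec true (fun k v => P k v) (fun _ k v _ l r => and (P k v) (and l r)) t

/-- No order on the keys is assumed. A positive result comes from an entry whose key equals `x`, and
`all` has tested every entry; the value 0 is reserved for absence. A badly ordered tree could only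
hide entries. -/
theorem BT.all_find {P : ℕ → ℕ → Bool} {x : ℕ} : ∀ {t : BT}, t.all P = true → 0 < t.find x →
    P x (t.find x) = true
  | .nil, _, h => absurd h (lt_irrefl 0)
  | .leaf k v, h, h' => by
    change P k v = true at h
    change 0 < cond (Nat.beq x k) v 0 at h'
    change P x (cond (Nat.beq x k) v 0) = true
    rw [Bool.cond_eq_ite] at h' ⊢
    split_ifs at h' ⊢ with hx
    · rwa [beq_iff.1 hx]
    · exact absurd h' (lt_irrefl 0)
  | .node l k v r, h, h' => by
    change and (P k v) (and (l.all P) (r.all P)) = true at h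
    change 0 < cond (Nat.ble k x) (cond (Nat.beq x k) v (r.find x)) (l.find x) at h'
    change P x (cond (Nat.ble k x) (cond (Nat.beq x k) v (r.find x)) (l.find x)) = true
    simp only [Bool.and_eq_true] at h
    simp only [Bool.cond_eq_ite] at h' ⊢
    split_ifs at h' ⊢ with h₁ h₂
    · rw [beq_iff.1 h₂]
      exact h.1
    · exact BT.all_find h.2.2 h'
    · exact BT.all_find h.2.1 h'

/-- Passing the sorted pair to a continuation avoids building and destructing products during
evaluation. -/
noncomputable def sort2 {α : Type} (a b : ℕ) (K : ℕ → ℕ → α) : α :=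
  cond (Nat.ble a b) (K a b) (K b a)

theorem sort2_spec {α : Type} {n : ℕ} (a b : Fin n) (K : ℕ → ℕ → α) :
    ∃ a' b' : Fin n, a' ≤ b' ∧ [a', b'].Perm [a, b] ∧ sort2 a b K = K a' b' := by
  unfold sort2
  rw [Bool.cond_eq_ite]
  split_ifs with h
  · exact ⟨a, b, by simpa using h, List.Perm.refl _, rfl⟩
  · exact ⟨b, a, le_of_not_ge fun h' => h (by simpa using h'), List.Perm.swap _ _ _, rfl⟩

/-- Base 256 separates the three components because vertices are below 140. -/
noncomputable def key (a b c : ℕ) : ℕ := Nat.add (Nat.mul (Nat.add (Nat.mul a 256) b) 256) c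

/-- The key of the triple after sorting. -/
noncomputable def key3 (a b c : ℕ) : ℕ :=
  sort2 a b fun a b => sort2 b c fun b c => sort2 a b fun a b => key a b c

theorem key3_spec {n : ℕ} (a b c : Fin n) : ∃ a' b' c' : Fin n, a' ≤ b' ∧ b' ≤ c' ∧
    [a', b', c'].Perm [a, b, c] ∧ key3 a b c = key a' b' c' := by
  unfold key3
  obtain ⟨a₁, b₁, l₁, p₁, e₁⟩ := sort2_spec a b fun a b => sort2 b c fun b c =>
    sort2 a b fun a b => key a b c
  obtain ⟨b₂, c₂, l₂, p₂, e₂⟩ := sort2_spec b₁ c fun b c => sort2 a₁ b fun a b => key a b c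
  obtain ⟨a₃, b₃, l₃, p₃, e₃⟩ := sort2_spec a₁ b₂ fun a b => key a b c₂
  -- The second comparison leaves `c₂` above both of its inputs, in particular above `b₁`. Hence the
  -- third comparison cannot produce anything larger than `c₂`.
  have hb : b₁ ≤ c₂ := (List.forall_mem_cons.1 (show ∀ x ∈ [b₁, c], x ≤ c₂ from fun x hx => by
    have := p₂.symm.subset hx
    simp only [List.mem_cons, List.not_mem_nil, or_false] at this
    rcases this with rfl | rfl
    exacts [l₂, le_rfl])).1
  refine ⟨a₃, b₃, c₂, l₃, ?_, ?_, e₁.trans (e₂.trans e₃)⟩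
  · have := p₃.subset (a := b₃) (by simp)
    simp only [List.mem_cons, List.not_mem_nil, or_false] at this
    rcases this with h | h <;> rw [h]
    exacts [l₁.trans hb, l₂]
  -- The three exchanges are composed by counting occurrences, which turns the claim into linear
  -- arithmetic.
  · rw [List.perm_iff_count] at *
    intro x
    have h₁ := p₁ x
    have h₂ := p₂ x
    have h₃ := p₃ x
    simp only [List.count_cons, List.count_nil] at *
    omega

/-- A sorted list is determined by its multiset, so the lookup depends only on the unordered triple.
The lower bound needs this: the robber's notion of safety must not depend on the numbering of the
cops. -/
theorem key3_perm {n : ℕ} {a b c a' b' c' : Fin n} (h : [a, b, c].Perm [a', b', c']) :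
    key3 a b c = key3 a' b' c' := by
  obtain ⟨x, y, z, l₁, l₂, p, e⟩ := key3_spec a b c
  obtain ⟨x', y', z', l₁', l₂', p', e'⟩ := key3_spec a' b' c'
  have hs : ∀ {x y z : Fin n}, x ≤ y → y ≤ z → [x, y, z].Pairwise (· ≤ ·) := fun h h' => by
    simp [h, h', h.trans h']
  have := List.Perm.eq_of_pairwise (le := (· ≤ ·)) (fun _ _ _ _ => le_antisymm) (hs l₁ l₂)
    (hs l₁' l₂') (p.trans (h.trans p'.symm))
  simp only [List.cons.injEq, and_true] at this
  obtain ⟨rfl, rfl, rfl⟩ := this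
  rw [e, e']

/-- Splits a key into its three parts. -/
noncomputable def unkey (k : ℕ) (K : ℕ → ℕ → ℕ → Bool) : Bool :=
  force (Nat.div k 65536) fun a => force (Nat.mod (Nat.div k 256) 256) fun b =>
    force (Nat.mod k 256) fun c => K a b c

theorem unkey_key (a b c : Fin 140) (K : ℕ → ℕ → ℕ → Bool) : unkey (key a b c) K = K a b c := by
  have ha := a.2
  have hb := b.2
  have hc := c.2
  have h₁ : Nat.div (key a b c) 65536 = a := by
    change ((a * 256 + b) * 256 + c : ℕ) / 65536 = a
    omega
  have h₂ : Nat.mod (Nat.div (key a b c) 256) 256 = b := by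
    change ((a * 256 + b) * 256 + c : ℕ) / 256 % 256 = b
    omega
  have h₃ : Nat.mod (key a b c) 256 = c := by
    change ((a * 256 + b) * 256 + c : ℕ) % 256 = c
    omega
  simp only [unkey, force_eq, h₁, h₂, h₃]

noncomputable def bit (m a : ℕ) : Bool := Nat.beq (Nat.mod (Nat.shiftRight m a) 2) 1

/-- The vertices within distance one of a representative. -/
noncomputable def nearMask (r : ℕ) : ℕ := cond (Nat.beq r 0) 27 (cond (Nat.beq r 1) 39 198)

noncomputable def near (r a : ℕ) : Bool := bit (nearMask r) a

/-- The masks 27, 39 and 198 have their bits at 0, 1, 3, 4, at 0, 1, 2, 5 and at 1, 2, 6, 7, the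
closed neighbourhoods of the representatives 0, 1 and 2. -/
theorem near_check : (allBelow 3 fun r => and (near r r) (and (allBelow 3 fun j => near r (nb r j))
    (allBelow 140 fun a => or (not (near r a)) (or (Nat.beq r a) (adjB r a))))) = true := by
  decide +kernel

theorem near_iff {r a : Fin 140} (hr : (r : ℕ) < 3) : near r a = true ↔ Step fullerene r a := by
  have h := allBelow_iff.1 near_check r hr
  simp only [Bool.and_eq_true, allBelow_iff] at h
  constructor
  · intro ha
    have := h.2.2 a a.2
    rw [ha] at this
    simp only [Bool.not_true, Bool.false_or, Bool.or_eq_true, beq_iff] at this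
    exact this.imp (fun h => Fin.ext h) id
  · rintro (rfl | ha)
    · exact h.1
    · obtain ⟨j, hj, e⟩ := fullerene_adj.1 ha
      rw [← e]
      exact h.2.1 j hj

noncomputable def traps (r : ℕ) : BT := cond (Nat.beq r 0) traps0 (cond (Nat.beq r 1) traps1 traps2)

noncomputable def trapValue (r a b c : ℕ) (K : ℕ → Bool) : Bool :=
  force (key3 a b c) fun x => force ((traps r).find x) K

/-- Whether three cops are known to win, with the robber at a representative. -/
noncomputable def bad (r a b c : ℕ) : Bool :=
  or (near r a) (or (near r b) (or (near r c) (trapValue r a b c fun v => Nat.blt 0 v)))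

theorem bad_iff {r a b c : ℕ} : bad r a b c = true ↔ near r a = true ∨ near r b = true ∨
    near r c = true ∨ 0 < (traps r).find (key3 a b c) := by
  simp only [bad, trapValue, force_eq, Bool.or_eq_true, blt_iff]

theorem bad_perm {r : ℕ} {a b c a' b' c' : Fin 140} (h : [a, b, c].Perm [a', b', c']) :
    bad r a b c = bad r a' b' c' := by
  rw [Bool.eq_iff_iff, bad_iff, bad_iff, key3_perm h]
  have : (∃ x ∈ [a, b, c], near r x = true) ↔ ∃ x ∈ [a', b', c'], near r x = true := by
    simp only [h.mem_iff]
  simp only [List.exists_mem_cons_iff, List.not_mem_nil, false_and, exists_false, or_false] at this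
  simp only [← or_assoc] at this ⊢
  rw [this]

/-- Whether the robber is caught at `r`, or all its options are covered by `Q`. -/
noncomputable def replies (r : ℕ) (occ : ℕ → Bool) (Q : ℕ → ℕ → Bool) : Bool :=
  or (occ r) (moves r fun u t s => or (occ u) (Q t s))

/-- After the robber's reply the position is transported by the automorphism that belongs to this
reply, and `Q` is consulted only for the transported position. `Caught.of_map` transports the
conclusion back. -/
theorem replies_spec {r : Fin 140} (hr : (r : ℕ) < 3) {occ : ℕ → Bool} {Q : ℕ → ℕ → Bool}
    {l : List (Fin 140)} (hocc : ∀ u : Fin 140, occ u = true → u ∈ l)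
    (hQ : ∀ t (φ : fullerene ≃g fullerene) (s : Fin 140), Lists t φ → (s : ℕ) < 3 →
      Q t s = true → Caught fullerene (l.map φ) s) (h : replies r occ Q = true) :
    r ∈ l ∨ ∀ r', Step fullerene r r' → r' ∈ l ∨ Caught fullerene l r' := by
  rw [replies, Bool.or_eq_true] at h
  refine h.imp (hocc r) fun h r' hr' => ?_
  obtain ⟨t, s, ⟨-, hs, φ, hφ, hu⟩, hP⟩ := moves_spec hr h hr'
  rw [Bool.or_eq_true] at hP
  refine hP.imp (hocc r') fun h => Caught.of_map φ ?_
  rw [hu]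
  exact hQ t φ s hφ hs h

/-- `l'` arises from `l` by a turn of the cops. -/
def Turn (l l' : List (Fin 140)) : Prop :=
  ∃ x y m, Step fullerene x y ∧ (x :: m).Perm l ∧ (y :: m).Perm l'

theorem Turn.caught {l l' : List (Fin 140)} (h : Turn l l') {r : Fin 140}
    (h' : r ∈ l' ∨ ∀ r', Step fullerene r r' → r' ∈ l' ∨ Caught fullerene l' r') :
    Caught fullerene l r := by
  obtain ⟨x, y, m, hxy, p, p'⟩ := h
  refine Caught.perm p (Caught.of_turn hxy ?_)
  exact h'.imp p'.mem_iff.2 fun h' r' hr' => (h' r' hr').imp p'.mem_iff.2 (Caught.perm p'.symm)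

noncomputable def occ3 (a b c u : ℕ) : Bool := or (Nat.beq u a) (or (Nat.beq u b) (Nat.beq u c))

/-- Carries out the turn of the cops with code `m`. -/
noncomputable def moved3 (m a b c : ℕ) (K : ℕ → ℕ → ℕ → Bool) : Bool :=
  cond (Nat.beq m 0) (K a b c) (cond (Nat.ble m 3) (force (nb a (Nat.sub m 1)) fun a => K a b c)
    (cond (Nat.ble m 6) (force (nb b (Nat.sub m 4)) fun b => K a b c)
      (cond (Nat.ble m 9) (force (nb c (Nat.sub m 7)) fun c => K a b c) false)))

/-- Code 0 passes; the codes 1 to 3, 4 to 6 and 7 to 9 send the first, second and third cop to its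
neighbours 0, 1, 2. Any other code evaluates to `false`, so a successful check always comes from a
legal turn. -/
theorem moved3_spec {m : ℕ} {a b c : Fin 140} {K : ℕ → ℕ → ℕ → Bool}
    (h : moved3 m a b c K = true) :
    ∃ a' b' c' : Fin 140, Turn [a, b, c] [a', b', c'] ∧ K a' b' c' = true := by
  simp only [moved3, Bool.cond_eq_ite, force_eq, beq_iff, Nat.ble_eq] at h
  split_ifs at h with h0 h1 h2 h3
  · exact ⟨a, b, c, ⟨a, a, [b, c], Step.refl _, .refl _, .refl _⟩, h⟩
  · obtain ⟨y, hy, hs⟩ := exists_nb a (j := m - 1) (by omega)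
    refine ⟨y, b, c, ⟨a, y, [b, c], Or.inr hs, .refl _, .refl _⟩, ?_⟩
    rw [hy]
    exact h
  · obtain ⟨y, hy, hs⟩ := exists_nb b (j := m - 4) (by omega)
    refine ⟨a, y, c, ⟨b, y, [a, c], Or.inr hs, .swap _ _ _, .swap _ _ _⟩, ?_⟩
    rw [hy]
    exact h
  · obtain ⟨y, hy, hs⟩ := exists_nb c (j := m - 7) (by omega)
    refine ⟨a, b, y, ⟨c, y, [a, b], Or.inr hs, List.perm_append_comm (l₁ := [c]) (l₂ := [a, b]),
      List.perm_append_comm (l₁ := [y]) (l₂ := [a, b])⟩, ?_⟩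
    rw [hy]
    exact h

/-- Whether the turn recorded in `v` leads from the state with key `k` to states with smaller
values. -/
noncomputable def winningEntry (r k v : ℕ) : Bool :=
  unkey k fun a b c => moved3 (Nat.mod v 16) a b c fun a b c => replies r (occ3 a b c) fun t s =>
    force (tab t a) fun a => force (tab t b) fun b => force (tab t c) fun c =>
      or (near s a) (or (near s b) (or (near s c)
        (trapValue s a b c fun w => and (Nat.blt 0 w) (Nat.blt w v))))

/-- Soundness is a local condition on each entry: the recorded turn must lead to capture, to a cop
within distance one, or to smaller values. No game search is repeated. -/
theorem winningEntry_check0 : traps0.all (winningEntry 0) = true := by decide +kernel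

theorem winningEntry_check1 : traps1.all (winningEntry 1) = true := by decide +kernel

theorem winningEntry_check2 : traps2.all (winningEntry 2) = true := by decide +kernel

theorem traps_all {P : ℕ → ℕ → ℕ → Bool} (h0 : traps0.all (P 0) = true)
    (h1 : traps1.all (P 1) = true) (h2 : traps2.all (P 2) = true) {r : Fin 140} (hr : (r : ℕ) < 3) :
    (traps r).all (P r) = true := by
  rcases eq_of_lt_three hr with rfl | rfl | rfl
  exacts [h0, h1, h2]

/-- The cop within distance one captures on its own next turn. -/
theorem caught_of_near {r a : Fin 140} (hr : (r : ℕ) < 3) (h : near r a = true)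
    {l : List (Fin 140)} (ha : a ∈ l) : Caught fullerene l r :=
  Caught.of_step ha (((near_iff hr).1 h).imp Eq.symm SimpleGraph.Adj.symm)

/-- Induction on the stored number. The numbers `16 * n + m` are compared whole, move code included.
Only the strict decrease matters, not that `n` is the optimal length of the game. -/
theorem caught_of_find (v : ℕ) : ∀ r a b c : Fin 140, (r : ℕ) < 3 → 0 < v →
    (traps r).find (key3 a b c) = v → Caught fullerene [a, b, c] r := by
  induction v using Nat.strong_induction_on with
  | _ v ih =>
    intro r a b c hr hv hfind
    have hall := BT.all_find (traps_all (P := winningEntry) winningEntry_check0 winningEntry_check1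
      winningEntry_check2 hr) (hfind ▸ hv)
    rw [hfind] at hall
    obtain ⟨a', b', c', -, -, hp, hk⟩ := key3_spec a b c
    rw [hk, winningEntry, unkey_key] at hall
    obtain ⟨x, y, z, ht, h⟩ := moved3_spec hall
    refine Caught.perm hp (ht.caught (replies_spec hr ?_ ?_ h))
    · intro u hu
      simpa only [occ3, Bool.or_eq_true, beq_iff, ← Fin.ext_iff, List.mem_cons, List.not_mem_nil,
        or_false] using hu
    · intro t φ s hφ hs hQ
      simp only [trapValue, force_eq, Bool.or_eq_true, Bool.and_eq_true, blt_iff, ← hφ x, ← hφ y,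
        ← hφ z] at hQ
      rcases hQ with h | h | h | ⟨h, h'⟩
      · exact caught_of_near hs h (by simp)
      · exact caught_of_near hs h (by simp)
      · exact caught_of_near hs h (by simp)
      · exact ih _ h' s (φ x) (φ y) (φ z) hs h rfl

theorem caught_of_bad {r a b c : Fin 140} (hr : (r : ℕ) < 3) (h : bad r a b c = true) :
    Caught fullerene [a, b, c] r := by
  rcases bad_iff.1 h with h | h | h | h
  · exact caught_of_near hr h (by simp)
  · exact caught_of_near hr h (by simp)
  · exact caught_of_near hr h (by simp)
  · exact caught_of_find _ r a b c hr h rfl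

end Traps

/-! ### Completeness of the list: predecessors of lost positions. -/

section Evasion

/-- All tables that occur in `moves` list automorphisms, so agreement is needed only for those. This
allows `tab t` to be read as a map of `Fin 140` when cops are permuted. -/
theorem moves_congr {r : ℕ} {P Q : ℕ → ℕ → ℕ → Bool}
    (h : ∀ u t s, (∃ φ, Lists t φ) → P u t s = Q u t s) : moves r P = moves r Q := by
  simp only [moves, h _ tabId _ exists_lists_id, h _ tabRho _ exists_lists_rho,
    h _ tabRhoInv _ exists_lists_rhoInv, h _ tabSigma _ exists_lists_sigma,
    h _ tabSigmaInv _ exists_lists_sigmaInv, h _ tabTau _ exists_lists_tau]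

/-- Whether all options of the robber at `r` lead to bad states. -/
noncomputable def lost (r a b c : ℕ) : Bool :=
  moves r fun _ t s => force (tab t a) fun a => force (tab t b) fun b => force (tab t c) fun c =>
    bad s a b c

theorem lost_perm {r : ℕ} {a b c a' b' c' : Fin 140} (h : [a, b, c].Perm [a', b', c']) :
    lost r a b c = lost r a' b' c' := by
  refine moves_congr fun u t s ⟨φ, hφ⟩ => ?_
  simp only [force_eq, ← hφ _]
  exact bad_perm (h.map φ)

theorem exists_option_of_lost_eq_false {r a b c : Fin 140} (hr : (r : ℕ) < 3)
    (h : lost r a b c = false) : ∃ r' s : Fin 140, ∃ φ : fullerene ≃g fullerene,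
      Step fullerene r r' ∧ (s : ℕ) < 3 ∧ φ r' = s ∧ bad s (φ a) (φ b) (φ c) = false := by
  obtain ⟨u, t, s, ⟨hu, hs, φ, hφ, e⟩, hP⟩ := exists_option_of_moves_eq_false hr h
  simp only [force_eq, ← hφ _] at hP
  exact ⟨u, s, φ, hu, hs, e, hP⟩

/-- Staying is one of the robber's options, with the identity as its automorphism. Consequently lost
positions occur only among bad ones, and the closure check can run over the tables and over
positions with a cop near the robber. -/
theorem bad_of_lost {r a b c : Fin 140} (hr : (r : ℕ) < 3) (h : lost r a b c = true) :
    bad r a b c = true := by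
  have hP : (fun _ t s => force (tab t a) fun a => force (tab t b) fun b => force (tab t c) fun c =>
    bad s a b c : ℕ → ℕ → ℕ → Bool) r tabId r = true := by
    rcases eq_of_lt_three hr with rfl | rfl | rfl
    all_goals exact (Bool.and_eq_true_iff.1 h).1
  simp only [force_eq, tabId_apply] at hP
  exact hP

/-- Whether a turn of one of the cops from the listed state with key `k` leads to a bad state,
provided that all replies of the robber to the listed state lose. -/
noncomputable def closedEntry (r k _v : ℕ) : Bool :=
  unkey k fun a b c => cond (lost r a b c) (allBelow 3 fun j =>
    and (force (nb a j) fun a => bad r a b c) (and (force (nb b j) fun b => bad r a b c)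
      (force (nb c j) fun c => bad r a b c))) true

theorem closedEntry_check0 : traps0.all (closedEntry 0) = true := by decide +kernel

theorem closedEntry_check1 : traps1.all (closedEntry 1) = true := by decide +kernel

theorem closedEntry_check2 : traps2.all (closedEntry 2) = true := by decide +kernel

/-- The same for a cop next to the robber, which moves away from it. -/
noncomputable def closedNear (r x : ℕ) : Bool :=
  allBelow 140 fun b => allBelow (Nat.succ b) fun a => cond (lost r a b x)
    (allBelow 3 fun j => force (nb x j) fun x => bad r a b x) true

/-- There are nine pairs of a representative and a neighbour, one check for each. The other two cops
run over all pairs `a ≤ b`, which by symmetry covers every placement. -/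
theorem closedNear_check01 : closedNear 0 1 = true := by decide +kernel

theorem closedNear_check03 : closedNear 0 3 = true := by decide +kernel

theorem closedNear_check04 : closedNear 0 4 = true := by decide +kernel

theorem closedNear_check10 : closedNear 1 0 = true := by decide +kernel

theorem closedNear_check12 : closedNear 1 2 = true := by decide +kernel

theorem closedNear_check15 : closedNear 1 5 = true := by decide +kernel

theorem closedNear_check21 : closedNear 2 1 = true := by decide +kernel

theorem closedNear_check26 : closedNear 2 6 = true := by decide +kernel

theorem closedNear_check27 : closedNear 2 7 = true := by decide +kernel

end Evasion

/-! ### The robber's invariant against three cops, and its entry into it. -/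

section Evasion

theorem closedNear_spec {r x : Fin 140} (hr : (r : ℕ) < 3) (hx : fullerene.Adj r x) :
    closedNear r x = true := by
  obtain ⟨j, hj, e⟩ := fullerene_adj.1 hx
  obtain ⟨n00, n01, n02, n10, n11, n12, n20, n21, n22⟩ := nb_reps
  rw [← e]
  rcases eq_of_lt_three hr with rfl | rfl | rfl
  · change closedNear 0 (nb 0 j) = true
    interval_cases j
    · exact n00 ▸ closedNear_check01
    · exact n01 ▸ closedNear_check03
    · exact n02 ▸ closedNear_check04
  · change closedNear 1 (nb 1 j) = true
    interval_cases j
    · exact n10 ▸ closedNear_check10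
    · exact n11 ▸ closedNear_check12
    · exact n12 ▸ closedNear_check15
  · change closedNear 2 (nb 2 j) = true
    interval_cases j
    · exact n20 ▸ closedNear_check21
    · exact n21 ▸ closedNear_check26
    · exact n22 ▸ closedNear_check27

theorem bad_of_lost_of_adj_of_le {r a b x y : Fin 140} (hr : (r : ℕ) < 3) (hab : a ≤ b)
    (hx : fullerene.Adj r x) (h : lost r a b x = true) (hxy : fullerene.Adj x y) :
    bad r a b y = true := by
  have := allBelow_iff.1 (allBelow_iff.1 (closedNear_spec hr hx) b b.2) a (Nat.lt_succ_of_le hab)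
  rw [h, cond_true] at this
  obtain ⟨j, hj, e⟩ := fullerene_adj.1 hxy
  have := allBelow_iff.1 this j hj
  rwa [force_eq, e] at this

theorem bad_of_lost_of_adj {r a b x y : Fin 140} (hr : (r : ℕ) < 3)
    (hx : fullerene.Adj r x) (h : lost r a b x = true) (hxy : fullerene.Adj x y) :
    bad r a b y = true := by
  rcases le_total a b with hab | hab
  · exact bad_of_lost_of_adj_of_le hr hab hx h hxy
  · rw [bad_perm (List.Perm.swap b a [y])]
    refine bad_of_lost_of_adj_of_le hr hab hx ?_ hxy
    rwa [lost_perm (List.Perm.swap a b [x])]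

/-- This replaces the moved cop inside a triple whose order has been changed by sorting: cancel `c`,
then insert `y`. -/
theorem perm_last_of_perm {α : Type*} {a b c y : α} {m : List α}
    (h : (c :: m).Perm [a, b, c]) : (y :: m).Perm [a, b, y] := by
  have h₁ : (c :: m).Perm (c :: [a, b]) :=
    h.trans (List.perm_append_comm (l₁ := [a, b]) (l₂ := [c]))
  exact ((List.perm_cons c).1 h₁ |>.cons y).trans
    (List.perm_append_comm (l₁ := [y]) (l₂ := [a, b]))

/-- Edges are undirected, so moving a cop forward from a lost position enumerates the positions from
which a turn of that cop reaches it. -/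
theorem closedEntry_spec {r k v : ℕ} {a b c : Fin 140} (hk : k = key a b c)
    (h : closedEntry r k v = true) (hl : lost r a b c = true) {j : ℕ} (hj : j < 3) :
    bad r (nb a j) b c = true ∧ bad r a (nb b j) c = true ∧ bad r a b (nb c j) = true := by
  rw [closedEntry, hk, unkey_key, hl, cond_true] at h
  have := allBelow_iff.1 h j hj
  simpa only [force_eq, Bool.and_eq_true] using this

/-- If the cops can prevent the robber from reaching a state that is not bad after their turn, then
the state before their turn was bad. -/
theorem bad_of_lost_of_step {r a b x y : Fin 140} (hr : (r : ℕ) < 3)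
    (h : lost r a b x = true) (hxy : Step fullerene y x) : bad r a b y = true := by
  rcases hxy with rfl | hxy
  · exact bad_of_lost hr h
  replace hxy := hxy.symm
  -- The lost position is bad for one of four reasons. If an unmoved cop is near the robber, it was
  -- so before the turn. If the moved cop landed on the robber, it came from a neighbouring vertex.
  -- If it landed next to the robber, the `closedNear` checks apply, and if the position is listed,
  -- the `closedEntry` checks.
  rcases bad_iff.1 (bad_of_lost hr h) with h' | h' | h' | h'
  · exact bad_iff.2 (Or.inl h')
  · exact bad_iff.2 (Or.inr (Or.inl h'))
  · rcases (near_iff hr).1 h' with rfl | h'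
    · exact bad_iff.2 (Or.inr (Or.inr (Or.inl ((near_iff hr).2 (Or.inr hxy)))))
    · exact bad_of_lost_of_adj hr h' h hxy
  · have hall := BT.all_find (traps_all (P := closedEntry) closedEntry_check0 closedEntry_check1
      closedEntry_check2 hr) h'
    obtain ⟨a', b', c', -, -, hp, hk⟩ := key3_spec a b x
    obtain ⟨j, hj, e⟩ := fullerene_adj.1 hxy
    obtain ⟨ha, hb, hc⟩ := closedEntry_spec hk hall ((lost_perm hp).trans h) hj
    have hmem : x ∈ [a', b', c'] := hp.mem_iff.2 (by simp)
    simp only [List.mem_cons, List.not_mem_nil, or_false] at hmem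
    -- Sorting may have put the moved cop in any of the three places, and the check covers
    -- predecessors through each.
    rcases hmem with rfl | rfl | rfl
    · rw [e] at ha
      rwa [← bad_perm (perm_last_of_perm (y := y) hp)]
    · rw [e] at hb
      rw [← bad_perm (perm_last_of_perm (y := y) ((List.Perm.swap _ _ _).trans hp))]
      rwa [bad_perm (List.Perm.swap _ _ _)] at hb
    · rw [e] at hc
      rw [← bad_perm (perm_last_of_perm (y := y)
        ((List.perm_append_comm (l₁ := [x]) (l₂ := [a', b'])).trans hp))]
      rwa [bad_perm (List.perm_append_comm (l₁ := [a', b']) (l₂ := [y]))] at hc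

/-- The generator that brings `x` nearer to a representative. -/
noncomputable def stepTab (x : ℕ) : ℕ :=
  (fun i => cond (Nat.beq i 0) tabId (cond (Nat.beq i 1) tabRho (cond (Nat.beq i 2) tabRhoInv
    (cond (Nat.beq i 3) tabSigma (cond (Nat.beq i 4) tabSigmaInv tabTau))))) (tab tabStep x)

theorem exists_lists_stepTab (x : ℕ) : ∃ φ, Lists (stepTab x) φ := by
  simp only [stepTab, Bool.cond_eq_ite]
  split_ifs
  exacts [exists_lists_id, exists_lists_rho, exists_lists_rhoInv, exists_lists_sigma,
    exists_lists_sigmaInv, exists_lists_tau]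

/-- Applies `n` generators to move `x` to a representative. -/
noncomputable def walk (n : ℕ) : (ℕ → ℕ) → (ℕ → (ℕ → ℕ) → Bool) → ℕ → Bool :=
  Nat.rec (fun g K x => K x g)
    (fun _ ih g K x => force (tab (stepTab x) x) (ih (fun c => tab (stepTab x) (g c)) K)) n

/-- In the induction `ψ` is the composite of the generators applied so far, `g` is the same map on
numbers, and `ψ x` is where `x` has arrived. -/
theorem walk_spec (x : Fin 140) (n : ℕ) : ∀ (g : ℕ → ℕ) (ψ : fullerene ≃g fullerene),
    (∀ c : Fin 140, g c = ψ c) → ∃ (g' : ℕ → ℕ) (φ : fullerene ≃g fullerene),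
      (∀ c : Fin 140, g' c = φ c) ∧ ∀ K, walk n g K (ψ x) = K (φ x) g' := by
  induction n with
  | zero => exact fun g ψ h => ⟨g, ψ, h, fun K => rfl⟩
  | succ n ih =>
    intro g ψ h
    obtain ⟨χ, hχ⟩ := exists_lists_stepTab (ψ x)
    obtain ⟨g', φ, hg, hw⟩ := ih (fun c => tab (stepTab (ψ x)) (g c)) (ψ.trans χ)
      fun c => by rw [h c]; exact (hχ _).symm
    refine ⟨g', φ, hg, fun K => ?_⟩
    have : walk (n + 1) g K (ψ x) = force (tab (stepTab (ψ x)) (ψ x))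
      (walk n (fun c => tab (stepTab (ψ x)) (g c)) K) := rfl
    rw [this, force_eq, ← hχ]
    exact hw K

/-- `K (φ x) φ` for an automorphism `φ` that takes `x` to a representative. -/
noncomputable def normalize (x : ℕ) (K : ℕ → (ℕ → ℕ) → Bool) : Bool := walk 7 (fun c => c) K x

/-- Seven generators suffice for every vertex. Shorter walks are padded without effect, because
`tabStep` selects the identity at 0, 1 and 2. -/
theorem normalize_check : (allBelow 140 fun x => normalize x fun s _ => Nat.blt s 3) = true := by
  decide +kernel

theorem exists_normalize (x : Fin 140) : ∃ (g : ℕ → ℕ) (φ : fullerene ≃g fullerene),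
    (∀ c : Fin 140, g c = φ c) ∧ ((φ x : Fin 140) : ℕ) < 3 ∧ ∀ K, normalize x K = K (φ x) g := by
  obtain ⟨g, φ, hg, hK⟩ := walk_spec x 7 (fun c => c) (RelIso.refl _) fun _ => rfl
  refine ⟨g, φ, hg, ?_, hK⟩
  have := allBelow_iff.1 normalize_check x x.2
  rwa [show normalize x (fun s _ => Nat.blt s 3) = Nat.blt (φ x) 3 from hK _, blt_iff] at this

/-- The vertices within distance five of a representative. -/
noncomputable def ballMask (r : ℕ) : ℕ :=
  cond (Nat.beq r 0) 139706696204287 (cond (Nat.beq r 1) 493680720871423 8448639294767103)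

noncomputable def inBall (r a : ℕ) : Bool := bit (ballMask r) a

noncomputable def ballEntry (r k _v : ℕ) : Bool :=
  unkey k fun a b c => or (inBall r a) (or (inBall r b) (inBall r c))

theorem ballEntry_check0 : traps0.all (ballEntry 0) = true := by decide +kernel

theorem ballEntry_check1 : traps1.all (ballEntry 1) = true := by decide +kernel

theorem ballEntry_check2 : traps2.all (ballEntry 2) = true := by decide +kernel

theorem inBall_of_near_check : (allBelow 3 fun r => allBelow 140 fun a =>
    or (not (near r a)) (inBall r a)) = true := by
  decide +kernel

theorem inBall_of_near {r a : Fin 140} (hr : (r : ℕ) < 3) (h : near r a = true) :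
    inBall r a = true := by
  have := allBelow_iff.1 (allBelow_iff.1 inBall_of_near_check r hr) a a.2
  rwa [h] at this

/-- Bad positions are local: some cop is always in the ball about the robber. This is what makes the
counting in `exists_safe` possible. -/
theorem exists_inBall_of_bad {r a b c : Fin 140} (hr : (r : ℕ) < 3) (h : bad r a b c = true) :
    ∃ x ∈ [a, b, c], inBall r x = true := by
  rcases bad_iff.1 h with h | h | h | h
  · exact ⟨a, by simp, inBall_of_near hr h⟩
  · exact ⟨b, by simp, inBall_of_near hr h⟩
  · exact ⟨c, by simp, inBall_of_near hr h⟩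
  · have hall := BT.all_find (traps_all (P := ballEntry) ballEntry_check0 ballEntry_check1
      ballEntry_check2 hr) h
    obtain ⟨a', b', c', -, -, hp, hk⟩ := key3_spec a b c
    rw [hk, ballEntry, unkey_key] at hall
    simp only [Bool.or_eq_true] at hall
    rcases hall with h | h | h
    · exact ⟨a', hp.subset (by simp), h⟩
    · exact ⟨b', hp.subset (by simp), h⟩
    · exact ⟨c', hp.subset (by simp), h⟩

/-- The number of numbers below `n` with the property `p`. -/
noncomputable def countBelow (n : ℕ) (p : ℕ → Bool) : ℕ :=
  Nat.rec 0 (fun k ih => Nat.add ih (cond (p k) 1 0)) n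

theorem countBelow_eq (n : ℕ) (p : ℕ → Bool) :
    countBelow n p = ∑ i ∈ Finset.range n, cond (p i) 1 0 := by
  induction n with
  | zero => rfl
  | succ n ih =>
    rw [Finset.sum_range_succ, ← ih]
    rfl

noncomputable def isClose (x c : ℕ) : Bool := normalize x fun s g => inBall s (g c)

/-- Here the cop is fixed and the possible vertices of the robber are counted. The bound 43 matters
only through `3 * 43 = 129 < 140`. -/
theorem isClose_check : (allBelow 140 fun c =>
    Nat.ble (countBelow 140 fun x => isClose x c) 43) = true := by
  decide +kernel

/-- The robber at `r` is safe if some automorphism takes the state to one that is not bad. -/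
def Safe (a b c r : Fin 140) : Prop :=
  ∃ φ : fullerene ≃g fullerene, ((φ r : Fin 140) : ℕ) < 3 ∧ bad (φ r) (φ a) (φ b) (φ c) = false

/-- If no vertex were safe, each of the 140 would have one of the three cops in its ball, while
three cops account for at most 129. `Safe` asks for just one good automorphism, so its failure
applies to the normalizing one, for which the close pairs have been counted. -/
theorem exists_safe (a b c : Fin 140) : ∃ r, Safe a b c r := by
  by_contra hc
  have hclose : ∀ x : Fin 140, ∃ y ∈ [a, b, c], isClose x y = true := fun x => by
    obtain ⟨g, φ, hg, hs, hK⟩ := exists_normalize x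
    have hbad : bad (φ x) (φ a) (φ b) (φ c) = true := by
      by_contra hb
      exact hc ⟨x, φ, hs, Bool.eq_false_iff.2 hb⟩
    obtain ⟨y, hy, hy'⟩ := exists_inBall_of_bad hs hbad
    have hy : y ∈ [a, b, c].map φ := hy
    obtain ⟨z, hz, rfl⟩ := List.mem_map.1 hy
    refine ⟨z, hz, ?_⟩
    rw [isClose, hK, hg]
    exact hy'
  have hcount : ∀ y : Fin 140, ∑ i ∈ Finset.range 140, cond (isClose i y) 1 0 ≤ 43 := fun y => by
    rw [← countBelow_eq]
    exact Nat.le_of_ble_eq_true (allBelow_iff.1 isClose_check y y.2)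
  have : ∑ i ∈ Finset.range 140, 1 ≤ ∑ i ∈ Finset.range 140,
      (cond (isClose i a) 1 0 + cond (isClose i b) 1 0 + cond (isClose i c) 1 0) := by
    refine Finset.sum_le_sum fun i hi => ?_
    obtain ⟨y, hy, hy'⟩ := hclose ⟨i, Finset.mem_range.1 hi⟩
    simp only [List.mem_cons, List.not_mem_nil, or_false] at hy
    rcases hy with rfl | rfl | rfl
    all_goals
      change isClose i _ = true at hy'
      rw [hy', cond_true]
      omega
  rw [Finset.sum_add_distrib, Finset.sum_add_distrib, Finset.sum_const, Finset.card_range,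
    smul_eq_mul, mul_one] at this
  have ha := hcount a
  have hb := hcount b
  have hc := hcount c
  omega

theorem Safe.perm {a b c a' b' c' r : Fin 140} (h : [a, b, c].Perm [a', b', c'])
    (hs : Safe a b c r) : Safe a' b' c' r := by
  obtain ⟨φ, hφ, hb⟩ := hs
  refine ⟨φ, hφ, ?_⟩
  rw [← hb]
  exact (bad_perm (h.map φ)).symm

theorem Safe.not_step {a b c r : Fin 140} (h : Safe a b c r) : ¬ Step fullerene c r := by
  obtain ⟨φ, hφ, hb⟩ := h
  intro hs
  refine Bool.eq_false_iff.1 hb (bad_iff.2 (Or.inr (Or.inr (Or.inl ((near_iff hφ).2 ?_)))))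
  exact Step.map φ (hs.imp Eq.symm SimpleGraph.Adj.symm)

/-- The core of the lower bound. If every reply to the cops' turn were bad, then by
`bad_of_lost_of_step` the position before the turn would have been bad as well. -/
theorem Safe.exists_step {a b x y r : Fin 140} (h : Safe a b x r) (hxy : Step fullerene x y) :
    ∃ r', Step fullerene r r' ∧ Safe a b y r' := by
  obtain ⟨φ, hφ, hb⟩ := h
  have hl : lost (φ r) (φ a) (φ b) (φ y) = false :=
    Bool.eq_false_iff.2 fun hl => Bool.eq_false_iff.1 hb
      (bad_of_lost_of_step hφ hl (hxy.map φ))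
  obtain ⟨r', s, χ, hr, hs, e, hb'⟩ := exists_option_of_lost_eq_false hφ hl
  have hr' := hr.map φ.symm
  rw [φ.symm_apply_apply] at hr'
  -- The reply is found in the normalized position and pulled back along `φ`. The new position is
  -- certified by the composite with `χ`, which brings the robber to a representative again.
  refine ⟨φ.symm r', hr', φ.trans χ, ?_⟩
  have : (φ.trans χ) (φ.symm r') = s := by
    rw [← e]
    exact congrArg χ (φ.apply_symm_apply r')
  rw [this]
  exact ⟨hs, hb'⟩

theorem not_copsWin_fullerene_three : ¬ CopsWin fullerene 1 3 := by
  -- The step lemmas treat the last cop of a triple. This moves cop `j` to the last place, in the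
  -- same way before and after a turn that moves no other cop.
  have hperm : ∀ (p : Fin 3 → Fin 140) (j : Fin 3), ∃ a b, [a, b, p j].Perm [p 0, p 1, p 2] ∧
      ∀ q : Fin 3 → Fin 140, (∀ i, i ≠ j → q i = p i) → [a, b, q j].Perm [q 0, q 1, q 2] := by
    intro p j
    fin_cases j
    · refine ⟨p 1, p 2, List.perm_append_comm (l₁ := [p 1, p 2]) (l₂ := [p 0]), fun q hq => ?_⟩
      rw [← hq 1 (by decide), ← hq 2 (by decide)]
      exact List.perm_append_comm (l₁ := [q 1, q 2]) (l₂ := [q 0])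
    · refine ⟨p 0, p 2, (List.Perm.swap _ _ _).cons _, fun q hq => ?_⟩
      rw [← hq 0 (by decide), ← hq 2 (by decide)]
      exact (List.Perm.swap _ _ _).cons _
    · refine ⟨p 0, p 1, List.Perm.refl _, fun q hq => ?_⟩
      rw [← hq 0 (by decide), ← hq 1 (by decide)]
      exact List.Perm.refl _
  refine not_copsWin_of_invariant (fun p r => Safe (p 0) (p 1) (p 2) r)
    (fun p => exists_safe _ _ _) (fun p r h i => ?_) (fun p q r h hpq => ?_)
  · obtain ⟨a, b, hp, -⟩ := hperm p i
    exact (h.perm hp.symm).not_step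
  · obtain ⟨j, hj, hq⟩ := hpq.exists_forall_ne
    obtain ⟨a, b, hp, hp'⟩ := hperm p j
    obtain ⟨r', hr, hs⟩ := (h.perm hp.symm).exists_step hj
    exact ⟨r', hr, hs.perm (hp' q hq)⟩

end Evasion

/-! ### Four cops win. -/

section Chase

set_option maxRecDepth 100000 in
/-- States with the robber at `0` in which four cops win, encoded like those for three cops. -/
noncomputable def chases0 : BT :=
  (.node (.node (.node (.node (.node (.node (.node (.node (.leaf 34877540 82) 34881146 50 .nil)
  85018733 51 (.node (.leaf 85018745 88) 85022573 71 .nil)) 85143913 40 (.node (.node (.leaf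
  85143923 17) 85143925 40 .nil) 85143934 17 (.node (.leaf 85147765 55) 85147774 17 .nil))) 85147776
  43 (.node (.node (.node (.leaf 85147784 58) 85149045 39 .nil) 85151614 17 (.node (.leaf 85209459
  52) 85213312 180 .nil)) 85470069 53 (.node (.node (.leaf 85473653 87) 85670261 55 .nil) 85674093
  68 (.node (.leaf 85677933 151) 85736287 55 .nil)))) 85738314 21 (.node (.node (.node (.node (.leaf
  85739615 72) 85740114 37 .nil) 85864819 36 (.node (.leaf 85866101 36) 85866110 36 .nil)) 85868661
  68 (.node (.node (.leaf 85868670 36) 85868672 52 .nil) 85868680 106 (.node (.leaf 85869941 52)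
  85872510 55 .nil))) 85872512 75 (.node (.node (.node (.leaf 85930355 65) 85934206 65 .nil)
  85935451 17 (.node (.leaf 85935477 65) 86260085 100 .nil)) 86716787 52 (.node (.node (.leaf
  86716798 104) 86716808 120 .nil) 86718069 87 (.leaf 86718078 52))))) 86718088 103 (.node (.node
  (.node (.node (.node (.leaf 86719572 17) 86720638 52 .nil) 86720640 100 (.node (.leaf 86720648
  122) 86721627 33 .nil)) 86721883 49 (.node (.node (.leaf 86721897 74) 86721909 90 .nil) 86723412
  17 (.node (.leaf 86724480 119) 86724488 135 .nil))) 86725722 81 (.node (.node (.node (.leaf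
  86728328 167) 86786174 164 .nil) 87112053 133 (.node (.leaf 87112062 118) 87439733 103 .nil))
  87637056 17 (.node (.node (.leaf 87638142 100) 87639401 84 .nil) 87640916 17 (.node (.leaf
  87643226 97) 101334628 40 .nil)))) 101334639 20 (.node (.node (.node (.node (.leaf 101334641 40)
  101334650 20 .nil) 101334897 39 (.node (.leaf 101338481 55) 101338490 20 .nil)) 101338492 43
  (.node (.node (.leaf 101338501 58) 101342330 20 .nil) 101530477 34 (.node (.leaf 101533805 34)
  101537645 34 .nil))) 101920890 37 (.node (.node (.node (.leaf 101924474 37) 101928314 37 .nil)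
  101982844 53 (.node (.leaf 101983109 39) 101986404 36 .nil)) 101986426 36 (.node (.node (.leaf
  101986437 55) 101990010 36 .nil) 101990244 87 (.leaf 101993850 36)))))) 102055546 114 (.node
  (.node (.node (.node (.node (.node (.leaf 102055780 34) 102193005 50 .nil) 102703740 39 (.node
  (.leaf 102710906 52) 102776676 50 .nil)) 102778500 97 (.node (.node (.leaf 118698366 117)
  118703465 37 .nil) 119617411 129 (.node (.leaf 120139403 120) 120146827 119 .nil))) 121060491 116
  (.node (.node (.node (.leaf 135022687 52) 135026542 180 .nil) 135088210 40 (.node (.leaf 135088223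
  17) 135088224 40 .nil)) 135088237 17 (.node (.node (.leaf 135088736 39) 135092064 55 .nil)
  135092077 17 (.node (.leaf 135092078 43) 135092089 58 .nil)))) 135095661 17 (.node (.node (.node
  (.node (.leaf 135544442 50) 135544453 88 .nil) 135548282 71 (.node (.leaf 135676746 17) 135678047
  65 .nil)) 135678560 65 (.node (.node (.leaf 135681901 65) 135740256 36 .nil) 135740269 36 (.node
  (.leaf 135743583 36) 135744096 52 .nil))) 135747424 68 (.node (.node (.node (.leaf 135747437 36)
  135747438 52 .nil) 135747449 106 (.node (.leaf 135751021 55) 135751022 75 .nil)) 136261472 55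
  (.node (.node (.leaf 136265338 68) 136269178 151 .nil) 136327279 55 (.leaf 136330863 72)))))
  136331094 21 (.node (.node (.node (.node (.node (.leaf 136331108 37) 136455513 17 .nil) 136457056
  56 (.node (.leaf 136458841 17) 136461152 87 .nil)) 136461165 53 (.node (.node (.leaf 136461177
  103) 136462937 81 .nil) 136463177 33 (.node (.leaf 136463178 49) 136464479 53 .nil))) 136464493
  104 (.node (.node (.node (.leaf 136464505 120) 136464978 74 .nil) 136464992 90 (.node (.leaf
  136468333 53) 136468334 101 .nil)) 136468345 122 (.node (.node (.leaf 136471918 119) 136471929 135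
  .nil) 136475257 167 (.node (.leaf 136533869 164) 136654679 17 .nil)))) 137047904 87 (.node (.node
  (.node (.node (.leaf 137310809 17) 137312608 103 .nil) 137313120 100 (.node (.leaf 137314905 97)
  137316448 136 .nil)) 137316461 116 (.node (.node (.leaf 137316946 84) 137320301 100 .nil)
  151794046 51 (.node (.leaf 151795305 83) 168571262 50 .nil))) 168571272 88 (.node (.node (.node
  (.leaf 168575102 71) 168702065 36 .nil) 168702074 36 (.node (.leaf 168705647 36) 168705905 52
  .nil)) 168709489 68 (.node (.node (.leaf 168709498 36) 168709500 52 .nil) 168709509 106 (.leaf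
  168713338 55))))))) 168713340 75 (.node (.node (.node (.node (.node (.node (.node (.leaf 168767859
  72) 168769139 55 .nil) 168772955 20 (.node (.leaf 168772969 36) 168902255 52 .nil)) 168906108 180
  (.node (.node (.leaf 169223281 55) 169226622 68 .nil) 169230462 151 (.node (.leaf 169353841 55)
  169357425 87 .nil))) 169357434 52 (.node (.node (.node (.leaf 169357445 103) 169358166 33 .nil)
  169359182 17 (.node (.leaf 169361007 52) 169361018 104 .nil)) 169361029 120 (.node (.node (.leaf
  169361238 49) 169361252 74 .nil) 169361265 90 (.node (.leaf 169363022 17) 169364858 52 .nil))))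
  169364860 100 (.node (.node (.node (.node (.leaf 169364869 122) 169365077 81 .nil) 169368700 119
  (.node (.leaf 169368709 135) 169372293 167 .nil)) 169557615 65 (.node (.node (.leaf 169557846 17)
  169557873 65 .nil) 169561466 65 (.node (.leaf 170009713 87) 170143601 103 .nil))) 170143857 100
  (.node (.node (.node (.leaf 170145613 17) 170147441 136 .nil) 170147450 116 (.node (.leaf
  170147684 84) 170149454 17 .nil)) 170151290 100 (.node (.node (.leaf 170151509 97) 170413434 164
  .nil) 185678674 82 (.leaf 185682029 50))))) 202578048 51 (.node (.node (.node (.node (.node (.leaf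
  202582152 39) 202584446 33 .nil) 202585705 33 (.node (.leaf 202585726 33) 202585736 55 .nil))
  202588286 33 (.node (.node (.leaf 202589545 87) 202907518 37 .nil) 202907528 53 (.node (.leaf
  202910590 53) 202910600 85 .nil))) 202914174 119 (.node (.node (.node (.leaf 203107198 40)
  203107208 56 .nil) 203309182 49 (.node (.leaf 203310441 100) 204158581 97 .nil)) 204161150 84
  (.node (.node (.leaf 204161160 129) 204880245 129 .nil) 205014389 213 (.node (.leaf 205018229 229)
  205078654 113 .nil)))) 205079913 97 (.node (.node (.node (.node (.leaf 205079925 199) 205083765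
  215 .nil) 205539454 167 (.node (.leaf 219229038 53) 219229305 39 .nil)) 219233106 36 (.node (.node
  (.leaf 219233133 36) 219233145 55 .nil) 219236461 36 (.node (.leaf 219236946 87) 219240301 36
  .nil))) 219301997 113 (.node (.node (.node (.leaf 219302482 33) 219361662 33 .nil) 219362942 33
  (.node (.leaf 219365502 33) 219884398 40 .nil)) 219891821 52 (.node (.node (.leaf 219951755 98)
  219957842 49 .nil) 220086398 49 (.leaf 236146042 53)))))) 236207972 97 (.node (.node (.node (.node
  (.node (.node (.leaf 236211578 52) 237054595 82 .nil) 252921193 53 (.node (.leaf 252922761 100)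
  253835145 199 .nil)) 254357129 120 (.node (.node (.leaf 255410302 162) 255871102 210 .nil)
  269630599 132 (.node (.leaf 270285963 199) 270413447 85 .nil))) 271137931 113 (.node (.node (.node
  (.leaf 271398795 119) 272055435 151 .nil) 286665581 40 (.node (.leaf 286665593 56) 286739026 100
  .nil)) 286742381 49 (.node (.node (.leaf 287253101 39) 287253113 55 .nil) 287452013 56 (.node
  (.leaf 287452025 88) 287456096 97 .nil)))) 287463277 85 (.node (.node (.node (.node (.leaf
  287463289 129) 288042861 119 .nil) 288308064 129 (.node (.leaf 288311890 97) 288311904 199 .nil))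
  288315245 113 (.node (.node (.leaf 288315744 215) 289229408 213 .nil) 289233248 229 (.node (.leaf
  289298285 164) 303705476 117 .nil))) 304430212 119 (.node (.node (.node (.leaf 304951940 119)
  320215168 40 .nil) 320221566 52 (.node (.leaf 336992378 40) 336992389 56 .nil)) 337126010 55
  (.node (.node (.leaf 337126021 87) 337129585 97 .nil) 337137018 84 (.leaf 337137029 129)))))
  337322618 39 (.node (.node (.node (.node (.node (.leaf 337322629 55) 337781882 119 .nil) 337916017
  129 (.node (.leaf 337919844 97) 337919857 199 .nil)) 337923450 113 (.node (.node (.leaf 337923697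
  215) 338116465 213 .nil) 338120305 229 (.node (.leaf 338775418 164) 353970825 120 .nil)))
  353977993 119 (.node (.node (.node (.leaf 354231682 129) 354760585 116 .nil) 372790389 241 (.node
  (.leaf 387587458 82) 421346436 119 .nil)) 421538436 120 (.node (.node (.leaf 421607305 116)
  422129289 119 .nil) 422194564 116 (.node (.leaf 422198404 148) 422459273 212 .nil)))) 422463113
  263 (.node (.node (.node (.node (.leaf 423050377 151) 438054283 114 .nil) 438906251 113 (.node
  (.leaf 438910091 209) 438913931 263 .nil)) 439170955 145 (.node (.node (.leaf 457005408 241)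
  472864621 161 .nil) 473847661 209 (.node (.leaf 488646020 199) 488975748 113 .nil))) 488979588 148
  (.node (.node (.node (.leaf 522669681 241) 539250042 161 .nil) 540102010 209 (.node (.leaf
  556083593 116) 556087177 151 .nil)) 623455881 151 (.node (.node (.leaf 623459467 145) 623521156
  212 .nil) 623720324 151 (.leaf 707605124 263))))))))

set_option maxRecDepth 100000 in
/-- The corresponding states with the robber at `1`. -/
noncomputable def chases1 : BT :=
  (.node (.node (.node (.node (.node (.node (.node (.node (.leaf 51784813 36) 51788370 26 .nil)
  51791967 52 (.leaf 51792210 26)) 51792480 52 (.node (.node (.leaf 51795821 52) 51987544 36 .nil)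
  51992673 36 (.leaf 51992674 36))) 52576855 52 (.node (.node (.node (.leaf 52576857 72) 52576882 72
  .nil) 52577097 20 (.leaf 52577098 36)) 52577113 71 (.node (.leaf 52577138 71) 52578399 100 (.leaf
  52578642 42)))) 52578898 82 (.node (.node (.node (.node (.leaf 52580695 71) 52580697 87 .nil)
  52580722 87 (.leaf 52580953 87)) 52582253 98 (.node (.node (.leaf 52779106 97) 53428567 87 .nil)
  53428825 84 (.leaf 53631074 161))) 55595891 241 (.node (.node (.node (.leaf 55795059 257) 68111188
  17 .nil) 68567145 17 (.leaf 68567166 17)) 68567168 17 (.node (.leaf 68762964 17) 68766548 17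
  (.leaf 68766804 17))))) 72900450 241 (.node (.node (.node (.node (.node (.leaf 101533805 34)
  101537645 34 .nil) 101990010 36 (.leaf 101990244 55)) 102193005 52 (.node (.node (.leaf 102710906
  52) 102776676 53 .nil) 102913901 69 (.leaf 118108531 82))) 118108542 106 (.node (.node (.node
  (.leaf 118113641 26) 118763620 97 .nil) 118767226 65 (.leaf 134889071 34)) 134892924 162 (.node
  (.leaf 135022687 20) 135023200 20 (.leaf 135026541 20)))) 135026542 20 (.node (.node (.node (.node
  (.leaf 135027040 129) 135084882 20 .nil) 135084896 20 (.leaf 135084909 20)) 135088223 20 (.node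
  (.leaf 135088224 20) 135088237 20 (.leaf 135088736 20))) 135092064 20 (.node (.node (.node (.leaf
  135092077 20) 135092078 20 .nil) 135095661 39 (.leaf 135537248 39)) 135540869 66 (.node (.leaf
  135544442 50) 135672906 33 (.leaf 135674450 76)))))) 135674464 60 (.node (.node (.node (.node
  (.node (.node (.leaf 135674478 40) 135674489 58 .nil) 135674720 20 (.leaf 135674733 20)) 135674745
  36 (.node (.node (.leaf 135676745 17) 135676746 33 .nil) 135678047 68 (.leaf 135678290 87)))
  135678304 71 (.node (.node (.node (.leaf 135678329 71) 135678560 101 .nil) 135681901 101 (.leaf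
  135681902 117)) 135682400 119 (.node (.leaf 135740269 36) 135743583 36 (.leaf 135747437 36))))
  135747438 91 (.node (.node (.node (.node (.leaf 135751021 52) 136258144 39 .nil) 136265338 130
  (.leaf 136457056 72)) 136457312 71 (.node (.leaf 136457337 84) 136458841 55 (.leaf 136459378 65)))
  136461152 87 (.node (.node (.node (.leaf 136461165 84) 136461177 100 .nil) 136462681 71 (.leaf
  136462937 71)) 136463177 33 (.node (.leaf 136463178 52) 136463218 81 (.leaf 136464479 116)))))
  136464493 105 (.node (.node (.node (.node (.node (.leaf 136464722 58) 136464978 74 .nil) 136464992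
  90 (.leaf 136466777 103)) 136467033 90 (.node (.node (.leaf 136468333 85) 136468334 107 .nil)
  136468345 122 (.leaf 136468832 103))) 136471917 103 (.node (.node (.node (.leaf 136471918 119)
  136471929 138 .nil) 136474226 138 (.leaf 136475257 151)) 136533869 116 (.node (.leaf 137047904 87)
  137310807 55 (.leaf 137310809 68)))) 137313120 116 (.node (.node (.node (.node (.leaf 137314905
  87) 137316946 84 .nil) 137318745 119 (.leaf 137320301 100)) 137385837 180 (.node (.leaf 153245549
  113) 168572521 55 (.leaf 168572545 55))) 168572552 75 (.node (.node (.node (.leaf 168575102 66)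
  168716924 167 .nil) 168716933 225 (.leaf 168765545 17)) 168765555 39 (.node (.leaf 168767859 33)
  168769139 55 (.leaf 168772955 17))))))) 168772969 42 (.node (.node (.node (.node (.node (.node
  (.node (.leaf 169226622 68) 169368709 145 .nil) 169372293 263 (.leaf 169561466 149)) 170009713 68
  (.node (.node (.leaf 186207060 49) 186397323 87 .nil) 186459522 116 (.leaf 187780474 113)))
  202255230 70 (.node (.node (.node (.leaf 202455904 17) 202463085 81 .nil) 202581118 57 (.leaf
  202581120 71)) 202584425 49 (.node (.leaf 202584446 33) 202584456 101 (.leaf 202585705 69))))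
  202588286 55 (.node (.node (.node (.node (.leaf 202588296 113) 202589545 87 .nil) 202653822 84
  (.leaf 202910590 56)) 202910600 72 (.node (.node (.leaf 202914174 71) 203118445 161 .nil)
  203309182 68 (.leaf 203367560 71))) 203374718 149 (.node (.node (.node (.leaf 203697032 100)
  203700597 113 .nil) 203700606 132 (.leaf 204157320 193)) 204161150 132 (.node (.leaf 204161160
  209) 204165000 231 (.leaf 204552565 145))))) 204552574 161 (.node (.node (.node (.node (.node
  (.leaf 204879989 200) 204880245 177 .nil) 205014389 213 (.leaf 205018229 231)) 205078654 148
  (.node (.node (.leaf 205079925 199) 205083765 215 .nil) 205539454 199 (.leaf 219225977 17)))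
  219229305 17 (.node (.node (.node (.leaf 219233106 17) 219233133 17 .nil) 219236461 36 (.leaf
  219236946 55)) 219240301 36 (.node (.leaf 219881326 17) 219884398 17 (.leaf 236204145 52))))
  236207738 49 (.node (.node (.node (.node (.leaf 236207972 113) 236207985 116 .nil) 236211569 84
  (.leaf 236211578 52)) 236211589 116 (.node (.leaf 236273274 129) 236273508 49 (.leaf 236994404
  65))) 253640830 130 (.node (.node (.node (.leaf 253838985 215) 254492798 146 .nil) 254687113 135
  (.leaf 255410302 194)) 255871102 210 (.node (.leaf 270612355 145) 271134347 129 (.leaf 271141771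
  129)))))) 286532205 39 (.node (.node (.node (.node (.node (.node (.leaf 286662509 20) 286662521 36
  .nil) 286665581 20 (.leaf 286669664 97)) 286671690 49 (.node (.node (.leaf 286742381 52) 287253088
  65 .nil) 287253101 39 (.leaf 287253113 71))) 287452013 100 (.node (.node (.node (.leaf 287452256
  81) 287456096 113 .nil) 287458122 65 (.leaf 287459922 81)) 287463277 97 (.node (.leaf 288308064
  132) 288311890 97 (.leaf 288311904 122)))) 288313945 122 (.node (.node (.node (.node (.leaf
  288315245 116) 288315744 215 .nil) 289233248 229 (.leaf 289298285 180)) 304426372 100 (.node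
  (.leaf 304430212 100) 337126010 55 (.leaf 337133412 132))) 337137029 145 (.node (.node (.node
  (.leaf 337916017 113) 337919857 151 .nil) 337923450 113 (.leaf 337923697 215)) 338116465 213
  (.node (.leaf 338120305 229) 338775418 196 (.leaf 353974153 100))))) 372790389 241 (.node (.node
  (.node (.node (.node (.leaf 387525002 146) 387723915 113 .nil) 387786114 104 (.leaf 421339268
  177)) 421339524 100 (.node (.node (.leaf 421342596 100) 421346436 100 .nil) 421541764 97 (.leaf
  421607305 135))) 421607306 151 (.node (.node (.node (.leaf 422129289 129) 422129291 135 .nil)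
  422393737 129 (.leaf 422459273 247)) 422463113 263 (.node (.leaf 438116738 65) 438910091 194
  (.leaf 438913931 231)))) 456087904 225 (.node (.node (.node (.node (.leaf 457005408 257) 472864621
  177 .nil) 473847661 257 (.leaf 488711554 88)) 488975748 201 (.node (.leaf 488979588 161) 522669681
  257 (.leaf 539250042 193))) 540102010 260 (.node (.node (.node (.leaf 556083593 132) 623455620 97
  .nil) 623455881 151 (.leaf 623459467 177)) 623521156 228 (.node (.leaf 623524996 196) 623785865
  167 (.leaf 707605124 247))))))))

set_option maxRecDepth 100000 in
/-- The corresponding states with the robber at `2`. -/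
noncomputable def chases2 : BT :=
  (.node (.node (.node (.node (.node (.node (.node (.node (.leaf 1728871 100) 2440559 34 .nil)
  2566504 27 (.leaf 3298138 68)) 3298163 164 (.node (.leaf 3299425 84) 3299426 84 (.leaf 3301735
  132))) 3490151 100 (.node (.node (.leaf 3490152 71) 3490163 87 (.leaf 3493992 87)) 4277351 119
  (.node (.leaf 4277363 103) 4281203 151 (.leaf 4282466 148)))) 4284775 177 (.node (.node (.node
  (.leaf 4348001 148) 4348002 148 (.leaf 4477032 116)) 4477043 151 (.node (.leaf 5264243 228)
  5265506 228 (.leaf 5331042 212))) 5463411 248 (.node (.node (.leaf 5791586 232) 51129453 18 (.leaf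
  51136607 34)) 51137120 34 (.node (.leaf 51140461 34) 51140960 123 (.leaf 51791967 82))))) 52582253
  98 (.node (.node (.node (.node (.node (.leaf 52773976 52) 52773990 97 .nil) 52773991 81 (.leaf
  52777818 43)) 52777843 161 (.node (.leaf 52779105 52) 52779106 52 (.leaf 52781415 129))) 53424727
  66 (.node (.node (.leaf 53622131 81) 53629811 177 (.leaf 53631073 145)) 53631074 116 (.node (.leaf
  54614114 196) 55595891 241 (.leaf 55795059 264)))) 69488227 33 (.node (.node (.node (.leaf
  70339962 97) 72900450 257 (.leaf 85147784 103)) 85864821 71 (.node (.leaf 85864830 103) 85864832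
  119 (.leaf 85864840 100))) 86256491 17 (.node (.node (.leaf 86256502 20) 86256520 114 (.leaf
  86263901 17)) 86328947 97 (.node (.leaf 86716808 183) 86720648 199 (.leaf 86724488 242))))))
  86728328 263 (.node (.node (.node (.node (.node (.node (.leaf 87111797 68) 87112053 68 .nil)
  87112062 148 (.leaf 87439733 165)) 87572597 135 (.node (.leaf 135019385 18) 135026542 43 (.leaf
  135534176 18))) 135667552 18 (.node (.node (.leaf 135670880 18) 135670893 18 (.leaf 135670905 18))
  135671150 18 (.node (.leaf 135674450 20) 135674464 20 (.leaf 135674478 20)))) 135674489 39 (.node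
  (.node (.node (.leaf 135674720 20) 135674733 20 (.leaf 135674745 39)) 135678047 36 (.node (.leaf
  135678560 36) 135681901 36 (.leaf 135681902 52))) 135682400 117 (.node (.node (.leaf 135747437 66)
  136258144 18 (.leaf 136457056 56)) 136457312 36 (.node (.leaf 136461152 36) 136462937 71 (.leaf
  136463177 36))))) 136463178 52 (.node (.node (.node (.node (.node (.leaf 136463218 87) 136464479
  84 .nil) 136464722 58 (.leaf 136464978 72)) 136464992 90 (.node (.leaf 136466777 87) 136467033 90
  (.leaf 136468333 82))) 136468334 107 (.node (.node (.leaf 136468832 103) 136471918 119 (.leaf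
  136471929 138)) 136474226 138 (.node (.leaf 136475257 154) 136533869 116 (.leaf 137314905 84))))
  137316946 84 (.node (.node (.node (.leaf 137385837 132) 168568937 37 (.leaf 168568961 39))
  168772955 20 (.node (.leaf 169372284 180) 169372293 167 (.leaf 170075249 87))) 170141284 65 (.node
  (.node (.leaf 170143857 100) 170144612 65 (.leaf 170147697 100)) 170151290 100 (.node (.leaf
  170151537 151) 186928506 113 (.leaf 186932346 145))))))) 202258814 87 (.node (.node (.node (.node
  (.node (.node (.node (.leaf 202448761 21) 202455904 20 .nil) 202463584 148 (.leaf 202585705 72))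
  202592129 100 (.node (.leaf 202914174 71) 203107424 23 (.leaf 203302014 68))) 203302016 84 (.node
  (.node (.leaf 203305342 52) 203305352 116 (.leaf 203309182 116)) 203309192 132 (.node (.leaf
  203697014 49) 203697032 84 (.leaf 203700341 65)))) 203700597 65 (.node (.node (.node (.leaf
  203700606 116) 204157320 119 (.leaf 204161150 132)) 204161160 215 (.node (.leaf 204165000 231)
  204552309 129 (.leaf 204552565 132))) 204552574 148 (.node (.node (.leaf 204879989 200) 204880245
  165 (.leaf 205013109 209)) 205014389 215 (.node (.leaf 205018229 231) 205078654 183 (.leaf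
  205079925 199))))) 205539454 199 (.node (.node (.node (.node (.node (.leaf 220542851 87) 253048713
  81 .nil) 253567108 161 (.leaf 253640830 130)) 253699208 82 (.node (.leaf 253769604 81) 253835145
  145 (.leaf 254492798 148))) 254621577 113 (.node (.node (.leaf 255410302 164) 255871102 215 (.leaf
  269758577 66)) 269762170 66 (.node (.leaf 269762417 130) 269766001 98 (.leaf 269827706 146))))
  286529133 23 (.node (.node (.node (.leaf 286662509 20) 286662521 52 (.leaf 286665581 20))
  286667850 49 (.node (.leaf 286669664 33) 286671690 49 (.leaf 286671705 74))) 286676845 100 (.node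
  (.node (.leaf 286676846 129) 286677344 129 (.leaf 287454322 81)) 287456096 97 (.node (.leaf
  287458122 65) 287458137 90 (.leaf 287458162 97)))))) 287461721 113 (.node (.node (.node (.node
  (.node (.node (.leaf 287461977 97) 287463277 97 .nil) 287463776 113 (.leaf 287528813 129))
  288174724 87 (.node (.leaf 288310090 84) 288311890 97 (.leaf 288311904 202))) 288313945 202 (.node
  (.node (.leaf 288315245 164) 288315744 218 (.leaf 288380781 193)) 289233248 245 (.node (.leaf
  289298285 244) 303636868 82 (.leaf 303639940 82)))) 303643780 82 (.node (.node (.node (.leaf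
  304426372 146) 304430212 146 (.leaf 337133412 81)) 337916017 129 (.node (.leaf 337919844 180)
  337919857 145 (.leaf 337923450 161))) 337923697 215 (.node (.node (.leaf 338120305 245) 353914234
  129 (.leaf 354700666 161)) 354757001 97 (.node (.leaf 370890605 177) 372790389 241 (.leaf
  421277321 119))))) 421603721 119 (.node (.node (.node (.node (.node (.leaf 421603722 135)
  421603723 119 .nil) 422129028 84 (.leaf 422129289 226)) 422132875 164 (.node (.leaf 422459273 242)
  422463113 263 (.leaf 438384515 161))) 438906507 145 (.node (.node (.leaf 438913931 145) 456087904
  241 (.leaf 457005408 261)) 472198532 81 (.node (.leaf 472198793 135) 472202372 84 (.leaf 472202379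
  164)))) 473847661 257 (.node (.node (.node (.leaf 488975748 209) 488979588 177 (.leaf 522669681
  257)) 539250042 241 (.node (.leaf 540102010 260) 556083593 135 (.leaf 556083595 71))) 556087177
  151 (.node (.node (.leaf 623455620 148) 623455881 151 (.leaf 623459467 180)) 623521156 228 (.node
  (.leaf 623720324 231) 623785865 231 (.leaf 707605124 263))))))))

noncomputable def chases (r : ℕ) : BT :=
  cond (Nat.beq r 0) chases0 (cond (Nat.beq r 1) chases1 chases2)

noncomputable def keyFour (a b c d : ℕ) : ℕ := Nat.add (Nat.mul (key a b c) 256) d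

/-- The key of the quadruple after sorting. -/
noncomputable def key4 (a b c d : ℕ) : ℕ :=
  sort2 a b fun a b => sort2 c d fun c d => sort2 a c fun a c => sort2 b d fun b d =>
    sort2 b c fun b c => keyFour a b c d

/-- The five comparisons sort four numbers, but only the permutation is recorded: this list is used
for soundness alone, and a lookup under another order could merely fail to find an entry. -/
theorem key4_spec {n : ℕ} (a b c d : Fin n) : ∃ a' b' c' d' : Fin n,
    [a', b', c', d'].Perm [a, b, c, d] ∧ key4 a b c d = keyFour a' b' c' d' := by
  obtain ⟨a₁, b₁, -, p₁, e₁⟩ := sort2_spec a b fun a b => sort2 c d fun c d =>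
    sort2 a c fun a c => sort2 b d fun b d => sort2 b c fun b c => keyFour a b c d
  obtain ⟨c₂, d₂, -, p₂, e₂⟩ := sort2_spec c d fun c d =>
    sort2 a₁ c fun a c => sort2 b₁ d fun b d => sort2 b c fun b c => keyFour a b c d
  obtain ⟨a₃, c₃, -, p₃, e₃⟩ := sort2_spec a₁ c₂ fun a c =>
    sort2 b₁ d₂ fun b d => sort2 b c fun b c => keyFour a b c d
  obtain ⟨b₄, d₄, -, p₄, e₄⟩ := sort2_spec b₁ d₂ fun b d =>
    sort2 b c₃ fun b c => keyFour a₃ b c d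
  obtain ⟨b₅, c₅, -, p₅, e₅⟩ := sort2_spec b₄ c₃ fun b c => keyFour a₃ b c d₄
  refine ⟨a₃, b₅, c₅, d₄, ?_, e₁.trans (e₂.trans (e₃.trans (e₄.trans e₅)))⟩
  rw [List.perm_iff_count] at *
  intro x
  have h₁ := p₁ x
  have h₂ := p₂ x
  have h₃ := p₃ x
  have h₄ := p₄ x
  have h₅ := p₅ x
  simp only [List.count_cons, List.count_nil] at *
  omega

noncomputable def unkeyFour (k : ℕ) (K : ℕ → ℕ → ℕ → ℕ → Bool) : Bool :=
  unkey (Nat.div k 256) fun a b c => force (Nat.mod k 256) fun d => K a b c d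

theorem unkeyFour_keyFour (a b c d : Fin 140) (K : ℕ → ℕ → ℕ → ℕ → Bool) :
    unkeyFour (keyFour a b c d) K = K a b c d := by
  have hd := d.2
  have h₁ : Nat.div (keyFour a b c d) 256 = key a b c := by
    change (key a b c * 256 + d : ℕ) / 256 = key a b c
    omega
  have h₂ : Nat.mod (keyFour a b c d) 256 = d := by
    change (key a b c * 256 + d : ℕ) % 256 = d
    omega
  rw [unkeyFour, h₁, unkey_key, force_eq, h₂]

/-- Whether three of four cops are known to win, with the robber at a representative. -/
noncomputable def bad4 (r a b c d : ℕ) : Bool :=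
  or (bad r a b c) (or (bad r a b d) (or (bad r a c d) (bad r b c d)))

/-- The cop left out of the winning triple stays idle. -/
theorem caught_of_bad4 {r a b c d : Fin 140} (hr : (r : ℕ) < 3) (h : bad4 r a b c d = true) :
    Caught fullerene [a, b, c, d] r := by
  simp only [bad4, Bool.or_eq_true] at h
  rcases h with h | h | h | h
  · exact (caught_of_bad hr h).sublist (by simp)
  · exact (caught_of_bad hr h).sublist (by simp)
  · exact (caught_of_bad hr h).sublist (by simp)
  · exact (caught_of_bad hr h).sublist (by simp)

noncomputable def chaseValue (r a b c d : ℕ) (K : ℕ → Bool) : Bool :=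
  force (key4 a b c d) fun x => force ((chases r).find x) K

noncomputable def occ4 (a b c d u : ℕ) : Bool := or (Nat.beq u a) (occ3 b c d u)

theorem mem_of_occ4 {a b c d u : Fin 140} (h : occ4 a b c d u = true) : u ∈ [a, b, c, d] := by
  simpa only [occ4, occ3, Bool.or_eq_true, beq_iff, ← Fin.ext_iff, List.mem_cons, List.not_mem_nil,
    or_false] using h

/-- Carries out the turn of the cops with code `m`. -/
noncomputable def moved4 (m a b c d : ℕ) (K : ℕ → ℕ → ℕ → ℕ → Bool) : Bool :=
  cond (Nat.ble m 9) (moved3 m a b c fun a b c => K a b c d)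
    (cond (Nat.ble m 12) (force (nb d (Nat.sub m 10)) fun d => K a b c d) false)

theorem Turn.concat {l l' : List (Fin 140)} (h : Turn l l') (d : Fin 140) :
    Turn (l ++ [d]) (l' ++ [d]) := by
  obtain ⟨x, y, m, hs, p, p'⟩ := h
  exact ⟨x, y, m ++ [d], hs, p.append_right [d], p'.append_right [d]⟩

/-- The codes 10 to 12 move the fourth cop; codes up to 9 keep their meaning for three cops, with
the fourth standing still. -/
theorem moved4_spec {m : ℕ} {a b c d : Fin 140} {K : ℕ → ℕ → ℕ → ℕ → Bool}
    (h : moved4 m a b c d K = true) : ∃ a' b' c' d' : Fin 140,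
      Turn [a, b, c, d] [a', b', c', d'] ∧ K a' b' c' d' = true := by
  simp only [moved4, Bool.cond_eq_ite, force_eq, Nat.ble_eq] at h
  split_ifs at h with h0 h1
  · obtain ⟨x, y, z, ht, h⟩ := moved3_spec h
    exact ⟨x, y, z, d, ht.concat d, h⟩
  · obtain ⟨y, hy, hs⟩ := exists_nb d (j := m - 10) (by omega)
    refine ⟨a, b, c, y, ⟨d, y, [a, b, c], Or.inr hs,
      List.perm_append_comm (l₁ := [d]) (l₂ := [a, b, c]),
      List.perm_append_comm (l₁ := [y]) (l₂ := [a, b, c])⟩, ?_⟩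
    rw [hy]
    exact h

/-- Whether the turn recorded in `v` leads from the state with key `k` to states in which three
cops win, or to states with smaller values. -/
noncomputable def chaseEntry (r k v : ℕ) : Bool :=
  unkeyFour k fun a b c d => moved4 (Nat.mod v 16) a b c d fun a b c d =>
    replies r (occ4 a b c d) fun t s => force (tab t a) fun a => force (tab t b) fun b =>
      force (tab t c) fun c => force (tab t d) fun d =>
        or (bad4 s a b c d) (chaseValue s a b c d fun w => and (Nat.blt 0 w) (Nat.blt w v))

theorem chaseEntry_check0 : chases0.all (chaseEntry 0) = true := by decide +kernel

theorem chaseEntry_check1 : chases1.all (chaseEntry 1) = true := by decide +kernel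

theorem chaseEntry_check2 : chases2.all (chaseEntry 2) = true := by decide +kernel

/-- The induction is that of `caught_of_find`, with positions won by three of the cops as a further
way to end. The list therefore needs to follow the game only until three cops suffice. -/
theorem caught_of_chase (v : ℕ) : ∀ r a b c d : Fin 140, (r : ℕ) < 3 → 0 < v →
    (chases r).find (key4 a b c d) = v → Caught fullerene [a, b, c, d] r := by
  induction v using Nat.strong_induction_on with
  | _ v ih =>
    intro r a b c d hr hv hfind
    have hall : (chases r).all (chaseEntry r) = true := by
      rcases eq_of_lt_three hr with rfl | rfl | rfl
      exacts [chaseEntry_check0, chaseEntry_check1, chaseEntry_check2]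
    replace hall := BT.all_find hall (hfind ▸ hv)
    rw [hfind] at hall
    obtain ⟨a', b', c', d', hp, hk⟩ := key4_spec a b c d
    rw [hk, chaseEntry, unkeyFour_keyFour] at hall
    obtain ⟨x, y, z, w, ht, h⟩ := moved4_spec hall
    refine Caught.perm hp (ht.caught (replies_spec hr (fun u => mem_of_occ4) ?_ h))
    intro t φ s hφ hs hQ
    simp only [chaseValue, force_eq, Bool.or_eq_true, Bool.and_eq_true, blt_iff, ← hφ x, ← hφ y,
      ← hφ z, ← hφ w] at hQ
    rcases hQ with h | ⟨h, h'⟩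
    · exact caught_of_bad4 hs h
    · exact ih _ h' s (φ x) (φ y) (φ z) (φ w) hs h rfl

/-- The opening placement is fixed and the robber's vertex varies, so each vertex is normalized and
the four cops are carried along. -/
noncomputable def caughtFromStart (x : ℕ) : Bool :=
  or (occ4 22 56 84 117 x) (normalize x fun s g => force (g 22) fun a => force (g 56) fun b =>
    force (g 84) fun c => force (g 117) fun d =>
      or (bad4 s a b c d) (chaseValue s a b c d fun v => Nat.blt 0 v))

theorem caughtFromStart_check : allBelow 140 caughtFromStart = true := by decide +kernel

theorem copsWin_fullerene_four : CopsWin fullerene 1 4 := by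
  refine copsWin_of_forall_caught [22, 56, 84, 117] fun r hr => ?_
  have h := allBelow_iff.1 caughtFromStart_check r r.2
  rw [caughtFromStart, Bool.or_eq_true] at h
  rcases h with h | h
  · exact absurd (mem_of_occ4 (a := 22) (b := 56) (c := 84) (d := 117) h) hr
  · obtain ⟨g, φ, hg, hs, hK⟩ := exists_normalize r
    rw [hK] at h
    have ha : g 22 = φ 22 := hg 22
    have hb : g 56 = φ 56 := hg 56
    have hc : g 84 = φ 84 := hg 84
    have hd : g 117 = φ 117 := hg 117
    simp only [chaseValue, force_eq, Bool.or_eq_true, blt_iff, ha, hb, hc, hd] at h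
    refine Caught.of_map φ ?_
    rcases h with h | h
    · exact caught_of_bad4 hs h
    · exact caught_of_chase _ (φ r) (φ 22) (φ 56) (φ 84) (φ 117) hs h rfl

end Chase

/-! ### A drawing with straight edges. -/

section Drawing

/-- Some line separates the ends `a`, `b` of one segment from the ends `c`, `d` of another. -/
def Separated (a b c d : ℝ × ℝ) : Prop :=
  ∃ α β γ : ℝ, α * a.1 + β * a.2 ≤ γ ∧ α * b.1 + β * b.2 ≤ γ ∧
    γ < α * c.1 + β * c.2 ∧ γ < α * d.1 + β * d.2

/-- The point that divides the segment from `a` to `b` in the ratio `t : 1 - t`. -/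
def onSegment (a b : ℝ × ℝ) (t : ℝ) : ℝ × ℝ :=
  ((1 - t) * a.1 + t * b.1, (1 - t) * a.2 + t * b.2)

/-- By convexity the linear functional is at most `γ` on the whole first segment and greater than
`γ` on the whole second one. -/
theorem Separated.onSegment_ne {a b c d : ℝ × ℝ} (h : Separated a b c d) {t u : ℝ}
    (ht : t ∈ unitInterval) (hu : u ∈ unitInterval) : onSegment a b t ≠ onSegment c d u := by
  obtain ⟨α, β, γ, ha, hb, hc, hd⟩ := h
  intro he
  obtain ⟨h₁, h₂⟩ := Prod.ext_iff.1 he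
  simp only [onSegment] at h₁ h₂
  obtain ⟨t0, t1⟩ := ht
  obtain ⟨u0, u1⟩ := hu
  have hle : (1 - t) * (α * a.1 + β * a.2) + t * (α * b.1 + β * b.2) ≤ γ := by
    nlinarith
  have hlt : γ < (1 - u) * (α * c.1 + β * c.2) + u * (α * d.1 + β * d.2) := by
    -- The strict inequality must come from an end with positive weight: this is `c` if `u = 0`, and
    -- otherwise `d` can be used.
    rcases eq_or_lt_of_le u0 with rfl | hu
    · simpa using hc
    · nlinarith
  have : (1 - t) * (α * a.1 + β * a.2) + t * (α * b.1 + β * b.2) =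
      (1 - u) * (α * c.1 + β * c.2) + u * (α * d.1 + β * d.2) := by
    linear_combination α * h₁ + β * h₂
  linarith

def cross (a b c : ℝ × ℝ) : ℝ := (b.1 - a.1) * (c.2 - a.2) - (b.2 - a.2) * (c.1 - a.1)

/-- With the origin at `a` the equation reads `t (b - a) = u (c - a)`. Taking the determinant with
`c - a` removes the right side. -/
theorem eq_zero_of_onSegment_eq {a b c : ℝ × ℝ} (h : cross a b c ≠ 0) {t u : ℝ}
    (he : onSegment a b t = onSegment a c u) : t = 0 := by
  obtain ⟨h₁, h₂⟩ := Prod.ext_iff.1 he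
  simp only [onSegment] at h₁ h₂
  refine (mul_eq_zero.1 (?_ : t * cross a b c = 0)).resolve_right h
  unfold cross
  linear_combination (c.2 - a.2) * h₁ - (c.1 - a.1) * h₂

/-- Two segments are apart if some line separates them. -/
def Apart (a b c d : ℝ × ℝ) : Prop := Separated a b c d ∨ Separated c d a b

theorem Apart.symm {a b c d : ℝ × ℝ} (h : Apart a b c d) : Apart c d a b := Or.symm h

theorem Separated.swap_left {a b c d : ℝ × ℝ} : Separated a b c d → Separated b a c d
  | ⟨α, β, γ, ha, hb, hc, hd⟩ => ⟨α, β, γ, hb, ha, hc, hd⟩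

theorem Separated.swap_right {a b c d : ℝ × ℝ} : Separated a b c d → Separated a b d c
  | ⟨α, β, γ, ha, hb, hc, hd⟩ => ⟨α, β, γ, ha, hb, hd, hc⟩

theorem Apart.swap_left {a b c d : ℝ × ℝ} (h : Apart a b c d) : Apart b a c d :=
  h.imp Separated.swap_left Separated.swap_right

theorem Apart.swap_right {a b c d : ℝ × ℝ} (h : Apart a b c d) : Apart a b d c :=
  h.imp Separated.swap_right Separated.swap_left

theorem Apart.onSegment_ne {a b c d : ℝ × ℝ} (h : Apart a b c d) {t u : ℝ}
    (ht : t ∈ unitInterval) (hu : u ∈ unitInterval) : onSegment a b t ≠ onSegment c d u :=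
  h.elim (fun h => h.onSegment_ne ht hu) fun h => (h.onSegment_ne hu ht).symm

theorem onSegment_symm (a b : ℝ × ℝ) (t : ℝ) : onSegment a b (1 - t) = onSegment b a t := by
  ext <;> simp only [onSegment] <;> ring

/-- A graph is planar if it has a drawing with straight edges. -/
theorem isPlanar_of_segments {V : Type*} {G : SimpleGraph V} (p : V → ℝ × ℝ)
    (hp : Function.Injective p)
    (hv : ∀ a b v, G.Adj a b → v ≠ a → v ≠ b → Apart (p a) (p b) (p v) (p v))
    (he : ∀ a b c d, G.Adj a b → G.Adj c d → a ≠ c → a ≠ d → b ≠ c → b ≠ d →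
      Apart (p a) (p b) (p c) (p d))
    (hc : ∀ a b c, G.Adj a b → G.Adj a c → b ≠ c → cross (p a) (p b) (p c) ≠ 0) :
    IsPlanar G := by
  classical
  -- `Quot.out` picks a direction for each edge, which serves only to parametrize its arc.
  let x : G.edgeSet → V := fun e => (e : Sym2 V).out.1
  let y : G.edgeSet → V := fun e => (e : Sym2 V).out.2
  have hxy : ∀ e : G.edgeSet, (e : Sym2 V) = s(x e, y e) := fun e => (Quot.out_eq _).symm
  have hadj : ∀ e, G.Adj (x e) (y e) := fun e => by
    have := e.2
    rwa [hxy e, SimpleGraph.mem_edgeSet] at this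
  have h0 : ∀ a b : ℝ × ℝ, onSegment a b 0 = a := fun a b => by ext <;> simp [onSegment]
  have h1 : ∀ a b : ℝ × ℝ, onSegment a b 1 = b := fun a b => by ext <;> simp [onSegment]
  have hdiag : ∀ a : ℝ × ℝ, ∀ t, onSegment a a t = a := fun a t => by
    ext <;> simp only [onSegment] <;> ring
  -- Two different edges that start at the same vertex are not collinear, so they meet only there.
  -- The other coincidences of ends reduce to this one by reversing parametrizations with
  -- `onSegment_symm`.
  have key : ∀ {a b c d : V} {t u : ℝ}, G.Adj a b → G.Adj c d → s(a, b) ≠ s(c, d) → a = c →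
      onSegment (p a) (p b) t = onSegment (p c) (p d) u → onSegment (p a) (p b) t = p a := by
    rintro a b _ d t u hab hcd hne rfl e
    have hbd : b ≠ d := fun h => hne (by rw [h])
    rw [eq_zero_of_onSegment_eq (hc _ _ _ hab hcd hbd) e, h0]
  refine ⟨⟨p, fun e => ⟨fun t => onSegment (p (x e)) (p (y e)) t, ?_⟩, hp, fun e t u htu => ?_,
    fun e => ?_, fun e t v htv => ?_, fun e f hef t u htu => ?_⟩⟩
  · unfold onSegment
    fun_prop
  · have hne : p (x e) ≠ p (y e) := hp.ne (hadj e).ne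
    obtain ⟨h₁, h₂⟩ := Prod.ext_iff.1 htu
    simp only [ContinuousMap.coe_mk, onSegment] at h₁ h₂
    by_contra htu'
    have htu' : (t : ℝ) - u ≠ 0 := sub_ne_zero.2 fun h => htu' (Subtype.ext h)
    refine hne (Prod.ext ?_ ?_)
    · refine (sub_eq_zero.1 ((mul_eq_zero.1 (?_ : _ * ((p (y e)).1 - (p (x e)).1) = 0)).resolve_left htu')).symm
      linear_combination h₁
    · refine (sub_eq_zero.1 ((mul_eq_zero.1 (?_ : _ * ((p (y e)).2 - (p (x e)).2) = 0)).resolve_left htu')).symm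
      linear_combination h₂
  · rw [hxy e, Sym2.map_mk]
    simp only [ContinuousMap.coe_mk, Set.Icc.coe_zero, Set.Icc.coe_one, h0, h1]
  · rw [hxy e, Sym2.mem_iff]
    by_contra hcon
    push Not at hcon
    -- The vertex `v` is treated as a degenerate segment with both ends at `p v`.
    exact (hv _ _ v (hadj e) hcon.1 hcon.2).onSegment_ne t.2 t.2 (htv.trans (hdiag _ _).symm)
  · have hne : s(x e, y e) ≠ s(x f, y f) := fun h =>
      hef (Subtype.ext ((hxy e).trans (h.trans (hxy f).symm)))
    have htu : onSegment (p (x e)) (p (y e)) t = onSegment (p (x f)) (p (y f)) u := htu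
    change ∃ v, _ ∧ _ ∧ onSegment (p (x e)) (p (y e)) t = p v
    simp only [hxy e, hxy f, Sym2.mem_iff]
    have hf := onSegment_symm (p (y f)) (p (x f)) u
    have he' := onSegment_symm (p (y e)) (p (x e)) t
    by_cases h₁ : x e = x f
    · exact ⟨x e, Or.inl rfl, Or.inl h₁, key (hadj e) (hadj f) hne h₁ htu⟩
    by_cases h₂ : x e = y f
    · exact ⟨x e, Or.inl rfl, Or.inr h₂, key (hadj e) (hadj f).symm (by rwa [Sym2.eq_swap (a := y f)])
        h₂ (htu.trans hf.symm)⟩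
    by_cases h₃ : y e = x f
    · refine ⟨y e, Or.inr rfl, Or.inl h₃, ?_⟩
      rw [← he'] at htu ⊢
      exact key (hadj e).symm (hadj f) (by rwa [Sym2.eq_swap (a := y e)]) h₃ htu
    by_cases h₄ : y e = y f
    · refine ⟨y e, Or.inr rfl, Or.inr h₄, ?_⟩
      rw [← he'] at htu ⊢
      exact key (hadj e).symm (hadj f).symm
        (by rwa [Sym2.eq_swap (a := y e), Sym2.eq_swap (a := y f)]) h₄ (htu.trans hf.symm)
    · exact absurd htu ((he _ _ _ _ (hadj e) (hadj f) h₁ h₂ h₃ h₄).onSegment_ne t.2 u.2)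

/-- The coordinates of the vertices in a drawing with straight edges. -/
noncomputable def tabX : ℕ := 0x86827e8986837f817a86898d898d847c77787d79868d918890827e74757c82758b9195948b8f847b786f707783728f9699978992827d766a6d757c8b6b969a9a968b8f857a7164666e7c91669ca19f998a91827c705c626f9c895ba2a49f978d8677685862a6914faaaca4998d837b694b75ab37acb3a19388765968ca00b0c4a7938067fa51c19f86ebc2a1

noncomputable def tabY : ℕ := 0x7c7a7d7a808281767c74767c828186857f84757870747b86848a897d876f6d7870767e8289888d8c8c80866e66746c747e858d8b9190907d8b676265756e78828a9090959391838a655a5f6e6b78848e949399989881915b635572707f8b93969e9c9b8c516146666d8290999ca4a4a79636517c8e78989faaabae005b77977b9ea7b1cc3eff97aac1dcb8bb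

/-- The point that represents a vertex. -/
noncomputable def coord (v : ℕ) : ℝ × ℝ := (tab tabX v, tab tabY v)

/-- The orientation determinant of three points is split into its positive and negative terms, so
that its sign is decided by comparing natural numbers, without subtraction. -/
noncomputable def posPart (xa ya xb yb xc yc : ℕ) : ℕ :=
  Nat.add (Nat.mul xa yb) (Nat.add (Nat.mul xb yc) (Nat.mul xc ya))

noncomputable def negPart (xa ya xb yb xc yc : ℕ) : ℕ :=
  Nat.add (Nat.mul xa yc) (Nat.add (Nat.mul xb ya) (Nat.mul xc yb))

/-- One coordinate of a bounding box test; with strict inequalities it is a separation by an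
axis-parallel line. -/
noncomputable def below2 (a b c d : ℕ) : Bool :=
  and (Nat.blt a c) (and (Nat.blt a d) (and (Nat.blt b c) (Nat.blt b d)))

/-- Whether both `c` and `d` are on the same side of the line through `a` and `b`. -/
noncomputable def sameSide (xa ya xb yb xc yc xd yd : ℕ) : Bool :=
  or (and (Nat.blt (negPart xa ya xb yb xc yc) (posPart xa ya xb yb xc yc))
      (Nat.blt (negPart xa ya xb yb xd yd) (posPart xa ya xb yb xd yd)))
    (and (Nat.blt (posPart xa ya xb yb xc yc) (negPart xa ya xb yb xc yc))
      (Nat.blt (posPart xa ya xb yb xd yd) (negPart xa ya xb yb xd yd)))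

noncomputable def withCoord (v : ℕ) (K : ℕ → ℕ → Bool) : Bool :=
  force (tab tabX v) fun x => force (tab tabY v) fun y => K x y

/-- The four box tests come first because they need no products. For the remaining pairs the line
through one segment has the other strictly on one side. -/
noncomputable def apart (a b c d : ℕ) : Bool :=
  withCoord a fun xa ya => withCoord b fun xb yb => withCoord c fun xc yc => withCoord d fun xd yd =>
    or (below2 xa xb xc xd) (or (below2 xc xd xa xb) (or (below2 ya yb yc yd) (or (below2 yc yd ya yb)
      (or (sameSide xa ya xb yb xc yc xd yd) (sameSide xc yc xd yd xa ya xb yb)))))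

theorem cast_posPart_sub (xa ya xb yb xc yc : ℕ) :
    (posPart xa ya xb yb xc yc : ℝ) - negPart xa ya xb yb xc yc =
      cross (xa, ya) (xb, yb) (xc, yc) := by
  change ((xa * yb + (xb * yc + xc * ya) : ℕ) : ℝ) - ((xa * yc + (xb * ya + xc * yb) : ℕ) : ℝ) = _
  simp only [cross]
  push_cast
  ring

theorem Apart.of_below2 {xa ya xb yb xc yc xd yd : ℕ} (h : below2 xa xb xc xd = true) :
    Apart (xa, ya) (xb, yb) (xc, yc) (xd, yd) := by
  simp only [below2, Bool.and_eq_true, blt_iff] at h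
  -- The functional is the first coordinate, and the threshold is the right edge of the first box.
  -- The second coordinate is handled through `Apart.flip`.
  refine Or.inl ⟨1, 0, max xa xb, ?_, ?_, ?_, ?_⟩
  · simp
  · simp
  · simpa using ⟨h.1, h.2.2.1⟩
  · simpa using ⟨h.2.1, h.2.2.2⟩

theorem Separated.flip {a b c d : ℝ × ℝ} :
    Separated a.swap b.swap c.swap d.swap → Separated a b c d
  | ⟨α, β, γ, h⟩ => ⟨β, α, γ, by
    simpa only [Prod.fst_swap, Prod.snd_swap, add_comm] using h⟩

theorem Apart.flip {a b c d : ℝ × ℝ} (h : Apart a.swap b.swap c.swap d.swap) : Apart a b c d :=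
  h.imp Separated.flip Separated.flip

/-- The functional is a normal of the line through the first segment, signed towards the second. It
is constant on that line, which is why `Separated` is strict on one side only. -/
theorem Apart.of_sameSide {xa ya xb yb xc yc xd yd : ℕ}
    (h : sameSide xa ya xb yb xc yc xd yd = true) :
    Apart (xa, ya) (xb, yb) (xc, yc) (xd, yd) := by
  simp only [sameSide, Bool.or_eq_true, Bool.and_eq_true, blt_iff] at h
  have hc := cast_posPart_sub xa ya xb yb xc yc
  have hd := cast_posPart_sub xa ya xb yb xd yd
  simp only [cross] at hc hd
  rcases h with ⟨h₁, h₂⟩ | ⟨h₁, h₂⟩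
  · have h₁ := (Nat.cast_lt (α := ℝ)).2 h₁
    have h₂ := (Nat.cast_lt (α := ℝ)).2 h₂
    refine Or.inl ⟨(ya : ℝ) - yb, (xb : ℝ) - xa, ((ya : ℝ) - yb) * xa + ((xb : ℝ) - xa) * ya,
      le_rfl, ?_, ?_, ?_⟩ <;> simp only <;> linarith
  · have h₁ := (Nat.cast_lt (α := ℝ)).2 h₁
    have h₂ := (Nat.cast_lt (α := ℝ)).2 h₂
    refine Or.inl ⟨(yb : ℝ) - ya, (xa : ℝ) - xb, ((yb : ℝ) - ya) * xa + ((xa : ℝ) - xb) * ya,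
      le_rfl, ?_, ?_, ?_⟩ <;> simp only <;> linarith

theorem Apart.of_apart {a b c d : ℕ} (h : apart a b c d = true) :
    Apart (coord a) (coord b) (coord c) (coord d) := by
  simp only [apart, withCoord, force_eq, Bool.or_eq_true] at h
  rcases h with h | h | h | h | h | h
  · exact Apart.of_below2 h
  · exact (Apart.of_below2 h).symm
  · exact Apart.flip (Apart.of_below2 h)
  · exact Apart.flip (Apart.of_below2 h).symm
  · exact Apart.of_sameSide h
  · exact (Apart.of_sameSide h).symm

theorem coord_check : (allBelow 140 fun a => allBelow a fun b =>
    or (not (Nat.beq (tab tabX a) (tab tabX b))) (not (Nat.beq (tab tabY a) (tab tabY b)))) = true := by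
  decide +kernel

theorem vertex_check : (allBelow 140 fun a => allBelow 3 fun j => force (nb a j) fun b =>
    or (Nat.blt b a) (allBelow 140 fun v => or (Nat.beq v a) (or (Nat.beq v b)
      (apart a b v v)))) = true := by
  decide +kernel

/-- Edges are taken with their smaller ends `a` and `c` first, and `c < a`, so each pair is tested
once. Then `c` differs from `a` and `b` automatically, and only `d` can be a common end. -/
theorem edge_check : (allBelow 140 fun a => allBelow 3 fun j => force (nb a j) fun b =>
    or (Nat.blt b a) (allBelow a fun c => allBelow 3 fun i => force (nb c i) fun d =>
      or (Nat.blt d c) (or (Nat.beq d a) (or (Nat.beq d b) (apart a b c d))))) = true := by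
  decide +kernel

/-- Different indices stand for different neighbours. The test excludes every collinear pair of
edges at a vertex, opposite ones included, which is more than planarity needs but is a single
inequation. -/
theorem angle_check : (allBelow 140 fun a => allBelow 3 fun j => allBelow 3 fun i =>
    or (Nat.beq i j) (withCoord a fun xa ya => withCoord (nb a i) fun xb yb =>
      withCoord (nb a j) fun xc yc =>
        not (Nat.beq (posPart xa ya xb yb xc yc) (negPart xa ya xb yb xc yc)))) = true := by
  decide +kernel

theorem coord_injective : Function.Injective fun v : Fin 140 => coord v := by
  have key : ∀ a b : Fin 140, b < a → coord a ≠ coord b := fun a b hab he => by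
    have := allBelow_iff.1 (allBelow_iff.1 coord_check a a.2) b hab
    simp only [Bool.or_eq_true, Bool.not_eq_true', ← Bool.not_eq_true, beq_iff] at this
    obtain ⟨h₁, h₂⟩ := Prod.ext_iff.1 he
    exact this.elim (fun h => h (Nat.cast_injective h₁)) fun h => h (Nat.cast_injective h₂)
  intro a b he
  rcases lt_trichotomy a b with h | h | h
  exacts [absurd he.symm (key b a h), h, absurd he (key a b h)]

theorem apart_vertex {a b v : Fin 140} (h : fullerene.Adj a b) (ha : v ≠ a) (hb : v ≠ b) :
    Apart (coord a) (coord b) (coord v) (coord v) := by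
  wlog hab : a < b generalizing a b
  · exact (this h.symm hb ha (lt_of_le_of_ne (not_lt.1 hab) h.ne')).swap_left
  obtain ⟨j, hj, e⟩ := fullerene_adj.1 h
  have := allBelow_iff.1 (allBelow_iff.1 vertex_check a a.2) j hj
  rw [force_eq, e, Bool.or_eq_true, blt_iff, allBelow_iff] at this
  have := (this.resolve_left (not_lt.2 hab.le)) v v.2
  simp only [Bool.or_eq_true, beq_iff, ← Fin.ext_iff, ha, hb, false_or] at this
  exact Apart.of_apart this

theorem apart_edge_of_lt {a b c d : Fin 140} (hab : fullerene.Adj a b) (hcd : fullerene.Adj c d)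
    (had : a ≠ d) (hbd : b ≠ d) (hlt : a < b) (hlt' : c < d) (hca : c < a) :
    Apart (coord a) (coord b) (coord c) (coord d) := by
  obtain ⟨j, hj, e⟩ := fullerene_adj.1 hab
  obtain ⟨i, hi, e'⟩ := fullerene_adj.1 hcd
  have := allBelow_iff.1 (allBelow_iff.1 edge_check a a.2) j hj
  rw [force_eq, e, Bool.or_eq_true, blt_iff, allBelow_iff] at this
  have := allBelow_iff.1 ((this.resolve_left (not_lt.2 hlt.le)) c hca) i hi
  rw [force_eq, e', Bool.or_eq_true, blt_iff] at this
  have := this.resolve_left (not_lt.2 hlt'.le)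
  simp only [Bool.or_eq_true, beq_iff, ← Fin.ext_iff, had.symm, hbd.symm, false_or] at this
  exact Apart.of_apart this

/-- Reversing either edge and exchanging the two edges bring any disjoint pair into the order that
`edge_check` covers. -/
theorem apart_edge {a b c d : Fin 140} (hab : fullerene.Adj a b) (hcd : fullerene.Adj c d)
    (hac : a ≠ c) (had : a ≠ d) (hbc : b ≠ c) (hbd : b ≠ d) :
    Apart (coord a) (coord b) (coord c) (coord d) := by
  wlog hlt : a < b generalizing a b
  · exact (this hab.symm hbc hbd hac had (lt_of_le_of_ne (not_lt.1 hlt) hab.ne')).swap_left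
  wlog hlt' : c < d generalizing c d
  · exact (this hcd.symm had hac hbd hbc (lt_of_le_of_ne (not_lt.1 hlt') hcd.ne')).swap_right
  rcases lt_or_gt_of_ne hac with h | h
  · exact (apart_edge_of_lt hcd hab hbc.symm hbd.symm hlt' hlt h).symm
  · exact apart_edge_of_lt hab hcd had hbd hlt hlt' h

theorem cross_ne_zero {a b c : Fin 140} (hab : fullerene.Adj a b) (hac : fullerene.Adj a c)
    (hbc : b ≠ c) : cross (coord a) (coord b) (coord c) ≠ 0 := by
  obtain ⟨i, hi, e⟩ := fullerene_adj.1 hab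
  obtain ⟨j, hj, e'⟩ := fullerene_adj.1 hac
  have := allBelow_iff.1 (allBelow_iff.1 (allBelow_iff.1 angle_check a a.2) j hj) i hi
  rw [Bool.or_eq_true, beq_iff] at this
  have := this.resolve_left fun h => hbc (Fin.ext (e.symm.trans (h ▸ e')))
  simp only [withCoord, force_eq, Bool.not_eq_true', ← Bool.not_eq_true, beq_iff, e, e'] at this
  rw [coord, coord, coord, ← cast_posPart_sub, sub_ne_zero]
  exact fun h => this (Nat.cast_injective h)

theorem fullerene_isPlanar : IsPlanar fullerene :=
  isPlanar_of_segments (fun v => coord v) coord_injective (fun _ _ _ => apart_vertex)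
    (fun _ _ _ _ => apart_edge) fun _ _ _ => cross_ne_zero

end Drawing

end CopsRobber

theorem mainTheorem3 :
    ∃ (V : Type) (_ : Fintype V) (G : SimpleGraph V),
      Fintype.card V ≤ 720 ∧ G.Connected ∧ CopsRobber.IsPlanar G ∧
        CopsRobber.copMoveNumber G 1 = 4 :=
  ⟨Fin 140, inferInstance, CopsRobber.fullerene, by simp, CopsRobber.fullerene_connected,
    CopsRobber.fullerene_isPlanar, CopsRobber.copMoveNumber_eq_succ
      CopsRobber.copsWin_fullerene_four CopsRobber.not_copsWin_fullerene_three⟩
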